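/- Let $\phi:\mathbb{R}\to\mathbb{C}$ satisfy the following two conditions. (A) $\phi$ is continuous and continuously differentiable on $\mathbb{R}$ except at finitely many points $a_i$, at which $\phi$ and $\phi'$ have only discontinuities of the first kind (finite one-sided limits), and at which $\phi(a_i)=\frac12\,[\phi(a_i+0)+\phi(a_i-0)]$. (B) There is $b>0$ such that $\phi(x)e^{x/2}$ and $\phi'(x)e^{x/2}$ are $\mathcal{O}(e^{-(1/2+b)|x|})$ as $x\to\pm\infty$. Then for every real $a<1$ with $0<a<b$, $\phi$ has a two-sided Laplace transform $$\Phi(s)=\int_{-\infty}^{+\infty}\phi(x)e^{-sx}\,dx ,$$ the integral converging absolutely for $-(1+a)\le\Re s\le a$; it is holomorphic in the strip $-(1+a)<\Re s<a$, and it is $\mathcal{O}(1/|t|)$, $t=\Im s$, uniformly in the strip $-(1+a)\le\Re s\le a$. Moreover, let $q\ge1$ be an integer and $\chi$ a primitive Dirichlet character modulo $q$. Put $\delta_{q,1}=1$ if $q=1$ and $\delta_{q,1}=0$ otherwise, and $\mathfrak a=0$ if $\chi(-1)=1$ and $\mathfrak a=1$ otherwise. Let $Z(\chi)$ be the set of nontrivial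 zeros of $L(s,\chi)$, that is, those with $0<\Re s<1$ (for $q=1$, $L(s,\chi)=\zeta(s)$). Then $$\sum_{n\ge1}\Lambda(n)\chi(n)\phi(\log n)=\delta_{q,1}\big(\Phi(-1)+\Phi(0)\big)-\sum_{\varrho\in Z(\chi)}\Phi(-\varrho)+\phi(0)\log\frac q\pi-\sum_{n\ge1}\frac{\Lambda(n)\overline{\chi}(n)}{n}\phi(-\log n)+\lim_{T\to+\infty}\frac1{2i\pi}\int_{1/2-iT}^{1/2+iT}\Re\frac{\Gamma'}{\Gamma}\Big(\frac{s+\mathfrak a}2\Big)\Phi(-s)\,ds .$$ Here the two sums over $n$ converge absolutely; the sum over zeros, counted with multiplicity, is $\lim_{T\to+\infty}\sum_{|\Im\varrho|\le T}\Phi(-\varrho)$, where each truncated sum is finite and the limit exists; and the limit of integrals exists. -/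

import Mathlib

open Filter Topology Asymptotics

noncomputable section

/-- `φ` is continuous and continuously differentiable on `ℝ` outside a finite set `S`; at each
point of `S` both `φ` and `φ'` have finite one-sided limits, and `φ` takes there the mean of its
two one-sided limits. -/
def PiecewiseC1WithMeanValue (φ : ℝ → ℂ) : Prop :=
  ∃ S : Finset ℝ,
    (∀ x : ℝ, x ∉ S → DifferentiableAt ℝ φ x) ∧
    (∀ x : ℝ, x ∉ S → ContinuousAt (deriv φ) x) ∧
    ∀ x ∈ S,
      (∃ l r : ℂ, Tendsto φ (𝓝[<] x) (𝓝 l) ∧ Tendsto φ (𝓝[>] x) (𝓝 r) ∧ φ x = (l + r) / 2) ∧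
      (∃ l' r' : ℂ, Tendsto (deriv φ) (𝓝[<] x) (𝓝 l') ∧ Tendsto (deriv φ) (𝓝[>] x) (𝓝 r'))

/-- `φ(x) e^{x/2}` and `φ'(x) e^{x/2}` are `O(e^{-(1/2+b)|x|})` as `x → ±∞`. -/
def ExpDecay (φ : ℝ → ℂ) (b : ℝ) : Prop :=
  ((fun x : ℝ => φ x * (Real.exp (x / 2) : ℂ)) =O[cocompact ℝ]
      fun x : ℝ => Real.exp (-(1 / 2 + b) * |x|)) ∧
  ((fun x : ℝ => deriv φ x * (Real.exp (x / 2) : ℂ)) =O[cocompact ℝ]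
      fun x : ℝ => Real.exp (-(1 / 2 + b) * |x|))

/-- The (two-sided) Laplace transform `Φ(s) = ∫_{-∞}^{∞} φ(x) e^{-sx} dx`. -/
def laplaceTransform (φ : ℝ → ℂ) (s : ℂ) : ℂ :=
  ∫ x : ℝ, φ x * Complex.exp (-s * x)

/-- The nontrivial zeros of `L(s, χ)`: those with `0 < Re s < 1`. For `q = 1`, `L(s, χ) = ζ(s)`. -/
def nontrivialZeros {q : ℕ} [NeZero q] (χ : DirichletCharacter ℂ q) : Set ℂ :=
  {ρ : ℂ | 0 < ρ.re ∧ ρ.re < 1 ∧ DirichletCharacter.LFunction χ ρ = 0}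

/-- The nontrivial zeros of `L(s, χ)` of height at most `T`. -/
def zerosUpTo {q : ℕ} [NeZero q] (χ : DirichletCharacter ℂ q) (T : ℝ) : Set ℂ :=
  {ρ : ℂ | ρ ∈ nontrivialZeros χ ∧ |ρ.im| ≤ T}

/-- The sum of `f(ρ)` over the nontrivial zeros `ρ` of `L(s, χ)` with `|Im ρ| ≤ T`, each counted
with its multiplicity. -/
def sumOverZerosUpTo {q : ℕ} [NeZero q] (χ : DirichletCharacter ℂ q) (f : ℂ → ℂ) (T : ℝ) : ℂ :=
  ∑ᶠ ρ ∈ zerosUpTo χ T, (analyticOrderNatAt (DirichletCharacter.LFunction χ) ρ : ℂ) * f ρ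

open Classical in
/-- `δ = 1` if `q = 1` and `δ = 0` otherwise. -/
def deltaOne (q : ℕ) : ℂ := if q = 1 then 1 else 0

open Classical in
/-- `𝔞 = 0` if `χ(-1) = 1` and `𝔞 = 1` otherwise. -/
def parityIndex {q : ℕ} (χ : DirichletCharacter ℂ q) : ℂ := if χ (-1) = 1 then 0 else 1

/-- `(1 / 2πi) ∫_{1/2-iT}^{1/2+iT} Re (Γ'/Γ)((s+𝔞)/2) Φ(-s) ds`, with `s = 1/2 + it`,
`ds = i dt`. -/
def gammaIntegral {q : ℕ} (χ : DirichletCharacter ℂ q) (φ : ℝ → ℂ) (T : ℝ) : ℂ :=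
  1 / (2 * Real.pi * Complex.I) *
    ∫ t : ℝ in (-T)..T,
      ((Complex.digamma ((1 / 2 + t * Complex.I + parityIndex χ) / 2)).re : ℂ) *
        laplaceTransform φ (-(1 / 2 + t * Complex.I)) * Complex.I

end

/-!
The explicit formula comes from the argument principle, applied with the weight `F(s) = Φ(-s)` to
the entire completed function `ξ(s, χ)` (`xiFunction`) on rectangles `[-a, 1 + a] × [-T, T]`; the
functional equation relates `ξ(1 - s, χ)` to `ξ(s, χ⁻¹)`.

*The test function.* On the line `Re s = σ`, the function `F` is the Fourier integral of
`φ(x) e^{σx}`, which is piecewise continuously differentiable with mean values at its jumps and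
decays exponentially, together with its derivative (`StripDecay`). One integration by parts gives
`F(s) = O(1 / |Im s|)`. This is not absolutely integrable, so Fourier inversion is the statement
that the symmetric truncations `∫_{-T}^{T}` converge to `2π` times the mean value
(`DecayingPiecewiseC1.tendsto_integral_fourierInt`); they are moreover bounded uniformly in the
point and in `T` (`DecayingPiecewiseC1.norm_integral_fourierInt_le`). Both facts follow by writing
the function as an integral of its derivative and its jumps against a sign kernel, whose truncated
inversion is the sine integral.

*The contour.* The logarithmic derivative of `ξ` is the sum of `1/s + 1/(s - 1)` (for `q = 1`),
a Gamma term, and `L'/L`. The polar term gives `Φ(0) + Φ(-1)` by Cauchy's formula. The Gamma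
terms have no singularity between the vertical sides and the critical line; moved there from both
sides, they add up to `log(q/π) + Re (Γ'/Γ)((s + 𝔞)/2)`, as the digamma function commutes with
conjugation (`contour_identity`, `gammaTerm_add_gammaTerm_one_sub`). On the vertical sides,
`L'/L` is a Dirichlet series: the uniform bound allows inverting it term by term
(`DecayingPiecewiseC1.tendsto_integral_LSeries_mul`), which yields the two sums over `n`. On the
critical line, `log(q/π)` contributes `φ(0) log(q/π)` by Fourier inversion at zero, and the limit
of the Gamma integral exists since digamma is a logarithm up to an error decaying like a power,
while the logarithm integrates against `F` by parts (`exists_tendsto_integral_digamma_mul`).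

*The horizontal sides.* Only `L'/L` to the right of the critical line, for `χ` and for `χ⁻¹`, is
left on them. Partial summation shows `L(s, χ) = O(|s|)` for `Re s ≥ 1/10`, and Landau's lemma
(`landau_bound`: division by Blaschke factors, Borel–Carathéodory and Cauchy's estimate) then
bounds the number of zeros near height `T` by `O(log T)`, and `L'/L` by `O(log T)` plus a sum over
these zeros. By pigeonhole every interval `[T, T + 1/2]` contains a height whose distance to all
ordinates is at least of order `1 / log T` (`exists_goodHeight`). There `L'/L = O(log² T)`, and the
horizontal sides are `O(log² T / T)`. Passing from this height back to `T` changes the sum over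
zeros by `O(log T / T)`, so that its limit exists along all `T`.
-/

noncomputable section

/-! ### Piecewise continuously differentiable functions with exponential decay -/

/-- `g` is continuously differentiable outside the finite set `S`, where `g` and `g'` have one-sided
limits and `g` takes the mean value of its one-sided limits. -/
def PiecewiseC1On (S : Finset ℝ) (g : ℝ → ℂ) : Prop :=
  (∀ x : ℝ, x ∉ S → DifferentiableAt ℝ g x) ∧
  (∀ x : ℝ, x ∉ S → ContinuousAt (deriv g) x) ∧
  ∀ x ∈ S,
    (∃ l r : ℂ, Tendsto g (𝓝[<] x) (𝓝 l) ∧ Tendsto g (𝓝[>] x) (𝓝 r) ∧ g x = (l + r) / 2) ∧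
    (∃ l' r' : ℂ, Tendsto (deriv g) (𝓝[<] x) (𝓝 l') ∧ Tendsto (deriv g) (𝓝[>] x) (𝓝 r'))

/-- A function with one-sided limits at every point, of exponential decay at infinity, has
exponential decay on the whole line. -/
lemma exists_bound_of_oneSided_limits {f : ℝ → ℂ} {ε : ℝ}
    (hf : ∀ x, ∃ l r : ℂ, Tendsto f (𝓝[<] x) (𝓝 l) ∧ Tendsto f (𝓝[>] x) (𝓝 r))
    (hO : f =O[cocompact ℝ] fun x => Real.exp (-ε * |x|)) :
    ∃ C, 0 ≤ C ∧ ∀ x, ‖f x‖ ≤ C * Real.exp (-ε * |x|) := by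
  have loc : ∀ x, ∃ M, 0 ≤ M ∧ ∀ᶠ y in 𝓝 x, ‖f y‖ ≤ M * Real.exp (-ε * |y|) := by
    intro x
    obtain ⟨l, r, hl, hr⟩ := hf x
    have hw : Continuous fun y : ℝ => Real.exp (-ε * |y|) := by fun_prop
    have key : ∀ (F : Filter ℝ) (a : ℂ), F ≤ 𝓝 x → Tendsto f F (𝓝 a) →
        ∀ᶠ y in F, ‖f y‖ ≤ ((‖a‖ + 1) * (2 / Real.exp (-ε * |x|))) * Real.exp (-ε * |y|) := by
      intro F a hF ha
      have h1 : ∀ᶠ y in F, ‖f y‖ < ‖a‖ + 1 :=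
        ha.norm.eventually (gt_mem_nhds (lt_add_one _))
      have h2 : ∀ᶠ y in F, Real.exp (-ε * |x|) / 2 < Real.exp (-ε * |y|) :=
        hF (hw.continuousAt.eventually (lt_mem_nhds (half_lt_self (Real.exp_pos _))))
      filter_upwards [h1, h2] with y hy1 hy2
      have := Real.exp_pos (-ε * |x|)
      calc ‖f y‖ ≤ (‖a‖ + 1) * 1 := by linarith
        _ ≤ (‖a‖ + 1) * ((2 / Real.exp (-ε * |x|)) * Real.exp (-ε * |y|)) := by
          gcongr
          rw [div_mul_eq_mul_div, le_div_iff₀ this]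
          linarith
        _ = _ := by ring
    have h1 := key _ l nhdsWithin_le_nhds hl
    have h2 := key _ r nhdsWithin_le_nhds hr
    refine ⟨max (max ((‖l‖ + 1) * (2 / Real.exp (-ε * |x|)))
      ((‖r‖ + 1) * (2 / Real.exp (-ε * |x|)))) (‖f x‖ / Real.exp (-ε * |x|)), ?_, ?_⟩
    · exact le_max_of_le_right (by positivity)
    · rw [← nhdsNE_sup_pure x, ← nhdsLT_sup_nhdsGT, eventually_sup, eventually_sup]
      refine ⟨⟨?_, ?_⟩, ?_⟩
      · filter_upwards [h1] with y hy
        refine hy.trans ?_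
        gcongr
        exact le_max_of_le_left (le_max_left _ _)
      · filter_upwards [h2] with y hy
        refine hy.trans ?_
        gcongr
        exact le_max_of_le_left (le_max_right _ _)
      · rw [eventually_pure, ← div_le_iff₀ (Real.exp_pos _)]
        exact le_max_right _ _
  obtain ⟨c, hc⟩ := hO.bound
  obtain ⟨K, hK, hKc⟩ := mem_cocompact.1 hc
  have hcomp : ∃ M, 0 ≤ M ∧ ∀ y ∈ K, ‖f y‖ ≤ M * Real.exp (-ε * |y|) := by
    refine hK.induction_on (p := fun s => ∃ M, 0 ≤ M ∧ ∀ y ∈ s, ‖f y‖ ≤ M * Real.exp (-ε * |y|))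
      ⟨0, le_rfl, by simp⟩ ?_ ?_ ?_
    · rintro s t hst ⟨M, h0, hM⟩
      exact ⟨M, h0, fun y hy => hM y (hst hy)⟩
    · rintro s t ⟨M, h0, hM⟩ ⟨N, h0', hN⟩
      refine ⟨max M N, le_max_of_le_left h0, ?_⟩
      rintro y (hy | hy)
      · exact (hM y hy).trans (by gcongr; exact le_max_left _ _)
      · exact (hN y hy).trans (by gcongr; exact le_max_right _ _)
    · intro x _
      obtain ⟨M, h0, hM⟩ := loc x
      exact ⟨_, mem_nhdsWithin_of_mem_nhds hM, M, h0, fun y hy => hy⟩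
  obtain ⟨M, h0, hM⟩ := hcomp
  refine ⟨max M c, le_max_of_le_left h0, fun x => ?_⟩
  by_cases hx : x ∈ K
  · exact (hM x hx).trans (by gcongr; exact le_max_left _ _)
  · have := hKc hx
    simp only [Set.mem_ofPred_eq, Real.norm_eq_abs, Real.abs_exp] at this
    exact this.trans (by gcongr; exact le_max_right _ _)

namespace PiecewiseC1On

variable {S : Finset ℝ} {g : ℝ → ℂ}

lemma oneSided (h : PiecewiseC1On S g) (x : ℝ) :
    ∃ l r : ℂ, Tendsto g (𝓝[<] x) (𝓝 l) ∧ Tendsto g (𝓝[>] x) (𝓝 r) ∧ g x = (l + r) / 2 := by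
  by_cases hx : x ∈ S
  · exact (h.2.2 x hx).1
  · have := (h.1 x hx).continuousAt
    exact ⟨g x, g x, this.tendsto.mono_left nhdsWithin_le_nhds,
      this.tendsto.mono_left nhdsWithin_le_nhds, by ring⟩

lemma oneSided_deriv (h : PiecewiseC1On S g) (x : ℝ) :
    ∃ l r : ℂ, Tendsto (deriv g) (𝓝[<] x) (𝓝 l) ∧ Tendsto (deriv g) (𝓝[>] x) (𝓝 r) := by
  by_cases hx : x ∈ S
  · exact (h.2.2 x hx).2
  · have := h.2.1 x hx
    exact ⟨_, _, this.tendsto.mono_left nhdsWithin_le_nhds,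
      this.tendsto.mono_left nhdsWithin_le_nhds⟩

/-- Multiplication by a smooth function preserves piecewise differentiability. -/
lemma mul_smooth (h : PiecewiseC1On S g) {E : ℝ → ℂ} {E' : ℝ → ℂ}
    (hE : ∀ x, HasDerivAt E (E' x) x) (hE' : Continuous E') :
    PiecewiseC1On S (fun x => g x * E x) := by
  have hEc : Continuous E := continuous_iff_continuousAt.2 fun x => (hE x).continuousAt
  have hd : ∀ x, x ∉ S → deriv (fun x => g x * E x) x = deriv g x * E x + g x * E' x :=
    fun x hx => ((h.1 x hx).hasDerivAt.mul (hE x)).deriv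
  have hopen : ∀ x, ∀ᶠ y in 𝓝[≠] x, y ∉ S := fun x => by
    have : (S : Set ℝ) \ {x} = ((S.erase x : Finset ℝ) : Set ℝ) := by simp
    have h2 : ((S.erase x : Finset ℝ) : Set ℝ)ᶜ ∈ 𝓝 x :=
      (Finset.finite_toSet _).isClosed.isOpen_compl.mem_nhds (by simp)
    filter_upwards [mem_nhdsWithin_of_mem_nhds h2, self_mem_nhdsWithin] with y hy hyx hyS
    exact hy (by simp [hyS]; exact hyx)
  have hEl : ∀ x (F : Filter ℝ), F ≤ 𝓝 x → Tendsto E F (𝓝 (E x)) :=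
    fun x F hF => (hEc.tendsto x).mono_left hF
  have hEl' : ∀ x (F : Filter ℝ), F ≤ 𝓝 x → Tendsto E' F (𝓝 (E' x)) :=
    fun x F hF => (hE'.tendsto x).mono_left hF
  refine ⟨fun x hx => (h.1 x hx).mul (hE x).differentiableAt, fun x hx => ?_, fun x hx => ⟨?_, ?_⟩⟩
  · have hev : ∀ᶠ y in 𝓝 x, y ∉ S :=
      S.finite_toSet.isClosed.isOpen_compl.mem_nhds (by simpa using hx)
    have hc : ContinuousAt (fun y => deriv g y * E y + g y * E' y) x :=
      ((h.2.1 x hx).mul hEc.continuousAt).add ((h.1 x hx).continuousAt.mul hE'.continuousAt)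
    exact hc.congr (hev.mono fun y hy => (hd y hy).symm)
  · obtain ⟨l, r, hl, hr, hm⟩ := h.oneSided x
    exact ⟨l * E x, r * E x, hl.mul (hEl x _ nhdsWithin_le_nhds),
      hr.mul (hEl x _ nhdsWithin_le_nhds), by simp only [hm]; ring⟩
  · obtain ⟨l, r, hl, hr, hm⟩ := h.oneSided x
    obtain ⟨l', r', hl', hr'⟩ := h.oneSided_deriv x
    refine ⟨l' * E x + l * E' x, r' * E x + r * E' x, ?_, ?_⟩
    · refine Tendsto.congr' ?_ ((hl'.mul (hEl x _ nhdsWithin_le_nhds)).add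
        (hl.mul (hEl' x _ nhdsWithin_le_nhds)))
      filter_upwards [(hopen x).filter_mono (nhdsWithin_mono x fun y (hy : y < x) => hy.ne)]
        with y hy using (hd y hy).symm
    · refine Tendsto.congr' ?_ ((hr'.mul (hEl x _ nhdsWithin_le_nhds)).add
        (hr.mul (hEl' x _ nhdsWithin_le_nhds)))
      filter_upwards [(hopen x).filter_mono (nhdsWithin_mono x fun y (hy : x < y) => hy.ne')]
        with y hy using (hd y hy).symm

lemma ae_notMem (S : Finset ℝ) : ∀ᵐ x : ℝ, x ∉ S :=
  MeasureTheory.measure_eq_zero_iff_ae_notMem.1 (S.finite_toSet.measure_zero _)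

lemma aestronglyMeasurable_of_continuousAt {f : ℝ → ℂ} (S : Finset ℝ)
    (hf : ∀ x, x ∉ S → ContinuousAt f x) : MeasureTheory.AEStronglyMeasurable f := by
  have h1 : ContinuousOn f (S : Set ℝ)ᶜ := fun x hx => (hf x (by simpa using hx)).continuousWithinAt
  have h2 := h1.aestronglyMeasurable (μ := MeasureTheory.volume)
    S.finite_toSet.isClosed.isOpen_compl.measurableSet
  rwa [MeasureTheory.Measure.restrict_eq_self_of_ae_mem] at h2
  filter_upwards [ae_notMem S] with x hx using by simpa using hx

lemma aestronglyMeasurable (h : PiecewiseC1On S g) : MeasureTheory.AEStronglyMeasurable g :=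
  aestronglyMeasurable_of_continuousAt S fun x hx => (h.1 x hx).continuousAt

lemma aestronglyMeasurable_deriv (h : PiecewiseC1On S g) :
    MeasureTheory.AEStronglyMeasurable (deriv g) :=
  aestronglyMeasurable_of_continuousAt S h.2.1

end PiecewiseC1On

lemma integrable_exp_neg_mul_abs {ε : ℝ} (hε : 0 < ε) :
    MeasureTheory.Integrable fun x : ℝ => Real.exp (-ε * |x|) := by
  rw [← MeasureTheory.integrableOn_univ, ← Set.Iic_union_Ioi (a := (0 : ℝ))]
  refine MeasureTheory.IntegrableOn.union ?_ ?_
  · refine (integrableOn_exp_mul_Iic hε 0).congr_fun (fun x hx => ?_) measurableSet_Iic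
    simp only [abs_of_nonpos (show x ≤ 0 from hx)]; ring_nf
  · refine (integrableOn_exp_mul_Ioi (neg_lt_zero.2 hε) 0).congr_fun (fun x hx => ?_)
      measurableSet_Ioi
    simp only [abs_of_pos (show 0 < x from hx)]

/-- A piecewise `C¹` function which is bounded, with its derivative, by `C e^{-ε|x|}`. -/
structure DecayingPiecewiseC1 (S : Finset ℝ) (ε C : ℝ) (g : ℝ → ℂ) : Prop where
  pc : PiecewiseC1On S g
  pos : 0 < ε
  bound : ∀ x, ‖g x‖ ≤ C * Real.exp (-ε * |x|)
  bound_deriv : ∀ x, ‖deriv g x‖ ≤ C * Real.exp (-ε * |x|)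

namespace DecayingPiecewiseC1

variable {S : Finset ℝ} {ε C : ℝ} {g : ℝ → ℂ}

lemma const_nonneg (h : DecayingPiecewiseC1 S ε C g) : 0 ≤ C := by
  have := (norm_nonneg _).trans (h.bound 0)
  simpa using this

lemma norm_le (h : DecayingPiecewiseC1 S ε C g) (x : ℝ) : ‖g x‖ ≤ C := by
  refine (h.bound x).trans (mul_le_of_le_one_right h.const_nonneg (Real.exp_le_one_iff.2 ?_))
  nlinarith [h.pos, abs_nonneg x]

lemma integrable (h : DecayingPiecewiseC1 S ε C g) : MeasureTheory.Integrable g :=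
  ((integrable_exp_neg_mul_abs h.pos).const_mul C).mono' h.pc.aestronglyMeasurable
    (Eventually.of_forall h.bound)

lemma integrable_deriv (h : DecayingPiecewiseC1 S ε C g) : MeasureTheory.Integrable (deriv g) :=
  ((integrable_exp_neg_mul_abs h.pos).const_mul C).mono' h.pc.aestronglyMeasurable_deriv
    (Eventually.of_forall h.bound_deriv)

lemma tendsto_zero (h : DecayingPiecewiseC1 S ε C g) {F : Filter ℝ}
    (hF : Tendsto (fun x : ℝ => |x|) F atTop) : Tendsto g F (𝓝 0) := by
  refine squeeze_zero_norm h.bound ?_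
  have : Tendsto (fun x : ℝ => -ε * |x|) F atBot :=
    hF.const_mul_atTop_of_neg (by linarith [h.pos])
  simpa using (Real.tendsto_exp_atBot.comp this).const_mul C

end DecayingPiecewiseC1

/-- The decay hypotheses, in the form of explicit bounds on the whole line. -/
lemma exists_bound_of_expDecay {φ : ℝ → ℂ} {b : ℝ} {S : Finset ℝ}
    (hA : PiecewiseC1On S φ) (hB : ExpDecay φ b) :
    ∃ C, 0 ≤ C ∧ (∀ x, ‖φ x‖ ≤ C * Real.exp (-(x / 2) - (1 / 2 + b) * |x|)) ∧
      ∀ x, ‖deriv φ x‖ ≤ C * Real.exp (-(x / 2) - (1 / 2 + b) * |x|) := by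
  have hE : ∀ x (F : Filter ℝ), F ≤ 𝓝 x →
      Tendsto (fun y : ℝ => (Real.exp (y / 2) : ℂ)) F (𝓝 (Real.exp (x / 2) : ℂ)) := fun x F hF => by
    have : Continuous fun y : ℝ => (Real.exp (y / 2) : ℂ) := by fun_prop
    exact (this.tendsto x).mono_left hF
  have conv : ∀ f : ℝ → ℂ, (∀ x, ∃ l r : ℂ, Tendsto f (𝓝[<] x) (𝓝 l) ∧ Tendsto f (𝓝[>] x) (𝓝 r)) →
      ((fun x : ℝ => f x * (Real.exp (x / 2) : ℂ)) =O[cocompact ℝ]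
        fun x : ℝ => Real.exp (-(1 / 2 + b) * |x|)) →
      ∃ C, 0 ≤ C ∧ ∀ x, ‖f x‖ ≤ C * Real.exp (-(x / 2) - (1 / 2 + b) * |x|) := by
    intro f hf hO
    obtain ⟨C, h0, hC⟩ := exists_bound_of_oneSided_limits (fun x => by
      obtain ⟨l, r, hl, hr⟩ := hf x
      exact ⟨_, _, hl.mul (hE x _ nhdsWithin_le_nhds), hr.mul (hE x _ nhdsWithin_le_nhds)⟩) hO
    refine ⟨C, h0, fun x => ?_⟩
    have h1 := hC x
    rw [norm_mul, Complex.norm_real, Real.norm_eq_abs, Real.abs_exp] at h1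
    rw [← le_div_iff₀ (Real.exp_pos _), mul_div_assoc, ← Real.exp_sub] at h1
    refine h1.trans (le_of_eq ?_)
    ring_nf
  obtain ⟨C₁, h0, h1⟩ := conv φ (fun x => by
    obtain ⟨l, r, hl, hr, -⟩ := hA.oneSided x
    exact ⟨l, r, hl, hr⟩) hB.1
  obtain ⟨C₂, h0', h2⟩ := conv (deriv φ) hA.oneSided_deriv hB.2
  refine ⟨max C₁ C₂, le_max_of_le_left h0, fun x => (h1 x).trans ?_, fun x => (h2 x).trans ?_⟩
  · gcongr; exact le_max_left _ _
  · gcongr; exact le_max_right _ _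

/-- The exponentially weighted functions `φ(x) e^{σx}`, for `σ` in the strip of convergence. -/
lemma decayingPiecewiseC1_mul_exp {φ : ℝ → ℂ} {b C : ℝ} {S : Finset ℝ}
    (hA : PiecewiseC1On S φ) (hC : 0 ≤ C)
    (h1 : ∀ x, ‖φ x‖ ≤ C * Real.exp (-(x / 2) - (1 / 2 + b) * |x|))
    (h2 : ∀ x, ‖deriv φ x‖ ≤ C * Real.exp (-(x / 2) - (1 / 2 + b) * |x|))
    {ε σ : ℝ} (hε : 0 < ε) (hσ : |σ - 1 / 2| + ε ≤ 1 / 2 + b) :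
    DecayingPiecewiseC1 S ε (C * (1 + |σ|)) (fun x => φ x * (Real.exp (σ * x) : ℂ)) := by
  have hE : ∀ x : ℝ, HasDerivAt (fun x : ℝ => (Real.exp (σ * x) : ℂ)) ((σ * Real.exp (σ * x) : ℝ) : ℂ) x := by
    intro x
    have : HasDerivAt (fun x : ℝ => Real.exp (σ * x)) (σ * Real.exp (σ * x)) x := by
      have := ((hasDerivAt_id x).const_mul σ).exp
      simpa [mul_comm] using this
    exact this.ofReal_comp
  have hexp : ∀ x : ℝ, Real.exp (-(x / 2) - (1 / 2 + b) * |x|) * Real.exp (σ * x)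
      ≤ Real.exp (-ε * |x|) := by
    intro x
    rw [← Real.exp_add, Real.exp_le_exp]
    have : (σ - 1 / 2) * x ≤ |σ - 1 / 2| * |x| := by
      rw [← abs_mul]; exact le_abs_self _
    nlinarith [abs_nonneg x]
  have hb1 : ∀ x : ℝ, ‖φ x * (Real.exp (σ * x) : ℂ)‖ ≤ C * Real.exp (-ε * |x|) := by
    intro x
    rw [norm_mul, Complex.norm_real, Real.norm_eq_abs, Real.abs_exp]
    calc _ ≤ C * Real.exp (-(x / 2) - (1 / 2 + b) * |x|) * Real.exp (σ * x) := by
          gcongr; exact h1 x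
      _ = C * (Real.exp (-(x / 2) - (1 / 2 + b) * |x|) * Real.exp (σ * x)) := by ring
      _ ≤ _ := by gcongr; exact hexp x
  have hb2 : ∀ x : ℝ, ‖deriv φ x * (Real.exp (σ * x) : ℂ)‖ ≤ C * Real.exp (-ε * |x|) := by
    intro x
    rw [norm_mul, Complex.norm_real, Real.norm_eq_abs, Real.abs_exp]
    calc _ ≤ C * Real.exp (-(x / 2) - (1 / 2 + b) * |x|) * Real.exp (σ * x) := by
          gcongr; exact h2 x
      _ = C * (Real.exp (-(x / 2) - (1 / 2 + b) * |x|) * Real.exp (σ * x)) := by ring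
      _ ≤ _ := by gcongr; exact hexp x
  refine ⟨hA.mul_smooth hE (by fun_prop), hε, fun x => (hb1 x).trans ?_, fun x => ?_⟩
  · gcongr
    exact le_mul_of_one_le_right hC (by linarith [abs_nonneg σ])
  · by_cases hd : DifferentiableAt ℝ φ x
    · rw [show deriv (fun x => φ x * (Real.exp (σ * x) : ℂ)) x = _ from
        (hd.hasDerivAt.mul (hE x)).deriv]
      calc _ ≤ ‖deriv φ x * (Real.exp (σ * x) : ℂ)‖ + |σ| * ‖φ x * (Real.exp (σ * x) : ℂ)‖ := by
            refine (norm_add_le _ _).trans (le_of_eq ?_)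
            simp only [norm_mul, Complex.norm_real, Real.norm_eq_abs]
            ring
        _ ≤ C * Real.exp (-ε * |x|) + |σ| * (C * Real.exp (-ε * |x|)) := by
            gcongr
            exacts [hb2 x, hb1 x]
        _ = _ := by ring
    · have : ¬ DifferentiableAt ℝ (fun x => φ x * (Real.exp (σ * x) : ℂ)) x := by
        intro h
        apply hd
        have h3 : DifferentiableAt ℝ (fun x => (φ x * (Real.exp (σ * x) : ℂ)) *
            (Real.exp (σ * x) : ℂ)⁻¹) x :=
          h.mul ((hE x).differentiableAt.inv (by simp [-Complex.ofReal_exp, Real.exp_ne_zero]))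
        refine h3.congr_of_eventuallyEq (Eventually.of_forall fun y => ?_)
        have : (Real.exp (σ * y) : ℂ) ≠ 0 := by exact_mod_cast (Real.exp_pos _).ne'
        simp only
        rw [mul_inv_cancel_right₀ this]
      rw [deriv_zero_of_not_differentiableAt this, norm_zero]
      positivity

/-! ### Integration by parts with jumps -/

section FTC

variable {M m : ℝ → ℂ} {S : Finset ℝ}

lemma intervalIntegral_eq_sub_off_finset (hM : Continuous M)
    (hd : ∀ x, x ∉ S → HasDerivAt M (m x) x) (hm : MeasureTheory.Integrable m) (a b : ℝ) :
    ∫ x in a..b, m x = M b - M a :=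
  MeasureTheory.integral_eq_of_hasDerivAt_off_countable M m S.countable_toSet hM.continuousOn
    (fun x hx => hd x (by simpa using hx.2)) hm.intervalIntegrable

lemma integral_Iic_eq_sub_off_finset (hM : Continuous M)
    (hd : ∀ x, x ∉ S → HasDerivAt M (m x) x) (hm : MeasureTheory.Integrable m) {l : ℂ}
    (hl : Tendsto M atBot (𝓝 l)) (x : ℝ) : ∫ y in Set.Iic x, m y = M x - l := by
  refine tendsto_nhds_unique
    (MeasureTheory.intervalIntegral_tendsto_integral_Iic x hm.integrableOn tendsto_id) ?_
  simp only [intervalIntegral_eq_sub_off_finset hM hd hm, id]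
  exact tendsto_const_nhds.sub hl

lemma integral_Ioi_eq_sub_off_finset (hM : Continuous M)
    (hd : ∀ x, x ∉ S → HasDerivAt M (m x) x) (hm : MeasureTheory.Integrable m) {r : ℂ}
    (hr : Tendsto M atTop (𝓝 r)) (x : ℝ) : ∫ y in Set.Ioi x, m y = r - M x := by
  refine tendsto_nhds_unique
    (MeasureTheory.intervalIntegral_tendsto_integral_Ioi x hm.integrableOn tendsto_id) ?_
  simp only [intervalIntegral_eq_sub_off_finset hM hd hm, id]
  exact hr.sub tendsto_const_nhds

lemma integral_eq_sub_off_finset (hM : Continuous M)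
    (hd : ∀ x, x ∉ S → HasDerivAt M (m x) x) (hm : MeasureTheory.Integrable m) {l r : ℂ}
    (hl : Tendsto M atBot (𝓝 l)) (hr : Tendsto M atTop (𝓝 r)) : ∫ y, m y = r - l := by
  rw [← MeasureTheory.integral_add_compl (measurableSet_Iic (a := (0 : ℝ))) hm, Set.compl_Iic,
    integral_Iic_eq_sub_off_finset hM hd hm hl, integral_Ioi_eq_sub_off_finset hM hd hm hr]
  ring

end FTC

lemma eventually_sign_sub_eq {x α : ℝ} (h : x ≠ α) :
    (fun y : ℝ => Real.sign (y - α)) =ᶠ[𝓝 x] fun _ => Real.sign (x - α) := by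
  rcases h.lt_or_gt with h | h
  · filter_upwards [gt_mem_nhds h] with y hy
    rw [Real.sign_of_neg (by linarith), Real.sign_of_neg (by linarith)]
  · filter_upwards [lt_mem_nhds h] with y hy
    rw [Real.sign_of_pos (by linarith), Real.sign_of_pos (by linarith)]

lemma hasDerivAt_sign_sub {x α : ℝ} (h : x ≠ α) :
    HasDerivAt (fun y : ℝ => (Real.sign (y - α) : ℂ)) 0 x := by
  refine (hasDerivAt_const x (Real.sign (x - α) : ℂ)).congr_of_eventuallyEq ?_
  filter_upwards [eventually_sign_sub_eq h] with y hy using by rw [hy]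

lemma aestronglyMeasurable_sign (x : ℝ) :
    MeasureTheory.AEStronglyMeasurable (fun y : ℝ => (Real.sign (x - y) : ℂ)) :=
  PiecewiseC1On.aestronglyMeasurable_of_continuousAt {x} fun y hy => by
    have := (hasDerivAt_sign_sub (x := y) (α := x) (by simpa using hy)).continuousAt.neg
    refine this.congr (Eventually.of_forall fun z => ?_)
    simp only [Pi.neg_apply]
    rw [← neg_sub x z, Real.sign_neg]; simp

lemma norm_sign_le (x : ℝ) : ‖(Real.sign x : ℂ)‖ ≤ 1 := by
  rcases Real.sign_apply_eq x with h | h | h <;> simp [h]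

/-- Multiplying by `sign (y - α)` a continuous function vanishing at `α` keeps it continuous. -/
lemma continuous_sign_mul {K : ℝ → ℂ} (hK : Continuous K) (α : ℝ) :
    Continuous fun y : ℝ => (Real.sign (y - α) : ℂ) * (K y - K α) := by
  refine continuous_iff_continuousAt.2 fun x => ?_
  by_cases h : x = α
  · subst h
    rw [ContinuousAt, sub_self (K x), mul_zero]
    have h0 : Tendsto (fun y => K y - K x) (𝓝 x) (𝓝 0) := by
      simpa using (hK.tendsto x).sub_const (K x)
    refine squeeze_zero_norm (fun y => ?_) (by simpa using h0.norm)
    rw [norm_mul]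
    exact mul_le_of_le_one_left (norm_nonneg _) (norm_sign_le _)
  · exact (hasDerivAt_sign_sub h).continuousAt.mul (hK.continuousAt.sub continuousAt_const)

lemma tendsto_sign_sub_atTop (α : ℝ) :
    Tendsto (fun y : ℝ => (Real.sign (y - α) : ℂ)) atTop (𝓝 1) := by
  refine tendsto_const_nhds.congr' ?_
  filter_upwards [eventually_gt_atTop α] with y hy
  rw [Real.sign_of_pos (by linarith)]; simp

lemma tendsto_sign_sub_atBot (α : ℝ) :
    Tendsto (fun y : ℝ => (Real.sign (y - α) : ℂ)) atBot (𝓝 (-1)) := by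
  refine tendsto_const_nhds.congr' ?_
  filter_upwards [eventually_lt_atBot α] with y hy
  rw [Real.sign_of_neg (by linarith)]; simp

/-- `j` is a family of jumps for `g` on `S`: subtracting the corresponding step functions makes `g`
continuous. The step functions take their mean value at the jump, as `g` does. -/
def IsJump (S : Finset ℝ) (g : ℝ → ℂ) (j : ℝ → ℂ) : Prop :=
  Continuous fun x => g x - 1 / 2 * ∑ α ∈ S, j α * (Real.sign (x - α) : ℂ)

lemma PiecewiseC1On.exists_isJump {S : Finset ℝ} {g : ℝ → ℂ} (h : PiecewiseC1On S g) :
    ∃ j : ℝ → ℂ, IsJump S g j ∧ ∀ M, (∀ x, ‖g x‖ ≤ M) → ∀ x, ‖j x‖ ≤ 2 * M := by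
  choose l r hl hr hm using h.oneSided
  refine ⟨fun x => r x - l x, ?_, fun M hM x => ?_⟩
  · refine continuous_iff_continuousAt.2 fun x => ?_
    have hsum : ∀ S' : Finset ℝ, x ∉ S' → ContinuousAt (fun y : ℝ => ∑ α ∈ S', (r α - l α) *
        (Real.sign (y - α) : ℂ)) x := fun S' hS' => tendsto_finsetSum _ fun α hα =>
      tendsto_const_nhds.mul
        (hasDerivAt_sign_sub (by rintro rfl; exact hS' hα)).continuousAt
    by_cases hx : x ∈ S
    · have key : ContinuousAt (fun y => g y - 1 / 2 * ((r x - l x) * (Real.sign (y - x) : ℂ))) x := by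
        rw [continuousAt_iff_continuous_left'_right']
        constructor
        · have : Tendsto (fun y => g y - 1 / 2 * ((r x - l x) * (-1))) (𝓝[<] x)
              (𝓝 (l x - 1 / 2 * ((r x - l x) * (-1)))) := (hl x).sub_const _
          rw [ContinuousWithinAt]
          simp only [sub_self, Real.sign_zero, Complex.ofReal_zero, mul_zero, sub_zero]
          rw [hm x, show (l x + r x) / 2 = l x - 1 / 2 * ((r x - l x) * (-1)) by ring]
          refine this.congr' ?_
          filter_upwards [self_mem_nhdsWithin] with y hy
          rw [Real.sign_of_neg (sub_neg.2 hy)]; simp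
        · have : Tendsto (fun y => g y - 1 / 2 * ((r x - l x) * 1)) (𝓝[>] x)
              (𝓝 (r x - 1 / 2 * ((r x - l x) * 1))) := (hr x).sub_const _
          rw [ContinuousWithinAt]
          simp only [sub_self, Real.sign_zero, Complex.ofReal_zero, mul_zero, sub_zero]
          rw [hm x, show (l x + r x) / 2 = r x - 1 / 2 * ((r x - l x) * 1) by ring]
          refine this.congr' ?_
          filter_upwards [self_mem_nhdsWithin] with y hy
          rw [Real.sign_of_pos (sub_pos.2 hy)]; simp
      refine (key.sub ((hsum (S.erase x) (by simp)).const_mul (1 / 2))).congr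
        (Eventually.of_forall fun y => ?_)
      simp only [Pi.sub_apply]
      rw [← Finset.add_sum_erase S _ hx]
      ring
    · exact (h.1 x hx).continuousAt.sub ((hsum S hx).const_mul _)
  · have h1 : ‖r x‖ ≤ M := le_of_tendsto (hr x).norm (Eventually.of_forall hM)
    have h2 : ‖l x‖ ≤ M := le_of_tendsto (hl x).norm (Eventually.of_forall hM)
    exact (norm_sub_le _ _).trans (by linarith)

namespace DecayingPiecewiseC1

variable {S : Finset ℝ} {ε C : ℝ} {g : ℝ → ℂ} {j : ℝ → ℂ}

lemma tendsto_atTop (h : DecayingPiecewiseC1 S ε C g) : Tendsto g atTop (𝓝 0) :=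
  h.tendsto_zero tendsto_abs_atTop_atTop

lemma tendsto_atBot (h : DecayingPiecewiseC1 S ε C g) : Tendsto g atBot (𝓝 0) :=
  h.tendsto_zero tendsto_abs_atBot_atTop

/-- Integration by parts for a function with jumps. -/
lemma integral_mul_eq (h : DecayingPiecewiseC1 S ε C g) (hj : IsJump S g j) {K k : ℝ → ℂ} {B : ℝ}
    (hK : ∀ x, HasDerivAt K (k x) x) (hk : Continuous k) (hKB : ∀ x, ‖K x‖ ≤ B)
    (hkB : ∀ x, ‖k x‖ ≤ B) :
    ∫ y, g y * k y = -((∫ y, deriv g y * K y) + ∑ α ∈ S, j α * K α) := by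
  have hKc : Continuous K := continuous_iff_continuousAt.2 fun x => (hK x).continuousAt
  have hi1 : MeasureTheory.Integrable fun y => g y * k y :=
    h.integrable.mul_bdd hk.aestronglyMeasurable (Eventually.of_forall hkB)
  have hi2 : MeasureTheory.Integrable fun y => deriv g y * K y :=
    h.integrable_deriv.mul_bdd hKc.aestronglyMeasurable (Eventually.of_forall hKB)
  have hM : Continuous fun y => g y * K y
      - 1 / 2 * ∑ α ∈ S, j α * K α * (Real.sign (y - α) : ℂ) := by
    have h1 : Continuous fun y => (g y - 1 / 2 * ∑ α ∈ S, j α * (Real.sign (y - α) : ℂ)) * K y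
        + 1 / 2 * ∑ α ∈ S, j α * ((Real.sign (y - α) : ℂ) * (K y - K α)) :=
      (Continuous.mul hj hKc).add (continuous_const.mul (continuous_finsetSum _ fun α _ =>
        continuous_const.mul (continuous_sign_mul hKc α)))
    refine h1.congr fun y => ?_
    rw [sub_mul, mul_assoc, Finset.sum_mul, sub_add, ← mul_sub, ← Finset.sum_sub_distrib]
    congr 2
    exact Finset.sum_congr rfl fun α _ => by ring
  have hd : ∀ x, x ∉ S → HasDerivAt (fun y => g y * K y
      - 1 / 2 * ∑ α ∈ S, j α * K α * (Real.sign (y - α) : ℂ)) (deriv g x * K x + g x * k x) x := by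
    intro x hx
    have h1 := (h.pc.1 x hx).hasDerivAt.mul (hK x)
    have h2 : HasDerivAt (fun y : ℝ => ∑ α ∈ S, j α * K α * (Real.sign (y - α) : ℂ))
        (∑ α ∈ S, j α * K α * 0) x := HasDerivAt.fun_sum fun α hα =>
      (hasDerivAt_sign_sub (by rintro rfl; exact hx hα)).const_mul _
    have h3 := h1.sub (h2.const_mul (1 / 2))
    simp only [mul_zero, Finset.sum_const_zero, sub_zero] at h3
    exact h3
  have hlim : ∀ (F : Filter ℝ) (c : ℂ), Tendsto g F (𝓝 0) →
      (∀ α : ℝ, Tendsto (fun y : ℝ => (Real.sign (y - α) : ℂ)) F (𝓝 c)) →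
      Tendsto (fun y => g y * K y - 1 / 2 * ∑ α ∈ S, j α * K α * (Real.sign (y - α) : ℂ)) F
        (𝓝 (0 - 1 / 2 * ∑ α ∈ S, j α * K α * c)) := by
    intro F c hg hc
    refine Tendsto.sub ?_ (tendsto_const_nhds.mul (tendsto_finsetSum _ fun α _ =>
      tendsto_const_nhds.mul (hc α)))
    refine squeeze_zero_norm (fun y => ?_) (by simpa using (hg.norm.mul_const B))
    rw [norm_mul]
    gcongr
    exact hKB y
  have := integral_eq_sub_off_finset hM hd (hi2.add hi1)
    (hlim _ _ h.tendsto_atBot tendsto_sign_sub_atBot)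
    (hlim _ _ h.tendsto_atTop tendsto_sign_sub_atTop)
  rw [MeasureTheory.integral_add hi2 hi1] at this
  rw [eq_neg_iff_add_eq_zero, ← add_assoc, add_comm (∫ y, g y * k y), this]
  simp only [← Finset.sum_mul]
  ring

/-- The value of `g` in terms of its derivative and its jumps. -/
lemma eq_integral_sign (h : DecayingPiecewiseC1 S ε C g) (hj : IsJump S g j) (x : ℝ) :
    (∫ y, deriv g y * (Real.sign (x - y) : ℂ)) + ∑ α ∈ S, j α * (Real.sign (x - α) : ℂ)
      = 2 * g x := by
  have hd : ∀ x, x ∉ S → HasDerivAt (fun y => g y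
      - 1 / 2 * ∑ α ∈ S, j α * (Real.sign (y - α) : ℂ)) (deriv g x) x := by
    intro x hx
    have h2 : HasDerivAt (fun y : ℝ => ∑ α ∈ S, j α * (Real.sign (y - α) : ℂ))
        (∑ α ∈ S, j α * 0) x := HasDerivAt.fun_sum fun α hα =>
      (hasDerivAt_sign_sub (by rintro rfl; exact hx hα)).const_mul _
    have h3 := (h.pc.1 x hx).hasDerivAt.sub (h2.const_mul (1 / 2))
    simp only [mul_zero, Finset.sum_const_zero, sub_zero] at h3
    exact h3
  have hlim : ∀ (F : Filter ℝ) (c : ℂ), Tendsto g F (𝓝 0) →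
      (∀ α : ℝ, Tendsto (fun y : ℝ => (Real.sign (y - α) : ℂ)) F (𝓝 c)) →
      Tendsto (fun y => g y - 1 / 2 * ∑ α ∈ S, j α * (Real.sign (y - α) : ℂ)) F
        (𝓝 (0 - 1 / 2 * ∑ α ∈ S, j α * c)) := by
    intro F c hg hc
    exact hg.sub (tendsto_const_nhds.mul (tendsto_finsetSum _ fun α _ =>
      tendsto_const_nhds.mul (hc α)))
  have e1 := integral_Iic_eq_sub_off_finset hj hd h.integrable_deriv
    (hlim _ _ h.tendsto_atBot tendsto_sign_sub_atBot) x
  have e2 := integral_Ioi_eq_sub_off_finset hj hd h.integrable_deriv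
    (hlim _ _ h.tendsto_atTop tendsto_sign_sub_atTop) x
  have hi : MeasureTheory.Integrable fun y => deriv g y * (Real.sign (x - y) : ℂ) :=
    h.integrable_deriv.mul_bdd (aestronglyMeasurable_sign x) (Eventually.of_forall fun y => norm_sign_le _)
  rw [← MeasureTheory.integral_add_compl (measurableSet_Iic (a := x)) hi, Set.compl_Iic]
  have f1 : ∫ y in Set.Iic x, deriv g y * (Real.sign (x - y) : ℂ) = ∫ y in Set.Iic x, deriv g y := by
    rw [MeasureTheory.integral_Iic_eq_integral_Iio, MeasureTheory.integral_Iic_eq_integral_Iio]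
    refine MeasureTheory.setIntegral_congr_fun measurableSet_Iio fun y hy => ?_
    simp only [Real.sign_of_pos (sub_pos.2 (show y < x from hy)), Complex.ofReal_one, mul_one]
  have f2 : ∫ y in Set.Ioi x, deriv g y * (Real.sign (x - y) : ℂ)
      = -∫ y in Set.Ioi x, deriv g y := by
    rw [← MeasureTheory.integral_neg]
    refine MeasureTheory.setIntegral_congr_fun measurableSet_Ioi fun y hy => ?_
    simp only [Real.sign_of_neg (sub_neg.2 (show x < y from hy)), Complex.ofReal_neg,
      Complex.ofReal_one, mul_neg, mul_one]
  rw [f1, f2, e1, e2]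
  simp only [← Finset.sum_mul]
  ring

end DecayingPiecewiseC1

/-! ### The sine integral -/

/-- The sine integral `Si(u) = ∫₀ᵘ sin(t)/t dt`. -/
def sineIntegral (u : ℝ) : ℝ := ∫ t in (0 : ℝ)..u, Real.sinc t

lemma hasDerivAt_sineIntegral (u : ℝ) : HasDerivAt sineIntegral (Real.sinc u) u :=
  intervalIntegral.integral_hasDerivAt_right (Real.continuous_sinc.intervalIntegrable _ _)
    (Real.continuous_sinc.stronglyMeasurableAtFilter _ _) Real.continuous_sinc.continuousAt

lemma continuous_sineIntegral : Continuous sineIntegral :=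
  continuous_iff_continuousAt.2 fun u => (hasDerivAt_sineIntegral u).continuousAt

@[simp] lemma sineIntegral_zero : sineIntegral 0 = 0 := by simp [sineIntegral]

lemma sineIntegral_neg (u : ℝ) : sineIntegral (-u) = -sineIntegral u := by
  have := intervalIntegral.integral_comp_neg (a := 0) (b := u) (fun t => Real.sinc t)
  simp only [Real.sinc_neg, neg_zero] at this
  rw [sineIntegral, sineIntegral, this, intervalIntegral.integral_symm]

lemma abs_sineIntegral_le (u : ℝ) : |sineIntegral u| ≤ |u| := by
  have := intervalIntegral.norm_integral_le_of_norm_le_const (a := 0) (b := u) (C := 1)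
    (f := Real.sinc) (fun x _ => Real.abs_sinc_le_one x)
  simpa [sineIntegral] using this

/-- Integrating by parts, `Si(t) + (cos t - 1)/t` increases and `Si(t) + (cos t + 1)/t` decreases
for `t > 0`, so `Si` converges at the rate `1/t`. -/
lemma exists_sineIntegral_limit : ∃ κ : ℝ, ∀ t, 0 < t → |κ - sineIntegral t| ≤ 2 / t := by
  have hder : ∀ (c t : ℝ), 0 < t → HasDerivAt (fun t => sineIntegral t + (Real.cos t + c) / t)
      (-(Real.cos t + c) / t ^ 2) t := by
    intro c t ht
    have h1 := (hasDerivAt_sineIntegral t).add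
      (((Real.hasDerivAt_cos t).add_const c).div (hasDerivAt_id t) ht.ne')
    refine h1.congr_deriv ?_
    rw [Real.sinc_of_ne_zero ht.ne']
    simp only [id]
    field_simp
    ring
  have mono : MonotoneOn (fun t => sineIntegral t + (Real.cos t + (-1)) / t) (Set.Ioi 0) := by
    refine monotoneOn_of_deriv_nonneg (convex_Ioi 0)
      (fun t ht => (hder (-1) t ht).continuousAt.continuousWithinAt) ?_ ?_
    · rw [interior_Ioi]
      exact fun t ht => (hder (-1) t ht).differentiableAt.differentiableWithinAt
    · rw [interior_Ioi]
      intro t ht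
      rw [(hder (-1) t ht).deriv]
      have := Real.cos_le_one t
      exact div_nonneg (by linarith) (by positivity)
  have anti : AntitoneOn (fun t => sineIntegral t + (Real.cos t + 1) / t) (Set.Ioi 0) := by
    refine antitoneOn_of_deriv_nonpos (convex_Ioi 0)
      (fun t ht => (hder 1 t ht).continuousAt.continuousWithinAt) ?_ ?_
    · rw [interior_Ioi]
      exact fun t ht => (hder 1 t ht).differentiableAt.differentiableWithinAt
    · rw [interior_Ioi]
      intro t ht
      rw [(hder 1 t ht).deriv]
      have := Real.neg_one_le_cos t
      exact div_nonpos_of_nonpos_of_nonneg (by linarith) (by positivity)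
  have hle : ∀ t : ℝ, 0 < t → sineIntegral t + (Real.cos t + (-1)) / t ≤
      sineIntegral t + (Real.cos t + 1) / t := fun t ht => by
    gcongr; norm_num
  have cross : ∀ u v : ℝ, 0 < u → 0 < v → sineIntegral u + (Real.cos u + (-1)) / u ≤
      sineIntegral v + (Real.cos v + 1) / v := by
    intro u v hu hv
    rcases le_total u v with h | h
    · exact (mono hu hv h).trans (hle v hv)
    · exact (hle u hu).trans (anti hv hu h)
  set A := (fun t => sineIntegral t + (Real.cos t + (-1)) / t) '' Set.Ioi (0 : ℝ) with hAdef
  have hbdd : ∀ v : ℝ, 0 < v → sineIntegral v + (Real.cos v + 1) / v ∈ upperBounds A := by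
    rintro v hv _ ⟨u, hu, rfl⟩
    exact cross u v hu hv
  refine ⟨sSup A, fun t ht => ?_⟩
  have h1 : sineIntegral t + (Real.cos t + (-1)) / t ≤ sSup A :=
    le_csSup ⟨_, hbdd 1 one_pos⟩ ⟨t, ht, rfl⟩
  have h2 : sSup A ≤ sineIntegral t + (Real.cos t + 1) / t :=
    csSup_le ⟨_, ⟨t, ht, rfl⟩⟩ (hbdd t ht)
  have h3 : (Real.cos t + 1) / t ≤ 2 / t := by
    gcongr; linarith [Real.cos_le_one t]
  have h4 : -(2 / t) ≤ (Real.cos t + (-1)) / t := by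
    rw [← neg_div]; gcongr; linarith [Real.neg_one_le_cos t]
  rw [abs_le]
  constructor <;> linarith

/-- The limit of the sine integral at infinity. -/
def sineLimit : ℝ := exists_sineIntegral_limit.choose

lemma abs_sineLimit_sub_le {t : ℝ} (ht : 0 < t) : |sineLimit - sineIntegral t| ≤ 2 / t :=
  exists_sineIntegral_limit.choose_spec t ht

lemma abs_sineIntegral_le_const (u : ℝ) : |sineIntegral u| ≤ |sineLimit| + 2 := by
  have key : ∀ u : ℝ, 0 ≤ u → |sineIntegral u| ≤ |sineLimit| + 2 := by
    intro u hu
    rcases le_total u 1 with h | h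
    · have := abs_sineIntegral_le u
      rw [abs_of_nonneg hu] at this
      linarith [abs_nonneg sineLimit]
    · have h1 := abs_sineLimit_sub_le (by linarith : 0 < u)
      have h2 : 2 / u ≤ 2 := by rw [div_le_iff₀ (by linarith)]; linarith
      have h3 := abs_sub_abs_le_abs_sub (sineIntegral u) sineLimit
      rw [abs_sub_comm] at h3
      linarith
  rcases le_total 0 u with h | h
  · exact key u h
  · have := key (-u) (by linarith)
    rwa [sineIntegral_neg, abs_neg] at this

lemma abs_sineIntegral_sub_sign_le {u : ℝ} (hu : u ≠ 0) :
    |sineIntegral u - sineLimit * Real.sign u| ≤ (2 * |sineLimit| + 2) * |u| ^ (-(1 / 2) : ℝ) := by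
  have key : ∀ u : ℝ, 0 < u →
      |sineIntegral u - sineLimit| ≤ (2 * |sineLimit| + 2) * u ^ (-(1 / 2) : ℝ) := by
    intro u hu
    rcases le_total u 1 with h | h
    · have h1 : 1 ≤ u ^ (-(1 / 2) : ℝ) :=
        Real.one_le_rpow_of_pos_of_le_one_of_nonpos hu h (by norm_num)
      have h2 := (abs_sub _ _).trans (add_le_add_left (abs_sineIntegral_le_const u) |sineLimit|)
      have h3 : 0 ≤ 2 * |sineLimit| + 2 := by positivity
      nlinarith
    · have h1 := abs_sineLimit_sub_le hu
      rw [abs_sub_comm] at h1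
      have h2 : 2 / u ≤ 2 * u ^ (-(1 / 2) : ℝ) := by
        rw [div_eq_mul_inv, ← Real.rpow_neg_one]
        gcongr 2 * ?_
        exact Real.rpow_le_rpow_of_exponent_le h (by norm_num)
      have h3 : 0 ≤ u ^ (-(1 / 2) : ℝ) := by positivity
      nlinarith [abs_nonneg sineLimit, mul_nonneg (abs_nonneg sineLimit) h3]
  rcases hu.lt_or_gt with h | h
  · have := key (-u) (by linarith)
    rw [Real.sign_of_neg h, abs_of_neg h]
    rw [sineIntegral_neg] at this
    rwa [← abs_neg, show -(sineIntegral u - sineLimit * -1) = -sineIntegral u - sineLimit by ring]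
  · rw [Real.sign_of_pos h, abs_of_pos h, mul_one]
    exact key u h

lemma tendsto_sineIntegral_mul (u : ℝ) :
    Tendsto (fun T : ℝ => sineIntegral (T * u)) atTop (𝓝 (sineLimit * Real.sign u)) := by
  rcases eq_or_ne u 0 with rfl | hu
  · simp
  rw [tendsto_iff_norm_sub_tendsto_zero]
  have h0 : Tendsto (fun T : ℝ => |T * u|) atTop atTop := by
    simp only [abs_mul]
    exact tendsto_abs_atTop_atTop.atTop_mul_const (abs_pos.2 hu)
  have h1 := ((tendsto_rpow_neg_atTop (y := 1 / 2) (by norm_num)).comp h0).const_mul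
    (2 * |sineLimit| + 2)
  rw [mul_zero] at h1
  refine squeeze_zero' (Eventually.of_forall fun _ => norm_nonneg _) ?_ h1
  filter_upwards [eventually_gt_atTop 0] with T hT
  have h2 := abs_sineIntegral_sub_sign_le (mul_ne_zero hT.ne' hu)
  have h3 : Real.sign (T * u) = Real.sign u := by
    rcases hu.lt_or_gt with h | h
    · rw [Real.sign_of_neg h, Real.sign_of_neg (mul_neg_of_pos_of_neg hT h)]
    · rw [Real.sign_of_pos h, Real.sign_of_pos (mul_pos hT h)]
  rwa [h3] at h2

/-! ### Fourier inversion for functions with jumps -/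

/-- The Fourier integral `∫ g(y) e^{ity} dy`. -/
def fourierInt (g : ℝ → ℂ) (t : ℝ) : ℂ := ∫ y, g y * Complex.exp (t * y * Complex.I)

lemma norm_exp_mul_mul_I (t y : ℝ) : ‖Complex.exp (t * y * Complex.I)‖ = 1 := by
  rw [← Complex.ofReal_mul, Complex.norm_exp_ofReal_mul_I]

lemma integral_exp_symm (T u : ℝ) :
    ∫ t in -T..T, Complex.exp (t * u * Complex.I) = 2 * T * Real.sinc (T * u) := by
  rcases eq_or_ne u 0 with rfl | hu
  · simp; ring
  have := intervalIntegral.integral_comp_mul_right (a := -T) (b := T)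
    (fun t : ℝ => Complex.exp (t * Complex.I)) hu
  simp only [Complex.ofReal_mul] at this
  rw [this, neg_mul, integral_exp_mul_I_eq_sinc, Complex.real_smul]
  have hu' : (u : ℂ) ≠ 0 := by exact_mod_cast hu
  push_cast
  field_simp

lemma continuous_fourierInt {g : ℝ → ℂ} (hg : MeasureTheory.Integrable g) :
    Continuous (fourierInt g) := by
  refine MeasureTheory.continuous_of_dominated (bound := fun y => ‖g y‖) (fun t => ?_) (fun t => ?_)
    hg.norm ?_
  · exact hg.aestronglyMeasurable.mul (by fun_prop : Continuous _).aestronglyMeasurable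
  · exact Eventually.of_forall fun y => by rw [norm_mul, norm_exp_mul_mul_I, mul_one]
  · exact Eventually.of_forall fun y => by fun_prop

lemma norm_fourierInt_le {g : ℝ → ℂ} (t : ℝ) : ‖fourierInt g t‖ ≤ ∫ y, ‖g y‖ := by
  refine (MeasureTheory.norm_integral_le_integral_norm _).trans (le_of_eq ?_)
  simp only [norm_mul, norm_exp_mul_mul_I, mul_one]

/-- The truncated inverse Fourier integral as an integral against the Dirichlet kernel. -/
lemma integral_fourierInt_mul_exp {g : ℝ → ℂ} (hg : MeasureTheory.Integrable g) (T x : ℝ) :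
    ∫ t in -T..T, fourierInt g t * Complex.exp (-(t * x * Complex.I)) =
      ∫ y, g y * (2 * T * Real.sinc (T * (y - x))) := by
  have h1 : ∀ t : ℝ, fourierInt g t * Complex.exp (-(t * x * Complex.I)) =
      ∫ y, g y * Complex.exp (t * ((y - x : ℝ) : ℂ) * Complex.I) := by
    intro t
    rw [fourierInt, ← MeasureTheory.integral_mul_const]
    congr 1 with y
    rw [mul_assoc, ← Complex.exp_add]
    congr 2
    push_cast
    ring
  simp only [h1]
  rw [MeasureTheory.intervalIntegral_integral_swap]
  · congr 1 with y
    rw [intervalIntegral.integral_const_mul, integral_exp_symm]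
  · have : MeasureTheory.IsFiniteMeasure
        (MeasureTheory.volume.restrict (Set.uIoc (-T) T)) := by
      rw [Set.uIoc]; infer_instance
    have hm : MeasureTheory.Integrable (fun p : ℝ × ℝ => (1 : ℂ) * g p.2)
        ((MeasureTheory.volume.restrict (Set.uIoc (-T) T)).prod MeasureTheory.volume) :=
      MeasureTheory.Integrable.mul_prod (f := fun _ : ℝ => (1 : ℂ)) (g := g)
        (MeasureTheory.integrable_const _) hg
    simp only [one_mul] at hm
    refine hm.mul_bdd (c := 1) (f := fun p : ℝ × ℝ => g p.2)
      (g := fun p : ℝ × ℝ => Complex.exp (p.1 * ((p.2 - x : ℝ) : ℂ) * Complex.I)) ?_ ?_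
    · exact (by fun_prop : Continuous _).aestronglyMeasurable
    · exact Eventually.of_forall fun p => (norm_exp_mul_mul_I _ _).le

namespace DecayingPiecewiseC1

variable {S : Finset ℝ} {ε C : ℝ} {g : ℝ → ℂ} {j : ℝ → ℂ}

/-- The truncated inverse Fourier integral in terms of the sine integral. -/
lemma integral_fourierInt_eq (h : DecayingPiecewiseC1 S ε C g) (hj : IsJump S g j) (T x : ℝ) :
    ∫ t in -T..T, fourierInt g t * Complex.exp (-(t * x * Complex.I)) =
      2 * ((∫ y, deriv g y * (sineIntegral (T * (x - y)) : ℂ)) +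
        ∑ α ∈ S, j α * (sineIntegral (T * (x - α)) : ℂ)) := by
  rw [integral_fourierInt_mul_exp h.integrable]
  have hK : ∀ y : ℝ, HasDerivAt (fun y : ℝ => ((-2 * sineIntegral (T * (x - y)) : ℝ) : ℂ))
      (2 * T * Real.sinc (T * (y - x))) y := by
    intro y
    have h1 : HasDerivAt (fun y : ℝ => T * (x - y)) (-T) y := by
      simpa using ((hasDerivAt_id y).const_sub x).const_mul T
    have h2 := (((hasDerivAt_sineIntegral _).comp y h1).const_mul (-2)).ofReal_comp
    refine h2.congr_deriv ?_
    rw [show T * (x - y) = -(T * (y - x)) by ring, Real.sinc_neg]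
    push_cast
    ring
  have hk : Continuous fun y : ℝ => (2 * T * Real.sinc (T * (y - x)) : ℂ) := by
    have := Real.continuous_sinc
    fun_prop
  rw [h.integral_mul_eq hj (B := max (2 * (|sineLimit| + 2)) (2 * |T|)) hK hk (fun y => ?_)
    (fun y => ?_)]
  · have e1 : ∀ y, deriv g y * ((-2 * sineIntegral (T * (x - y)) : ℝ) : ℂ) =
        (-2) * (deriv g y * (sineIntegral (T * (x - y)) : ℂ)) := fun y => by push_cast; ring
    have e2 : ∀ y, j y * ((-2 * sineIntegral (T * (x - y)) : ℝ) : ℂ) =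
        (-2) * (j y * (sineIntegral (T * (x - y)) : ℂ)) := fun y => by push_cast; ring
    simp only [e1, e2, MeasureTheory.integral_const_mul, ← Finset.mul_sum]
    ring
  · rw [Complex.norm_real, Real.norm_eq_abs, abs_mul, abs_neg, abs_two]
    refine le_max_of_le_left ?_
    gcongr
    exact abs_sineIntegral_le_const _
  · refine le_max_of_le_right ?_
    simp only [norm_mul, Complex.norm_real, Real.norm_eq_abs]
    have := Real.abs_sinc_le_one (T * (y - x))
    rw [Complex.norm_ofNat]
    nlinarith [abs_nonneg T]

/-- The truncated inverse Fourier integrals are bounded uniformly in the truncation and in the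
point; this dominates the termwise inversion of a Dirichlet series. -/
lemma norm_integral_fourierInt_le (h : DecayingPiecewiseC1 S ε C g) :
    ∃ B, ∀ T x : ℝ, ‖∫ t in -T..T, fourierInt g t * Complex.exp (-(t * x * Complex.I))‖ ≤ B := by
  obtain ⟨j, hj, -⟩ := h.pc.exists_isJump
  refine ⟨2 * ((∫ y, ‖deriv g y‖ * (|sineLimit| + 2)) + ∑ α ∈ S, ‖j α‖ * (|sineLimit| + 2)),
    fun T x => ?_⟩
  rw [h.integral_fourierInt_eq hj, norm_mul, Complex.norm_ofNat]
  gcongr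
  refine (norm_add_le _ _).trans (add_le_add ?_ ?_)
  · refine MeasureTheory.norm_integral_le_of_norm_le (h.integrable_deriv.norm.mul_const _)
      (Eventually.of_forall fun y => ?_)
    rw [norm_mul, Complex.norm_real, Real.norm_eq_abs]
    gcongr
    exact abs_sineIntegral_le_const _
  · refine norm_sum_le_of_le _ fun α _ => ?_
    rw [norm_mul, Complex.norm_real, Real.norm_eq_abs]
    gcongr
    exact abs_sineIntegral_le_const _

lemma tendsto_integral_fourierInt_aux (h : DecayingPiecewiseC1 S ε C g) (x : ℝ) :
    Tendsto (fun T : ℝ => ∫ t in -T..T, fourierInt g t * Complex.exp (-(t * x * Complex.I))) atTop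
      (𝓝 (4 * sineLimit * g x)) := by
  obtain ⟨j, hj, -⟩ := h.pc.exists_isJump
  simp only [h.integral_fourierInt_eq hj]
  have hpt : ∀ y : ℝ, Tendsto (fun T : ℝ => (sineIntegral (T * (x - y)) : ℂ)) atTop
      (𝓝 ((sineLimit : ℂ) * (Real.sign (x - y) : ℂ))) := fun y => by
    rw [← Complex.ofReal_mul]
    exact (Complex.continuous_ofReal.tendsto _).comp (tendsto_sineIntegral_mul _)
  have h1 : Tendsto (fun T : ℝ => ∫ y, deriv g y * (sineIntegral (T * (x - y)) : ℂ)) atTop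
      (𝓝 (∫ y, deriv g y * ((sineLimit : ℂ) * (Real.sign (x - y) : ℂ)))) := by
    refine MeasureTheory.tendsto_integral_filter_of_dominated_convergence
      (fun y => ‖deriv g y‖ * (|sineLimit| + 2)) (Eventually.of_forall fun T => ?_)
      (Eventually.of_forall fun T => Eventually.of_forall fun y => ?_)
      (h.integrable_deriv.norm.mul_const _)
      (Eventually.of_forall fun y => (hpt y).const_mul _)
    · have := continuous_sineIntegral
      exact h.pc.aestronglyMeasurable_deriv.mul (by fun_prop : Continuous _).aestronglyMeasurable
    · rw [norm_mul, Complex.norm_real, Real.norm_eq_abs]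
      gcongr
      exact abs_sineIntegral_le_const _
  have h2 : Tendsto (fun T : ℝ => ∑ α ∈ S, j α * (sineIntegral (T * (x - α)) : ℂ)) atTop
      (𝓝 (∑ α ∈ S, j α * ((sineLimit : ℂ) * (Real.sign (x - α) : ℂ)))) :=
    tendsto_finsetSum _ fun α _ => (hpt α).const_mul _
  refine ((h1.add h2).const_mul 2).congr' EventuallyEq.rfl |>.trans (le_of_eq ?_)
  congr 1
  have := h.eq_integral_sign hj x
  simp only [mul_left_comm _ (sineLimit : ℂ) _, MeasureTheory.integral_const_mul,
    ← Finset.mul_sum, ← mul_add, this]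
  ring

end DecayingPiecewiseC1

lemma two_mul_exp_abs_sub_sq_le (x : ℝ) :
    2 * |x| * Real.exp (-x ^ 2) ≤ 2 * Real.exp 1 * Real.exp (-1 * |x|) := by
  have h1 : |x| ≤ Real.exp |x| := by linarith [Real.add_one_le_exp |x|]
  calc 2 * |x| * Real.exp (-x ^ 2) ≤ 2 * Real.exp |x| * Real.exp (-x ^ 2) := by gcongr
    _ = 2 * Real.exp (|x| - x ^ 2) := by rw [mul_assoc, ← Real.exp_add]; ring_nf
    _ ≤ 2 * Real.exp (1 + -1 * |x|) := by
      gcongr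
      nlinarith [sq_nonneg (|x| - 1), sq_abs x]
    _ = _ := by rw [Real.exp_add]; ring

/-- The Gaussian serves as a test function for the value of the Dirichlet integral. -/
lemma decayingPiecewiseC1_gaussian :
    DecayingPiecewiseC1 ∅ 1 (2 * Real.exp 1) (fun x : ℝ => Complex.exp (-1 * x ^ 2)) := by
  have hd : ∀ x : ℝ, HasDerivAt (fun x : ℝ => Complex.exp (-1 * x ^ 2))
      (-2 * x * Complex.exp (-1 * x ^ 2)) x := by
    intro x
    have h1 : HasDerivAt (fun x : ℝ => Real.exp (-1 * x ^ 2)) (-2 * x * Real.exp (-1 * x ^ 2)) x := by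
      have := ((hasDerivAt_pow 2 x).const_mul (-1)).exp
      refine this.congr_deriv ?_
      push_cast; ring
    have h2 := h1.ofReal_comp
    push_cast at h2
    exact h2
  have hnorm : ∀ x : ℝ, ‖Complex.exp (-1 * (x : ℂ) ^ 2)‖ = Real.exp (-x ^ 2) := fun x => by
    rw [Complex.norm_exp]
    congr 1
    norm_cast
    simp
  have hderiv : deriv (fun x : ℝ => Complex.exp (-1 * (x : ℂ) ^ 2)) =
      fun x : ℝ => -2 * (x : ℂ) * Complex.exp (-1 * (x : ℂ) ^ 2) := funext fun x => (hd x).deriv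
  refine ⟨⟨fun x _ => (hd x).differentiableAt, fun x _ => ?_, by simp⟩, one_pos, fun x => ?_,
    fun x => ?_⟩
  · rw [hderiv]
    exact (by fun_prop : Continuous _).continuousAt
  · rw [hnorm]
    calc Real.exp (-x ^ 2) ≤ Real.exp (1 + -1 * |x|) := by
          gcongr
          nlinarith [sq_nonneg (|x| - 1), sq_abs x, abs_nonneg x]
      _ = Real.exp 1 * Real.exp (-1 * |x|) := Real.exp_add _ _
      _ ≤ _ := by gcongr; linarith [Real.exp_pos 1]
  · rw [hderiv]
    simp only [norm_mul, hnorm, norm_neg, Complex.norm_ofNat, Complex.norm_real, Real.norm_eq_abs]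
    exact two_mul_exp_abs_sub_sq_le x

/-- The Dirichlet integral. -/
lemma sineLimit_eq : sineLimit = Real.pi / 2 := by
  have h1 := decayingPiecewiseC1_gaussian.tendsto_integral_fourierInt_aux 0
  have hF : ∀ t : ℝ, fourierInt (fun x : ℝ => Complex.exp (-1 * x ^ 2)) t =
      (Real.sqrt Real.pi : ℂ) * ((Real.exp (-(1 / 4) * t ^ 2) : ℝ) : ℂ) := by
    intro t
    have h := fourierIntegral_gaussian (b := 1) (by simp) (t : ℂ)
    have e : fourierInt (fun x : ℝ => Complex.exp (-1 * x ^ 2)) t =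
        ∫ x : ℝ, Complex.exp (Complex.I * t * x) * Complex.exp (-1 * (x : ℂ) ^ 2) := by
      rw [fourierInt]
      congr 1 with x
      rw [mul_comm]
      ring_nf
    rw [e, h, div_one, Real.sqrt_eq_rpow, Complex.ofReal_cpow Real.pi_pos.le]
    push_cast
    ring_nf
  have hint : MeasureTheory.Integrable fun t : ℝ => Real.exp (-(1 / 4) * t ^ 2) :=
    integrable_exp_neg_mul_sq (by norm_num)
  simp only [hF, Complex.ofReal_zero, mul_zero, zero_mul, neg_zero, Complex.exp_zero, mul_one] at h1
  have h2 : Tendsto (fun T : ℝ => ∫ t in -T..T, (Real.sqrt Real.pi : ℂ) *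
      ((Real.exp (-(1 / 4) * t ^ 2) : ℝ) : ℂ)) atTop
      (𝓝 (∫ t : ℝ, (Real.sqrt Real.pi : ℂ) * ((Real.exp (-(1 / 4) * t ^ 2) : ℝ) : ℂ))) :=
    MeasureTheory.intervalIntegral_tendsto_integral (hint.ofReal.const_mul _)
      tendsto_neg_atTop_atBot tendsto_id
  have h3 := tendsto_nhds_unique h1 h2
  rw [MeasureTheory.integral_const_mul, integral_complex_ofReal, integral_gaussian] at h3
  have h4 : 4 * sineLimit = Real.sqrt Real.pi * Real.sqrt (Real.pi / (1 / 4)) := by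
    rw [show Complex.exp (-1 * 0 ^ 2) = 1 by simp, mul_one] at h3
    exact_mod_cast h3
  rw [← Real.sqrt_mul Real.pi_pos.le, show Real.pi * (Real.pi / (1 / 4)) = (2 * Real.pi) ^ 2 by ring,
    Real.sqrt_sq (by positivity)] at h4
  linarith

namespace DecayingPiecewiseC1

variable {S : Finset ℝ} {ε C : ℝ} {g : ℝ → ℂ}

/-- Fourier inversion: the symmetric partial integrals converge, at jumps to the mean value. -/
lemma tendsto_integral_fourierInt (h : DecayingPiecewiseC1 S ε C g) (x : ℝ) :
    Tendsto (fun T : ℝ => ∫ t in -T..T, fourierInt g t * Complex.exp (-(t * x * Complex.I))) atTop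
      (𝓝 (2 * Real.pi * g x)) := by
  have := h.tendsto_integral_fourierInt_aux x
  rw [sineLimit_eq] at this
  convert this using 2
  push_cast
  ring

end DecayingPiecewiseC1

lemma integrable_comp_abs {f : ℝ → ℝ} (hf : MeasureTheory.IntegrableOn f (Set.Ioi 0)) :
    MeasureTheory.Integrable fun x => f |x| := by
  have h1 : MeasureTheory.IntegrableOn (fun x => f |x|) (Set.Ioi 0) :=
    hf.congr_fun (fun x hx => by simp only [abs_of_pos (show 0 < x from hx)]) measurableSet_Ioi
  have h2 : MeasureTheory.IntegrableOn (fun x => f |x|) (Set.Iic 0) := by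
    rw [← MeasureTheory.Measure.map_neg_eq_self (MeasureTheory.volume : MeasureTheory.Measure ℝ)]
    have m : MeasurableEmbedding fun x : ℝ => -x := (Homeomorph.neg ℝ).measurableEmbedding
    rw [m.integrableOn_map_iff]
    simp_rw [Function.comp_def, abs_neg, Set.neg_preimage, Set.neg_Iic, neg_zero]
    exact Iff.mpr integrableOn_Ici_iff_integrableOn_Ioi h1
  rw [← MeasureTheory.integrableOn_univ, ← Set.Iic_union_Ioi (a := (0 : ℝ))]
  exact h2.union h1

namespace DecayingPiecewiseC1

variable {S : Finset ℝ} {ε C : ℝ} {g : ℝ → ℂ}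

/-- The Fourier transform decays like `1/|t|`, with an explicit constant. -/
lemma norm_fourierInt_mul_le (h : DecayingPiecewiseC1 S ε C g) (t : ℝ) :
    ‖fourierInt g t‖ * |t| ≤ C * (∫ x, Real.exp (-ε * |x|)) + S.card * (2 * C) := by
  have hC := h.const_nonneg
  have hI : 0 ≤ ∫ x, Real.exp (-ε * |x|) :=
    MeasureTheory.integral_nonneg fun x => (Real.exp_pos _).le
  rcases eq_or_ne t 0 with rfl | ht
  · rw [abs_zero, mul_zero]
    positivity
  obtain ⟨j, hj, hjb⟩ := h.pc.exists_isJump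
  have ht' : (t : ℂ) * Complex.I ≠ 0 := mul_ne_zero (by exact_mod_cast ht) Complex.I_ne_zero
  have hK : ∀ y : ℝ, HasDerivAt (fun y : ℝ => Complex.exp (t * y * Complex.I))
      (t * Complex.I * Complex.exp (t * y * Complex.I)) y := by
    intro y
    have h1 : HasDerivAt (fun y : ℝ => (t : ℂ) * y * Complex.I) (t * Complex.I) y := by
      simpa using ((Complex.ofRealCLM.hasDerivAt (x := y)).const_mul (t : ℂ)).mul_const Complex.I
    exact (h1.cexp).congr_deriv (mul_comm _ _)
  have h1 := h.integral_mul_eq hj (B := max 1 |t|) hK (by fun_prop)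
    (fun y => by rw [norm_exp_mul_mul_I]; exact le_max_left _ _)
    (fun y => by
      rw [norm_mul, norm_exp_mul_mul_I, mul_one, norm_mul, Complex.norm_I, mul_one,
        Complex.norm_real]
      exact le_max_right _ _)
  have e1 : ∫ y, g y * (t * Complex.I * Complex.exp (t * y * Complex.I)) =
      t * Complex.I * fourierInt g t := by
    rw [fourierInt, ← MeasureTheory.integral_const_mul]
    congr 1 with y
    ring
  have e2 : ‖fourierInt g t‖ * |t| = ‖t * Complex.I * fourierInt g t‖ := by
    rw [norm_mul, norm_mul, Complex.norm_I, Complex.norm_real, Real.norm_eq_abs]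
    ring
  rw [e2, ← e1, h1, norm_neg, ← MeasureTheory.integral_const_mul]
  refine (norm_add_le _ _).trans (add_le_add ?_ ?_)
  · refine MeasureTheory.norm_integral_le_of_norm_le
      ((integrable_exp_neg_mul_abs h.pos).const_mul C) (Eventually.of_forall fun y => ?_)
    rw [norm_mul, norm_exp_mul_mul_I, mul_one]
    exact h.bound_deriv y
  · refine (norm_sum_le_of_le S (f := fun α => j α * Complex.exp (t * α * Complex.I))
      (n := fun _ => 2 * C) fun α _ => ?_).trans (by simp)
    rw [norm_mul, norm_exp_mul_mul_I, mul_one]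
    exact hjb C h.norm_le α

/-- Fourier inversion at the origin, with a rate of convergence. -/
lemma norm_integral_fourierInt_sub_le (h : DecayingPiecewiseC1 S ε C g) :
    ∃ D, 0 ≤ D ∧ ∀ T : ℝ, 0 < T →
      ‖(∫ t in -T..T, fourierInt g t) - 2 * Real.pi * g 0‖ ≤ D * T ^ (-(1 / 2) : ℝ) := by
  obtain ⟨j, hj, -⟩ := h.pc.exists_isJump
  have hC := h.const_nonneg
  set A := 2 * |sineLimit| + 2 with hA
  have hA0 : 0 ≤ A := by positivity
  have hint : MeasureTheory.Integrable fun y : ℝ => |y| ^ (-(1 / 2) : ℝ) * Real.exp (-ε * |y|) := by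
    have := integrableOn_rpow_mul_exp_neg_mul_rpow (s := -(1 / 2)) (p := 1) (b := ε)
      (by norm_num) one_pos h.pos
    simp only [Real.rpow_one] at this
    exact integrable_comp_abs (f := fun y => y ^ (-(1 / 2) : ℝ) * Real.exp (-ε * y)) this
  have hSi : ∀ T y : ℝ, 0 < T → ‖(sineIntegral (T * (0 - y)) : ℂ) -
      ((sineLimit : ℂ) * (Real.sign (0 - y) : ℂ))‖ ≤ A * (T ^ (-(1 / 2) : ℝ) * |y| ^ (-(1 / 2) : ℝ)) := by
    intro T y hT
    rw [← Complex.ofReal_mul, ← Complex.ofReal_sub, Complex.norm_real, Real.norm_eq_abs]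
    rcases eq_or_ne y 0 with rfl | hy
    · simp
    have h1 := abs_sineIntegral_sub_sign_le
      (mul_ne_zero hT.ne' (sub_ne_zero.2 hy.symm) : T * (0 - y) ≠ 0)
    rw [abs_mul, zero_sub, abs_neg, abs_of_pos hT,
      Real.mul_rpow hT.le (abs_nonneg y)] at h1
    have h3 : Real.sign (T * -y) = Real.sign (-y) := by
      rcases (neg_ne_zero.2 hy).lt_or_gt with h | h
      · rw [Real.sign_of_neg h, Real.sign_of_neg (mul_neg_of_pos_of_neg hT h)]
      · rw [Real.sign_of_pos h, Real.sign_of_pos (mul_pos hT h)]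
    rw [h3] at h1
    rwa [zero_sub]
  refine ⟨2 * ((∫ y, (C * A) * (|y| ^ (-(1 / 2) : ℝ) * Real.exp (-ε * |y|))) +
    ∑ α ∈ S, ‖j α‖ * (A * |α| ^ (-(1 / 2) : ℝ))), ?_, fun T hT => ?_⟩
  · refine mul_nonneg zero_le_two (add_nonneg (MeasureTheory.integral_nonneg fun y => ?_)
      (Finset.sum_nonneg fun α _ => by positivity))
    positivity
  have hT' : 0 ≤ T ^ (-(1 / 2) : ℝ) := by positivity
  have e1 : ∫ t in -T..T, fourierInt g t = 2 * ((∫ y, deriv g y * (sineIntegral (T * (0 - y)) : ℂ)) +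
        ∑ α ∈ S, j α * (sineIntegral (T * (0 - α)) : ℂ)) := by
    have := h.integral_fourierInt_eq hj T 0
    simpa using this
  have e2 : 2 * Real.pi * g 0 = 2 * ((∫ y, deriv g y *
      ((sineLimit : ℂ) * (Real.sign (0 - y) : ℂ))) +
        ∑ α ∈ S, j α * ((sineLimit : ℂ) * (Real.sign (0 - α) : ℂ))) := by
    have := h.eq_integral_sign hj 0
    simp only [mul_left_comm _ (sineLimit : ℂ) _, MeasureTheory.integral_const_mul,
      ← Finset.mul_sum, ← mul_add, this]
    rw [sineLimit_eq]; push_cast; ring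
  have hi1 : MeasureTheory.Integrable fun y => deriv g y * (sineIntegral (T * (0 - y)) : ℂ) := by
    refine h.integrable_deriv.mul_bdd (c := |sineLimit| + 2) ?_ (Eventually.of_forall fun y => ?_)
    · have := continuous_sineIntegral
      exact (by fun_prop : Continuous fun y => (sineIntegral (T * (0 - y)) : ℂ)).aestronglyMeasurable
    · rw [Complex.norm_real, Real.norm_eq_abs]
      exact abs_sineIntegral_le_const _
  have hi2 : MeasureTheory.Integrable fun y => deriv g y *
      ((sineLimit : ℂ) * (Real.sign (0 - y) : ℂ)) := by
    refine h.integrable_deriv.mul_bdd (c := |sineLimit| * 1)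
      ((aestronglyMeasurable_sign 0).const_mul _) (Eventually.of_forall fun y => ?_)
    rw [norm_mul, Complex.norm_real, Real.norm_eq_abs]
    gcongr
    exact norm_sign_le _
  rw [e1, e2, ← mul_sub, add_sub_add_comm, ← MeasureTheory.integral_sub hi1 hi2,
    ← Finset.sum_sub_distrib, norm_mul, Complex.norm_ofNat, mul_assoc, add_mul]
  gcongr
  refine (norm_add_le _ _).trans (add_le_add ?_ ?_)
  · rw [← MeasureTheory.integral_mul_const]
    refine MeasureTheory.norm_integral_le_of_norm_le ((hint.const_mul _).mul_const _)
      (Eventually.of_forall fun y => ?_)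
    rw [← mul_sub, norm_mul]
    calc _ ≤ (C * Real.exp (-ε * |y|)) * (A * (T ^ (-(1 / 2) : ℝ) * |y| ^ (-(1 / 2) : ℝ))) := by
          gcongr
          exacts [h.bound_deriv y, hSi T y hT]
      _ = _ := by ring
  · rw [Finset.sum_mul]
    refine norm_sum_le_of_le _ fun α _ => ?_
    rw [← mul_sub, norm_mul]
    calc _ ≤ ‖j α‖ * (A * (T ^ (-(1 / 2) : ℝ) * |α| ^ (-(1 / 2) : ℝ))) := by
          gcongr
          exact hSi T α hT
      _ = _ := by ring

end DecayingPiecewiseC1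

lemma hasDerivAt_log_add_sq {c : ℝ} (hc : 0 < c) (t : ℝ) :
    HasDerivAt (fun t : ℝ => Real.log (c + t ^ 2)) (2 * t / (c + t ^ 2)) t := by
  have h1 : HasDerivAt (fun t : ℝ => c + t ^ 2) (2 * t) t := by
    simpa using (hasDerivAt_pow 2 t).const_add c
  exact h1.log (by positivity)

lemma tendsto_log_add_sq_mul_rpow {c : ℝ} (hc : 0 < c) :
    Tendsto (fun T : ℝ => Real.log (c + T ^ 2) * T ^ (-(1 / 2) : ℝ)) atTop (𝓝 0) := by
  have h1 : Tendsto (fun T : ℝ => 3 * (Real.log T / T ^ (1 / 2 : ℝ))) atTop (𝓝 0) := by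
    simpa using ((isLittleO_log_rpow_atTop (r := 1 / 2) (by norm_num)).tendsto_div_nhds_zero).const_mul 3
  refine squeeze_zero' ?_ ?_ h1
  · filter_upwards [eventually_ge_atTop 1] with T hT
    have : 0 ≤ Real.log (c + T ^ 2) := Real.log_nonneg (by nlinarith)
    positivity
  · filter_upwards [eventually_ge_atTop (max 2 c)] with T hT
    have h2 : 2 ≤ T := (le_max_left _ _).trans hT
    have h3 : c ≤ T := (le_max_right _ _).trans hT
    have h4 : Real.log (c + T ^ 2) ≤ 3 * Real.log T := by
      rw [← Real.log_rpow (by linarith)]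
      refine Real.log_le_log (by positivity) ?_
      have : T ^ (3 : ℝ) = T ^ 3 := by norm_cast
      rw [this]
      nlinarith [mul_nonneg (by linarith : 0 ≤ T - 2) (by linarith : 0 ≤ T),
        mul_nonneg (mul_nonneg (by linarith : 0 ≤ T - 2) (by linarith : 0 ≤ T))
          (by linarith : 0 ≤ T)]
    rw [Real.rpow_neg (by linarith), ← div_eq_mul_inv, ← mul_div_assoc]
    gcongr

namespace DecayingPiecewiseC1

variable {S : Finset ℝ} {ε C : ℝ} {g : ℝ → ℂ}

/-- The Fourier transform, which decays only like `1/|t|`, may be integrated symmetrically against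
a logarithmic weight: integrate by parts and use the rate of convergence in Fourier inversion at the
origin. -/
lemma exists_tendsto_integral_log_mul (h : DecayingPiecewiseC1 S ε C g) {c : ℝ} (hc : 0 < c) :
    ∃ L : ℂ, Tendsto (fun T : ℝ => ∫ t in -T..T, (Real.log (c + t ^ 2) : ℂ) * fourierInt g t)
      atTop (𝓝 L) := by
  obtain ⟨D, hD0, hD⟩ := h.norm_integral_fourierInt_sub_le
  have hcont := continuous_fourierInt h.integrable
  set p : ℝ → ℂ := fun t => fourierInt g t + fourierInt g (-t) with hp
  have hpc : Continuous p := hcont.add (hcont.comp continuous_neg)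
  set P : ℝ → ℂ := fun T => ∫ t in (0 : ℝ)..T, p t with hP
  have fold : ∀ (w : ℝ → ℂ), Continuous w → (∀ t, w (-t) = w t) → ∀ T : ℝ,
      ∫ t in -T..T, w t * fourierInt g t = ∫ t in (0 : ℝ)..T, w t * p t := by
    intro w hw hev T
    have hc1 : Continuous fun t => w t * fourierInt g t := hw.mul hcont
    rw [← intervalIntegral.integral_add_adjacent_intervals (b := 0)
      (hc1.intervalIntegrable _ _) (hc1.intervalIntegrable _ _)]
    have e := intervalIntegral.integral_comp_neg (a := 0) (b := T) fun t => w t * fourierInt g t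
    simp only [neg_zero, hev] at e
    have hc2 : Continuous fun t => w t * fourierInt g (-t) := hw.mul (hcont.comp continuous_neg)
    rw [← e, ← intervalIntegral.integral_add (hc2.intervalIntegrable _ _)
      (hc1.intervalIntegrable _ _)]
    congr 1 with t
    simp only [hp]; ring
  have hPeq : ∀ T, P T = ∫ t in -T..T, fourierInt g t := fun T => by
    have := fold (fun _ => 1) continuous_const (fun _ => rfl) T
    simp only [one_mul] at this
    rw [this]
  have hPd : ∀ T, HasDerivAt P (p T) T := fun T =>
    intervalIntegral.integral_hasDerivAt_right (hpc.intervalIntegrable _ _)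
      (hpc.stronglyMeasurableAtFilter _ _) hpc.continuousAt
  have hPc : Continuous P := continuous_iff_continuousAt.2 fun T => (hPd T).continuousAt
  have hw : ∀ t : ℝ, HasDerivAt (fun t : ℝ => (Real.log (c + t ^ 2) : ℂ))
      ((2 * t / (c + t ^ 2) : ℝ) : ℂ) t := fun t => (hasDerivAt_log_add_sq hc t).ofReal_comp
  have hwc : Continuous fun t : ℝ => (Real.log (c + t ^ 2) : ℂ) :=
    continuous_iff_continuousAt.2 fun T => (hw T).continuousAt
  have hw'c : Continuous fun t : ℝ => ((2 * t / (c + t ^ 2) : ℝ) : ℂ) := by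
    refine Complex.continuous_ofReal.comp (Continuous.div (by fun_prop) (by fun_prop) fun t => ?_)
    positivity
  set Q : ℝ → ℂ := fun T => P T - 2 * Real.pi * g 0 with hQ
  have hQb : ∀ T, 0 < T → ‖Q T‖ ≤ D * T ^ (-(1 / 2) : ℝ) := fun T hT => by
    simp only [hQ, hPeq]; exact hD T hT
  have hQc : Continuous Q := hPc.sub continuous_const
  have parts : ∀ T : ℝ, ∫ t in -T..T, (Real.log (c + t ^ 2) : ℂ) * fourierInt g t =
      (Real.log (c + T ^ 2) : ℂ) * Q T - (Real.log (c + 0 ^ 2) : ℂ) * Q 0 -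
        ∫ t in (0 : ℝ)..T, ((2 * t / (c + t ^ 2) : ℝ) : ℂ) * Q t := by
    intro T
    rw [fold _ hwc (fun t => by simp)]
    exact intervalIntegral.integral_mul_deriv_eq_deriv_mul (fun t _ => hw t)
      (fun t _ => (hPd t).sub_const _) (hw'c.intervalIntegrable _ _) (hpc.intervalIntegrable _ _)
  have hi : MeasureTheory.IntegrableOn (fun t : ℝ => ((2 * t / (c + t ^ 2) : ℝ) : ℂ) * Q t)
      (Set.Ioi 0) := by
    have hcc : Continuous fun t : ℝ => ((2 * t / (c + t ^ 2) : ℝ) : ℂ) * Q t := hw'c.mul hQc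
    rw [← Set.Ioc_union_Ioi_eq_Ioi (zero_le_one : (0 : ℝ) ≤ 1)]
    refine MeasureTheory.IntegrableOn.union ?_ ?_
    · exact (hcc.integrableOn_Icc (a := 0) (b := 1)).mono_set Set.Ioc_subset_Icc_self
    · have h0 := (integrableOn_Ioi_rpow_of_lt (a := -(3 / 2)) (by norm_num) one_pos).const_mul (2 * D)
      refine MeasureTheory.Integrable.mono' h0 hcc.aestronglyMeasurable ?_
      refine (MeasureTheory.ae_restrict_iff' measurableSet_Ioi).2 (Eventually.of_forall fun t ht => ?_)
      have ht1 : (1 : ℝ) < t := ht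
      have ht0 : 0 < t := by linarith
      rw [norm_mul, Complex.norm_real, Real.norm_eq_abs, abs_of_nonneg (by positivity)]
      have h1 : 2 * t / (c + t ^ 2) ≤ 2 * t ^ (-1 : ℝ) := by
        rw [Real.rpow_neg_one, div_le_iff₀ (by positivity)]
        field_simp
        nlinarith
      calc _ ≤ (2 * t ^ (-1 : ℝ)) * (D * t ^ (-(1 / 2) : ℝ)) := by
            gcongr
            exact hQb t ht0
        _ = 2 * D * (t ^ (-1 : ℝ) * t ^ (-(1 / 2) : ℝ)) := by ring
        _ = _ := by rw [← Real.rpow_add ht0]; norm_num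
  refine ⟨0 - (Real.log (c + 0 ^ 2) : ℂ) * Q 0 -
    ∫ t in Set.Ioi (0 : ℝ), ((2 * t / (c + t ^ 2) : ℝ) : ℂ) * Q t, ?_⟩
  simp only [parts]
  refine Tendsto.sub (Tendsto.sub ?_ tendsto_const_nhds)
    (MeasureTheory.intervalIntegral_tendsto_integral_Ioi 0 hi tendsto_id)
  have h1 := (tendsto_log_add_sq_mul_rpow hc).norm.mul_const D
  rw [norm_zero, zero_mul] at h1
  refine squeeze_zero_norm' ?_ h1
  filter_upwards [eventually_gt_atTop 0] with T hT
  rw [norm_mul, Complex.norm_real, norm_mul, mul_assoc]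
  gcongr
  rw [Real.norm_of_nonneg (by positivity : 0 ≤ T ^ (-(1 / 2) : ℝ)), mul_comm]
  exact hQb T hT

end DecayingPiecewiseC1

/-! ### The two-sided Laplace transform -/

lemma laplaceTransform_eq_fourierInt (φ : ℝ → ℂ) (σ t : ℝ) :
    laplaceTransform φ (-(σ + t * Complex.I)) =
      fourierInt (fun x => φ x * (Real.exp (σ * x) : ℂ)) t := by
  rw [laplaceTransform, fourierInt]
  congr 1 with x
  rw [mul_assoc, Complex.ofReal_exp, ← Complex.exp_add]
  congr 2
  push_cast
  ring

lemma laplaceTransform_eq_fourierInt' (φ : ℝ → ℂ) (s : ℂ) :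
    laplaceTransform φ s = fourierInt (fun x => φ x * (Real.exp (-s.re * x) : ℂ)) (-s.im) := by
  rw [← laplaceTransform_eq_fourierInt]
  congr 1
  apply Complex.ext <;> simp

/-- The weighted functions `φ(x) e^{σx}` for `σ` in the open strip, with explicit constants. -/
def StripDecay (S : Finset ℝ) (b C : ℝ) (φ : ℝ → ℂ) : Prop :=
  ∀ ε σ : ℝ, 0 < ε → |σ - 1 / 2| + ε ≤ 1 / 2 + b →
    DecayingPiecewiseC1 S ε (C * (1 + |σ|)) (fun x => φ x * (Real.exp (σ * x) : ℂ))

namespace StripDecay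

variable {S : Finset ℝ} {b C : ℝ} {φ : ℝ → ℂ}

lemma integrable (h : StripDecay S b C φ) {s : ℂ} (h1 : -(1 + b) < s.re) (h2 : s.re < b) :
    MeasureTheory.Integrable (fun x : ℝ => φ x * Complex.exp (-s * x)) := by
  have habs : |-s.re - 1 / 2| < 1 / 2 + b := by rw [abs_lt]; constructor <;> linarith
  have h3 := (h (1 / 2 + b - |-s.re - 1 / 2|) (-s.re) (by linarith) (by linarith)).integrable
  have h4 := h3.mul_bdd (c := 1) (g := fun x : ℝ => Complex.exp ((-s.im : ℝ) * x * Complex.I))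
    (by fun_prop : Continuous _).aestronglyMeasurable
    (Eventually.of_forall fun x => (norm_exp_mul_mul_I _ _).le)
  refine h4.congr (Eventually.of_forall fun x => ?_)
  simp only
  rw [mul_assoc, Complex.ofReal_exp, ← Complex.exp_add]
  congr 2
  conv_rhs => rw [← Complex.re_add_im s]
  push_cast
  ring

lemma differentiableAt (h : StripDecay S b C φ) {s : ℂ} (h1 : -(1 + b) < s.re) (h2 : s.re < b) :
    DifferentiableAt ℂ (laplaceTransform φ) s := by
  have habs : |-s.re - 1 / 2| < 1 / 2 + b := by rw [abs_lt]; constructor <;> linarith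
  set m := (1 / 2 + b - |-s.re - 1 / 2|) / 2 with hm
  have hm0 : 0 < m := by linarith
  set A := C * (1 + |s.re|) with hA
  have hA0 : 0 ≤ A := (h (2 * m) (-s.re) (by linarith) (by linarith)).const_nonneg.trans
    (by rw [abs_neg])
  -- a common bound for the weighted functions with parameters near `s`
  have hbd : ∀ z ∈ Metric.ball s m, ∀ x : ℝ, ‖φ x * Complex.exp (-z * x)‖ ≤
      A * Real.exp (-m * |x|) := by
    intro z hz x
    have hb0 := (h (2 * m) (-s.re) (by linarith) (by linarith)).bound x
    have e1 : φ x * Complex.exp (-z * x) =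
        φ x * (Real.exp (-s.re * x) : ℂ) * Complex.exp (-(z - s.re) * x) := by
      rw [mul_assoc, Complex.ofReal_exp, ← Complex.exp_add]
      congr 2; push_cast; ring
    rw [e1, norm_mul, Complex.norm_exp]
    have hz' : |(z - s).re| ≤ m := (Complex.abs_re_le_norm _).trans (by
      rw [← dist_eq_norm]; exact (Metric.mem_ball.1 hz).le)
    rw [abs_neg] at hb0
    have hre : (-(z - (s.re : ℂ)) * (x : ℂ)).re ≤ m * |x| := by
      have : (-(z - (s.re : ℂ)) * (x : ℂ)).re = -((z - s).re * x) := by simp; ring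
      rw [this]
      refine (neg_le_abs _).trans ?_
      rw [abs_mul]
      gcongr
    calc _ ≤ (A * Real.exp (-(2 * m) * |x|)) * Real.exp (m * |x|) :=
          mul_le_mul hb0 (Real.exp_le_exp.2 hre) (Real.exp_pos _).le (by positivity)
      _ = _ := by rw [mul_assoc, ← Real.exp_add]; congr 2; ring
  have hx : ∀ x : ℝ, |x| * Real.exp (-m * |x|) ≤ 2 / m * Real.exp (-(m / 2) * |x|) := by
    intro x
    have h3 : m / 2 * |x| ≤ Real.exp (m / 2 * |x|) := by linarith [Real.add_one_le_exp (m / 2 * |x|)]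
    have h4 : |x| ≤ 2 / m * Real.exp (m / 2 * |x|) := by
      rw [div_mul_eq_mul_div, le_div_iff₀ hm0]; linarith
    calc _ ≤ 2 / m * Real.exp (m / 2 * |x|) * Real.exp (-m * |x|) := by gcongr
      _ = _ := by rw [mul_assoc, ← Real.exp_add]; ring_nf
  have hsub : Metric.ball s m ⊆ {z : ℂ | -(1 + b) < z.re ∧ z.re < b} := by
    intro z hz
    have hz' : |(z - s).re| ≤ m := (Complex.abs_re_le_norm _).trans (by
      rw [← dist_eq_norm]; exact (Metric.mem_ball.1 hz).le)
    rw [Complex.sub_re, abs_le] at hz'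
    have h5 := neg_abs_le (-s.re - 1 / 2)
    have h6 := le_abs_self (-s.re - 1 / 2)
    constructor <;> linarith [hz'.1, hz'.2]
  have key := hasDerivAt_integral_of_dominated_loc_of_deriv_le (𝕜 := ℂ) (μ := MeasureTheory.volume)
    (F := fun (z : ℂ) (x : ℝ) => φ x * Complex.exp (-z * x))
    (F' := fun (z : ℂ) (x : ℝ) => (-x : ℂ) * (φ x * Complex.exp (-z * x)))
    (bound := fun x => A * (2 / m * Real.exp (-(m / 2) * |x|)))
    (x₀ := s) (s := Metric.ball s m) (Metric.ball_mem_nhds s hm0) ?_ (h.integrable h1 h2) ?_ ?_ ?_ ?_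
  · exact key.2.differentiableAt
  · filter_upwards [Metric.ball_mem_nhds s hm0] with z hz
    exact (h.integrable (hsub hz).1 (hsub hz).2).aestronglyMeasurable
  · exact (by fun_prop : Continuous fun x : ℝ => (-x : ℂ)).aestronglyMeasurable.mul
      (h.integrable h1 h2).aestronglyMeasurable
  · refine Eventually.of_forall fun x z hz => ?_
    rw [norm_mul, norm_neg, Complex.norm_real, Real.norm_eq_abs]
    calc _ ≤ |x| * (A * Real.exp (-m * |x|)) := by gcongr; exact hbd z hz x
      _ = A * (|x| * Real.exp (-m * |x|)) := by ring
      _ ≤ _ := mul_le_mul_of_nonneg_left (hx x) hA0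
  · exact ((integrable_exp_neg_mul_abs (half_pos hm0)).const_mul _).const_mul _
  · refine Eventually.of_forall fun x z hz => ?_
    have h3 : HasDerivAt (fun z : ℂ => -z * (x : ℂ)) (-x : ℂ) z := by
      simpa using (hasDerivAt_id z).neg.mul_const (x : ℂ)
    exact (h3.cexp.const_mul (φ x)).congr_deriv (by ring)

/-- The Laplace transform is `O(1/|t|)`, uniformly in closed substrips. -/
lemma exists_norm_le (h : StripDecay S b C φ) {a : ℝ} (ha : 0 < a) (hab : a < b) :
    ∃ B : ℝ, 0 ≤ B ∧ ∀ s : ℂ, -(1 + a) ≤ s.re → s.re ≤ a →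
      ‖laplaceTransform φ s‖ * |s.im| ≤ B := by
  have hI : 0 ≤ ∫ x, Real.exp (-(b - a) * |x|) :=
    MeasureTheory.integral_nonneg fun x => (Real.exp_pos _).le
  have hC : 0 ≤ C := by
    have := (h (b - a) 0 (by linarith) (by norm_num; linarith)).const_nonneg
    simpa using this
  refine ⟨C * (1 + (1 + a)) * (∫ x, Real.exp (-(b - a) * |x|)) + S.card * (2 * (C * (1 + (1 + a)))),
    by positivity, fun s h1 h2 => ?_⟩
  have habs : |-s.re - 1 / 2| ≤ 1 / 2 + a := by rw [abs_le]; constructor <;> linarith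
  have h3 := (h (b - a) (-s.re) (by linarith) (by linarith)).norm_fourierInt_mul_le (-s.im)
  rw [← laplaceTransform_eq_fourierInt', abs_neg, abs_neg] at h3
  have h4 : |s.re| ≤ 1 + a := by rw [abs_le]; constructor <;> linarith
  refine h3.trans ?_
  gcongr

end StripDecay

lemma exists_stripDecay {φ : ℝ → ℂ} {b : ℝ} (hA : PiecewiseC1WithMeanValue φ)
    (hB : ExpDecay φ b) : ∃ S C, StripDecay S b C φ := by
  obtain ⟨S, hS⟩ := hA
  obtain ⟨C, h0, h1, h2⟩ := exists_bound_of_expDecay (S := S) hS hB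
  exact ⟨S, C, fun ε σ hε hσ => decayingPiecewiseC1_mul_exp hS h0 h1 h2 hε hσ⟩

/-! ### The digamma function in vertical strips -/

/-- Derivatives converge at the centre of a disc on which a sequence of holomorphic functions
converges boundedly. -/
lemma tendsto_deriv_of_bounded {f : ℕ → ℂ → ℂ} {g : ℂ → ℂ} {c : ℂ} {R M : ℝ} (hR : 0 < R)
    (hf : ∀ᶠ n in atTop, DifferentiableOn ℂ (f n) (Metric.closedBall c R))
    (hg : DifferentiableOn ℂ g (Metric.closedBall c R))
    (hM : ∀ᶠ n in atTop, ∀ z ∈ Metric.closedBall c R, ‖f n z‖ ≤ M)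
    (hlim : ∀ z ∈ Metric.closedBall c R, Tendsto (fun n => f n z) atTop (𝓝 (g z))) :
    Tendsto (fun n => deriv (f n) c) atTop (𝓝 (deriv g c)) := by
  have cauchy : ∀ h : ℂ → ℂ, DifferentiableOn ℂ h (Metric.closedBall c R) →
      deriv h c = (2 * Real.pi * Complex.I)⁻¹ * ∮ z in C(c, R), (1 / (z - c) ^ 2) • h z := by
    intro h hh
    rw [(hh.mono Metric.closure_ball_subset_closedBall).diffContOnCl.deriv_eq_smul_circleIntegral hR]
    rw [smul_eq_mul, inv_mul_cancel_left₀ Complex.two_pi_I_ne_zero]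
  rw [cauchy g hg]
  have : (fun n => deriv (f n) c) =ᶠ[atTop] fun n =>
      (2 * Real.pi * Complex.I)⁻¹ * ∮ z in C(c, R), (1 / (z - c) ^ 2) • f n z :=
    hf.mono fun n hn => cauchy _ hn
  rw [tendsto_congr' this]
  refine Tendsto.const_mul _ ?_
  have hmem : ∀ θ, circleMap c R θ ∈ Metric.closedBall c R :=
    fun θ => circleMap_mem_closedBall c hR.le θ
  refine intervalIntegral.tendsto_integral_filter_of_dominated_convergence
    (fun _ => R * (1 / R ^ 2 * M)) ?_ ?_ intervalIntegrable_const
    (Eventually.of_forall fun θ _ => ((hlim _ (hmem θ)).const_smul _).const_smul _)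
  · filter_upwards [hf] with n hn
    have hc : Continuous fun θ => f n (circleMap c R θ) :=
      hn.continuousOn.comp_continuous (continuous_circleMap c R) hmem
    have hc2 : Continuous fun θ => (1 / (circleMap c R θ - c) ^ 2) := by
      refine continuous_const.div (by fun_prop) fun θ => ?_
      simp [circleMap, hR.ne']
    simp only [deriv_circleMap]
    exact (((continuous_circleMap 0 R).mul continuous_const).smul (hc2.smul hc)).aestronglyMeasurable
  · filter_upwards [hM] with n hn
    refine Eventually.of_forall fun θ _ => ?_
    simp only [deriv_circleMap, norm_smul, norm_mul, norm_div, norm_pow, norm_one, Complex.norm_I,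
      mul_one, circleMap_sub_center, norm_circleMap_zero, abs_of_pos hR]
    gcongr
    exact hn _ (hmem θ)

lemma norm_GammaSeq_le {s : ℂ} (hs : 0 < s.re) {n : ℕ} (hn : n ≠ 0) :
    ‖Complex.GammaSeq s n‖ ≤ Real.Gamma s.re := by
  rw [Complex.GammaSeq_eq_approx_Gamma_integral hs hn,
    intervalIntegral.integral_of_le (Nat.cast_nonneg n), Real.Gamma_eq_integral hs]
  have hi := Real.GammaIntegral_convergent hs
  refine (MeasureTheory.norm_integral_le_of_norm_le
    (hi.mono_set Set.Ioc_subset_Ioi_self) ?_).trans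
    (MeasureTheory.setIntegral_mono_set hi ?_ (Set.Ioc_subset_Ioi_self.eventuallyLE))
  · refine (MeasureTheory.ae_restrict_iff' measurableSet_Ioc).2 (Eventually.of_forall fun x hx => ?_)
    have hn' : (0 : ℝ) < n := by positivity
    rw [norm_mul, Complex.norm_real, Complex.norm_cpow_eq_rpow_re_of_pos hx.1, Complex.sub_re,
      Complex.one_re, Real.norm_of_nonneg]
    · refine mul_le_mul_of_nonneg_right ?_ (Real.rpow_nonneg hx.1.le _)
      exact Real.one_sub_div_pow_le_exp_neg hx.2
    · refine pow_nonneg ?_ _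
      rw [sub_nonneg, div_le_one hn']
      exact hx.2
  · refine (MeasureTheory.ae_restrict_iff' measurableSet_Ioi).2 (Eventually.of_forall fun x hx => ?_)
    have : (0 : ℝ) < x := hx
    simp only [Pi.zero_apply]
    positivity

lemma add_natCast_ne_zero {s : ℂ} (hs : 0 < s.re) (k : ℕ) : s + k ≠ 0 := fun h => by
  have := congrArg Complex.re h
  simp at this
  linarith [(Nat.cast_nonneg k : (0 : ℝ) ≤ k)]

lemma hasDerivAt_GammaSeq {s : ℂ} (hs : 0 < s.re) {n : ℕ} (hn : n ≠ 0) :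
    HasDerivAt (fun s => Complex.GammaSeq s n)
      (Complex.GammaSeq s n * (Complex.log n - ∑ k ∈ Finset.range (n + 1), 1 / (s + k))) s := by
  have hn' : (n : ℂ) ≠ 0 := Nat.cast_ne_zero.2 hn
  have h1 : HasDerivAt (fun s : ℂ => (n : ℂ) ^ s * (n.factorial : ℂ))
      ((n : ℂ) ^ s * Complex.log n * (n.factorial : ℂ)) s := by
    have := ((hasDerivAt_id s).const_cpow (c := (n : ℂ)) (Or.inl hn')).mul_const (n.factorial : ℂ)
    simpa using this
  have h2 : HasDerivAt (fun s : ℂ => ∏ k ∈ Finset.range (n + 1), (s + k))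
      ((∏ k ∈ Finset.range (n + 1), (s + k)) * ∑ k ∈ Finset.range (n + 1), 1 / (s + k)) s := by
    have := HasDerivAt.fun_finsetProd (u := Finset.range (n + 1)) (f := fun k (s : ℂ) => s + (k : ℂ))
      (f' := fun _ => 1) (x := s) fun k _ => (hasDerivAt_id s).add_const _
    refine this.congr_deriv ?_
    rw [Finset.mul_sum]
    refine Finset.sum_congr rfl fun k hk => ?_
    rw [← Finset.mul_prod_erase _ _ hk, smul_eq_mul, mul_one, mul_one_div,
      mul_div_cancel_left₀ _ (add_natCast_ne_zero hs k)]
  have hprod : ∏ k ∈ Finset.range (n + 1), (s + k) ≠ 0 :=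
    Finset.prod_ne_zero_iff.2 fun k _ => add_natCast_ne_zero hs k
  refine (h1.div h2 hprod).congr_deriv ?_
  rw [Complex.GammaSeq]
  field_simp

/-- Euler's limit for the digamma function, by logarithmic differentiation of Euler's limit for the
Gamma function. -/
lemma tendsto_digamma {s : ℂ} (hs : 0 < s.re) :
    Tendsto (fun n : ℕ => Complex.log n - ∑ k ∈ Finset.range (n + 1), 1 / (s + k)) atTop
      (𝓝 (Complex.digamma s)) := by
  have hball : ∀ z ∈ Metric.closedBall s (s.re / 2), 0 < z.re := fun z hz => by
    have h1 := (Complex.abs_re_le_norm (z - s)).trans (mem_closedBall_iff_norm.1 hz)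
    rw [Complex.sub_re, abs_le] at h1
    linarith [h1.1]
  have hΓd : ∀ z : ℂ, 0 < z.re → DifferentiableAt ℂ Complex.Gamma z := fun z hz =>
    Complex.differentiableAt_Gamma z fun m h => by
      have := congrArg Complex.re h
      simp at this
      linarith [(Nat.cast_nonneg m : (0 : ℝ) ≤ m)]
  obtain ⟨M, hM⟩ : ∃ M, ∀ z ∈ Metric.closedBall s (s.re / 2), Real.Gamma z.re ≤ M := by
    have hc : ContinuousOn (fun z : ℂ => Real.Gamma z.re) (Metric.closedBall s (s.re / 2)) := by
      intro z hz
      have h1 : ContinuousAt Real.Gamma z.re :=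
        (Real.differentiableAt_Gamma fun m => by
          have := hball z hz
          have h2 := (Nat.cast_nonneg m : (0 : ℝ) ≤ m)
          intro h; linarith).continuousAt
      exact (h1.comp (f := Complex.re) Complex.continuous_re.continuousAt).continuousWithinAt
    obtain ⟨M, hM⟩ := ((isCompact_closedBall s (s.re / 2)).image_of_continuousOn hc).bddAbove
    exact ⟨M, fun z hz => hM ⟨z, hz, rfl⟩⟩
  have h1 : Tendsto (fun n => deriv (fun z => Complex.GammaSeq z n) s) atTop
      (𝓝 (deriv Complex.Gamma s)) := by
    refine tendsto_deriv_of_bounded (M := M) (half_pos hs) ?_ ?_ ?_ ?_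
    · filter_upwards [eventually_ne_atTop 0] with n hn z hz
      exact (hasDerivAt_GammaSeq (hball z hz) hn).differentiableAt.differentiableWithinAt
    · exact fun z hz => (hΓd z (hball z hz)).differentiableWithinAt
    · filter_upwards [eventually_ne_atTop 0] with n hn z hz
      exact (norm_GammaSeq_le (hball z hz) hn).trans (hM z hz)
    · exact fun z _ => Complex.GammaSeq_tendsto_Gamma z
  have hΓ : Complex.Gamma s ≠ 0 := Complex.Gamma_ne_zero_of_re_pos hs
  have h2 := h1.div (Complex.GammaSeq_tendsto_Gamma s) hΓ
  rw [Complex.digamma_def, logDeriv_apply]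
  refine h2.congr' ?_
  filter_upwards [eventually_ne_atTop 0,
    (Complex.GammaSeq_tendsto_Gamma s).eventually_ne hΓ] with n hn hne
  rw [Pi.div_apply, (hasDerivAt_GammaSeq hs hn).deriv, mul_div_cancel_left₀ _ hne]

lemma differentiableAt_digamma {s : ℂ} (hs : 0 < s.re) : DifferentiableAt ℂ Complex.digamma s := by
  have hopen : IsOpen {z : ℂ | 0 < z.re} := isOpen_lt continuous_const Complex.continuous_re
  have hΓ : DifferentiableOn ℂ Complex.Gamma {z : ℂ | 0 < z.re} := fun z hz =>
    (Complex.differentiableAt_Gamma z fun m h => by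
      have h2 := congrArg Complex.re h
      simp at h2
      have h3 : 0 < z.re := hz
      linarith [(Nat.cast_nonneg m : (0 : ℝ) ≤ m)]).differentiableWithinAt
  have h1 := ((hΓ.deriv hopen).differentiableAt (hopen.mem_nhds hs))
  have h2 := hΓ.differentiableAt (hopen.mem_nhds hs)
  exact h1.div h2 (Complex.Gamma_ne_zero_of_re_pos hs)

lemma norm_log_add_one_sub_log_sub_le {w : ℂ} (hw : 0 < w.re) :
    ‖Complex.log (w + 1) - Complex.log w - 1 / w‖ ≤ 1 / ‖w‖ ^ 2 := by
  have hw0 : w ≠ 0 := fun h => by simp [h] at hw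
  have hre : ∀ x : ℝ, 0 ≤ x → 0 < (w + x).re := fun x hx => by simp; linarith
  have hne : ∀ x : ℝ, 0 ≤ x → w + x ≠ 0 := fun x hx h => by
    have := hre x hx
    rw [h] at this
    simp at this
  have hnorm : ∀ x : ℝ, 0 ≤ x → ‖w‖ ≤ ‖w + x‖ := fun x hx => by
    rw [← sq_le_sq₀ (norm_nonneg _) (norm_nonneg _), ← Complex.normSq_eq_norm_sq,
      ← Complex.normSq_eq_norm_sq, Complex.normSq_apply, Complex.normSq_apply]
    simp
    nlinarith
  have h := norm_image_sub_le_of_norm_deriv_le_segment_01'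
    (f := fun x : ℝ => Complex.log (w + x) - x / w) (f' := fun x : ℝ => 1 / (w + x) - 1 / w)
    (C := 1 / ‖w‖ ^ 2) (fun x hx => ?_) (fun x hx => ?_)
  · simp only [Complex.ofReal_one, Complex.ofReal_zero, zero_div, add_zero, sub_zero] at h
    rwa [sub_right_comm]
  · have h1 : HasDerivAt (fun x : ℝ => w + (x : ℂ)) 1 x := by
      simpa using (Complex.ofRealCLM.hasDerivAt (x := x)).const_add w
    have h2 := h1.clog_real (Or.inl (hre x hx.1))
    have h3 : HasDerivAt (fun x : ℝ => (x : ℂ) / w) (1 / w) x := by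
      simpa using (Complex.ofRealCLM.hasDerivAt (x := x)).div_const w
    exact (h2.sub h3).hasDerivWithinAt
  · have e : 1 / (w + x) - 1 / w = -x / (w * (w + x)) := by
      field_simp [hne x hx.1]
      ring
    rw [e, norm_div, norm_neg, norm_mul, Complex.norm_real, Real.norm_of_nonneg hx.1, sq]
    have := norm_pos_iff.2 hw0
    have h2 := hnorm x hx.1
    gcongr
    exact hx.2.le

/-- `ψ(z) = log z + O(|Im z|^{-1/2})` on vertical lines in the right half-plane. -/
lemma exists_norm_digamma_sub_log_le {β : ℝ} (hβ : 0 < β) :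
    ∃ C, 0 ≤ C ∧ ∀ τ : ℝ, τ ≠ 0 → ‖Complex.digamma (β + τ * Complex.I) -
      Complex.log (β + τ * Complex.I)‖ ≤ C * |τ| ^ (-(1 / 2) : ℝ) := by
  have hsum : Summable fun k : ℕ => (β + k) ^ (-(3 / 2) : ℝ) := by
    have h1 : Summable fun k : ℕ => 1 / |(k : ℝ) + β| ^ (3 / 2 : ℝ) :=
      (Real.summable_one_div_nat_add_rpow β (3 / 2)).2 (by norm_num)
    refine h1.congr fun k => ?_
    have : 0 < (k : ℝ) + β := by positivity
    rw [abs_of_pos this, Real.rpow_neg (by positivity), one_div, add_comm]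
  refine ⟨∑' k : ℕ, (β + k) ^ (-(3 / 2) : ℝ), tsum_nonneg fun k => by positivity, fun τ hτ => ?_⟩
  set z : ℂ := β + τ * Complex.I with hz
  have hzre : 0 < z.re := by simp [hz, hβ]
  have hτ' : 0 < |τ| := abs_pos.2 hτ
  have hterm : ∀ k : ℕ, ‖Complex.log (z + k + 1) - Complex.log (z + k) - 1 / (z + k)‖ ≤
      (β + k) ^ (-(3 / 2) : ℝ) * |τ| ^ (-(1 / 2) : ℝ) := by
    intro k
    have hk : 0 < (z + k).re := by simp; positivity
    have hβk : 0 < β + k := by positivity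
    refine (norm_log_add_one_sub_log_sub_le hk).trans ?_
    have h1 : (z + k).re = β + k := by simp [hz]
    have h2 : (z + k).im = τ := by simp [hz]
    have h3 : β + k ≤ ‖z + k‖ := by
      rw [← h1]; exact Complex.re_le_norm _
    have h4 : |τ| ≤ ‖z + k‖ := by
      rw [← h2]; exact Complex.abs_im_le_norm _
    have h5 : 0 < ‖z + k‖ := hβk.trans_le h3
    have h6 : 1 / ‖z + k‖ ^ 2 = ‖z + k‖ ^ (-(3 / 2) : ℝ) * ‖z + k‖ ^ (-(1 / 2) : ℝ) := by
      rw [← Real.rpow_add h5, one_div, ← Real.rpow_natCast, ← Real.rpow_neg h5.le]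
      norm_num
    rw [h6]
    have h7 : ‖z + k‖ ^ (-(3 / 2) : ℝ) ≤ (β + k) ^ (-(3 / 2) : ℝ) :=
      Real.rpow_le_rpow_of_nonpos hβk h3 (by norm_num)
    have h8 : ‖z + k‖ ^ (-(1 / 2) : ℝ) ≤ |τ| ^ (-(1 / 2) : ℝ) :=
      Real.rpow_le_rpow_of_nonpos hτ' h4 (by norm_num)
    gcongr
  have htel : ∀ n : ℕ, n ≠ 0 → Complex.log n - ∑ k ∈ Finset.range (n + 1), 1 / (z + k) -
      Complex.log z + Complex.log ((z + n + 1) / n) = ∑ k ∈ Finset.range (n + 1),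
        (Complex.log (z + k + 1) - Complex.log (z + k) - 1 / (z + k)) := by
    intro n hn
    have hn' : (0 : ℝ) < n := by positivity
    have h1 := Finset.sum_range_sub (fun k : ℕ => Complex.log (z + k)) (n + 1)
    simp only [Nat.cast_add, Nat.cast_one, Nat.cast_zero, add_zero, ← add_assoc] at h1
    rw [Finset.sum_sub_distrib, h1]
    have hne : z + n + 1 ≠ 0 := by
      have := add_natCast_ne_zero hzre (n + 1)
      push_cast at this
      rwa [← add_assoc] at this
    have h2 : Complex.log (z + n + 1) = Real.log n + Complex.log ((z + n + 1) / n) := by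
      have hq : (z + n + 1) / n ≠ 0 := div_ne_zero hne (by exact_mod_cast hn)
      have := Complex.log_ofReal_mul hn' hq
      rw [← this]
      congr 1
      have : (n : ℂ) ≠ 0 := by exact_mod_cast hn
      push_cast
      field_simp
    rw [h2, ← Complex.natCast_log]
    ring
  have hlim0 : Tendsto (fun n : ℕ => Complex.log ((z + n + 1) / n)) atTop (𝓝 0) := by
    have h1 : Tendsto (fun n : ℕ => (z + n + 1) / (n : ℂ)) atTop (𝓝 1) := by
      have h2 : Tendsto (fun n : ℕ => (z + 1) * (n : ℂ)⁻¹ + 1) atTop (𝓝 ((z + 1) * 0 + 1)) :=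
        ((tendsto_inv_atTop_nhds_zero_nat (𝕜 := ℂ)).const_mul _).add_const _
      rw [mul_zero, zero_add] at h2
      refine h2.congr' ?_
      filter_upwards [eventually_ne_atTop 0] with n hn
      have : (n : ℂ) ≠ 0 := by exact_mod_cast hn
      field_simp
      ring
    have h2 := ((continuousAt_clog (by simp : (1 : ℂ) ∈ Complex.slitPlane)).tendsto).comp h1
    rwa [Complex.log_one] at h2
  have hlim := ((tendsto_digamma hzre).sub_const (Complex.log z)).add hlim0
  rw [add_zero] at hlim
  refine le_of_tendsto hlim.norm ?_
  filter_upwards [eventually_ne_atTop 0] with n hn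
  rw [htel n hn]
  refine (norm_sum_le_of_le _ fun k _ => hterm k).trans ?_
  rw [← Finset.sum_mul]
  gcongr
  exact hsum.sum_le_tsum _ fun k _ => by positivity

/-- The integral of `Re ψ` on a vertical line against a Fourier transform converges as a symmetric
limit. The weight is `½ log (4β² + t²)` up to a constant and an error `O(|t|^{-1/2})`. -/
lemma exists_tendsto_integral_digamma_mul {S : Finset ℝ} {ε C : ℝ} {g : ℝ → ℂ}
    (h : DecayingPiecewiseC1 S ε C g) {β : ℝ} (hβ : 0 < β) :
    ∃ L : ℂ, Tendsto (fun T : ℝ => ∫ t in -T..T,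
      ((Complex.digamma (β + (t / 2 : ℝ) * Complex.I)).re : ℂ) * fourierInt g t) atTop (𝓝 L) := by
  obtain ⟨D, hD0, hD⟩ := exists_norm_digamma_sub_log_le hβ
  have hre : ∀ t : ℝ, 0 < ((β : ℂ) + (t / 2 : ℝ) * Complex.I).re := fun t => by simp [hβ]
  have hline : Continuous fun t : ℝ => (β : ℂ) + (t / 2 : ℝ) * Complex.I := by fun_prop
  have hψc : Continuous fun t : ℝ => Complex.digamma (β + (t / 2 : ℝ) * Complex.I) :=
    continuous_iff_continuousAt.2 fun t =>
      (differentiableAt_digamma (hre t)).continuousAt.comp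
        (f := fun t : ℝ => (β : ℂ) + (t / 2 : ℝ) * Complex.I) hline.continuousAt
  have hlogc : Continuous fun t : ℝ => Complex.log (β + (t / 2 : ℝ) * Complex.I) :=
    hline.clog fun t => Or.inl (hre t)
  set e : ℝ → ℂ := fun t => (((Complex.digamma (β + (t / 2 : ℝ) * Complex.I)).re -
    (Complex.log (β + (t / 2 : ℝ) * Complex.I)).re : ℝ) : ℂ) with he
  have hec : Continuous e := by
    refine Complex.continuous_ofReal.comp ?_
    exact (Complex.continuous_re.comp hψc).sub (Complex.continuous_re.comp hlogc)
  have hgc := continuous_fourierInt h.integrable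
  have hlog : ∀ t : ℝ, (Complex.log (β + (t / 2 : ℝ) * Complex.I)).re =
      1 / 2 * Real.log (4 * β ^ 2 + t ^ 2) - 1 / 2 * Real.log 4 := by
    intro t
    have h1 : ‖(β : ℂ) + (t / 2 : ℝ) * Complex.I‖ = Real.sqrt ((4 * β ^ 2 + t ^ 2) / 4) := by
      rw [Complex.norm_add_mul_I]
      congr 1; ring
    rw [Complex.log_re, h1, Real.log_sqrt (by positivity),
      Real.log_div (by positivity) (by norm_num)]
    ring
  have hint : MeasureTheory.Integrable fun t => e t * fourierInt g t := by
    have h0 : MeasureTheory.Integrable fun t : ℝ => (1 + ‖t‖) ^ (-(3 / 2) : ℝ) :=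
      integrable_one_add_norm (by simp; norm_num)
    refine (hec.mul hgc).locallyIntegrable.integrable_of_isBigO_cocompact ?_
      (h0.integrableAtFilter (cocompact ℝ))
    set B := C * (∫ x, Real.exp (-ε * |x|)) + S.card * (2 * C) with hB
    refine IsBigO.of_bound (D * 2 ^ (1 / 2 : ℝ) * B * 2 ^ (3 / 2 : ℝ)) ?_
    have hev : ∀ᶠ t : ℝ in cocompact ℝ, 1 ≤ ‖t‖ :=
      (tendsto_norm_cocompact_atTop (E := ℝ)).eventually_ge_atTop 1
    filter_upwards [hev] with t ht
    rw [Real.norm_eq_abs] at ht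
    have ht0 : 0 < |t| := by linarith
    have htne : t ≠ 0 := abs_pos.1 ht0
    have h1 : ‖e t‖ ≤ D * 2 ^ (1 / 2 : ℝ) * |t| ^ (-(1 / 2) : ℝ) := by
      have h2 := hD (t / 2) (by positivity)
      rw [he, Complex.norm_real, Real.norm_eq_abs, ← Complex.sub_re]
      refine (Complex.abs_re_le_norm _).trans (h2.trans (le_of_eq ?_))
      rw [abs_div, abs_two, Real.div_rpow ht0.le zero_le_two, Real.rpow_neg zero_le_two]
      field_simp
    have h3 : ‖fourierInt g t‖ ≤ B * |t| ^ (-1 : ℝ) := by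
      rw [Real.rpow_neg_one, ← div_eq_mul_inv, le_div_iff₀ ht0]
      exact h.norm_fourierInt_mul_le t
    have h4 : |t| ^ (-(3 / 2) : ℝ) ≤ 2 ^ (3 / 2 : ℝ) * (1 + |t|) ^ (-(3 / 2) : ℝ) := by
      have h5 : ((1 + |t|) / 2) ^ (-(3 / 2) : ℝ) = 2 ^ (3 / 2 : ℝ) * (1 + |t|) ^ (-(3 / 2) : ℝ) := by
        rw [Real.div_rpow (by positivity) zero_le_two, Real.rpow_neg zero_le_two]
        field_simp
      rw [← h5]
      exact Real.rpow_le_rpow_of_nonpos (by positivity) (by linarith) (by norm_num)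
    have hB0 : 0 ≤ B := (mul_nonneg (norm_nonneg _) (abs_nonneg _)).trans
      (h.norm_fourierInt_mul_le t)
    rw [Pi.mul_apply, norm_mul]
    calc _ ≤ (D * 2 ^ (1 / 2 : ℝ) * |t| ^ (-(1 / 2) : ℝ)) * (B * |t| ^ (-1 : ℝ)) := by gcongr
      _ = D * 2 ^ (1 / 2 : ℝ) * B * (|t| ^ (-(1 / 2) : ℝ) * |t| ^ (-1 : ℝ)) := by ring
      _ = D * 2 ^ (1 / 2 : ℝ) * B * |t| ^ (-(3 / 2) : ℝ) := by
          rw [← Real.rpow_add ht0]; norm_num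
      _ ≤ D * 2 ^ (1 / 2 : ℝ) * B * (2 ^ (3 / 2 : ℝ) * (1 + |t|) ^ (-(3 / 2) : ℝ)) := by gcongr
      _ = _ := by
          rw [Real.norm_of_nonneg (by positivity), Real.norm_eq_abs]; ring
  obtain ⟨L, hL⟩ := h.exists_tendsto_integral_log_mul (c := 4 * β ^ 2) (by positivity)
  have hF := h.tendsto_integral_fourierInt 0
  simp only [Complex.ofReal_zero, mul_zero, zero_mul, neg_zero, Complex.exp_zero, mul_one] at hF
  have hE := MeasureTheory.intervalIntegral_tendsto_integral hint tendsto_neg_atTop_atBot tendsto_id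
  refine ⟨_, (((hL.const_mul (1 / 2 : ℂ)).sub (hF.const_mul (1 / 2 * (Real.log 4 : ℂ)))).add hE).congr
    fun T => ?_⟩
  have hwc : Continuous fun t : ℝ => (Real.log (4 * β ^ 2 + t ^ 2) : ℂ) :=
    continuous_iff_continuousAt.2 fun t =>
      ((hasDerivAt_log_add_sq (by positivity) t).ofReal_comp).continuousAt
  have c1 : Continuous fun t : ℝ =>
      1 / 2 * ((Real.log (4 * β ^ 2 + t ^ 2) : ℂ) * fourierInt g t) :=
    continuous_const.mul (hwc.mul hgc)
  have c2 : Continuous fun t : ℝ => 1 / 2 * (Real.log 4 : ℂ) * fourierInt g t :=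
    continuous_const.mul hgc
  have c12 : Continuous fun t : ℝ => 1 / 2 * ((Real.log (4 * β ^ 2 + t ^ 2) : ℂ) * fourierInt g t) -
      1 / 2 * (Real.log 4 : ℂ) * fourierInt g t := c1.sub c2
  have c3 : Continuous fun t : ℝ => e t * fourierInt g t := hec.mul hgc
  simp only [id]
  rw [← intervalIntegral.integral_const_mul, ← intervalIntegral.integral_const_mul,
    ← intervalIntegral.integral_sub (c1.intervalIntegrable _ _) (c2.intervalIntegrable _ _),
    ← intervalIntegral.integral_add (c12.intervalIntegrable _ _)
      (c3.intervalIntegrable _ _)]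
  refine intervalIntegral.integral_congr fun t _ => ?_
  simp only [he, hlog]
  push_cast
  ring

/-! ### Factoring out the zeros of a holomorphic function -/

lemma exists_factor_at {U : Set ℂ} (hU : IsOpen U) {f : ℂ → ℂ} (hf : DifferentiableOn ℂ f U) {ρ : ℂ}
    (hρ : ρ ∈ U) (ho : analyticOrderAt f ρ ≠ ⊤) :
    ∃ g : ℂ → ℂ, DifferentiableOn ℂ g U ∧ g ρ ≠ 0 ∧
      ∀ z ∈ U, f z = (z - ρ) ^ analyticOrderNatAt f ρ * g z := by
  have hfa : AnalyticAt ℂ f ρ := hf.analyticAt (hU.mem_nhds hρ)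
  obtain ⟨g₀, hg₀, hne, heq⟩ := hfa.analyticOrderAt_ne_top.1 ho
  set m := analyticOrderNatAt f ρ with hm
  set g : ℂ → ℂ := fun z => if z = ρ then g₀ ρ else f z / (z - ρ) ^ m with hg
  have hgg : g =ᶠ[𝓝 ρ] g₀ := by
    filter_upwards [heq] with z hz
    by_cases h : z = ρ
    · simp [hg, h]
    · simp only [hg, h, if_false]
      rw [hz, smul_eq_mul, mul_div_cancel_left₀]
      exact pow_ne_zero _ (sub_ne_zero.2 h)
  refine ⟨g, fun z hz => ?_, by simpa [hg] using hne, fun z hz => ?_⟩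
  · by_cases h : z = ρ
    · subst h
      exact (hgg.differentiableAt_iff.2 hg₀.differentiableAt).differentiableWithinAt
    · have h1 : DifferentiableAt ℂ (fun z => f z / (z - ρ) ^ m) z :=
        (hf.differentiableAt (hU.mem_nhds hz)).div (by fun_prop) (pow_ne_zero _ (sub_ne_zero.2 h))
      refine (h1.congr_of_eventuallyEq ?_).differentiableWithinAt
      filter_upwards [isOpen_ne.mem_nhds h] with w hw
      simp only [hg, show w ≠ ρ from hw, if_false]
  · by_cases h : z = ρ
    · subst h
      rw [heq.self_of_nhds, hgg.self_of_nhds]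
      rfl
    · simp only [hg, h, if_false]
      rw [mul_div_cancel₀]
      exact pow_ne_zero _ (sub_ne_zero.2 h)

/-- A holomorphic function with its zeros at a finite set of points divided out. -/
lemma exists_factorization {U : Set ℂ} (hU : IsOpen U) {f : ℂ → ℂ} (hf : DifferentiableOn ℂ f U)
    (Z : Finset ℂ) (hZ : ∀ ρ ∈ Z, ρ ∈ U) (ho : ∀ ρ ∈ Z, analyticOrderAt f ρ ≠ ⊤) :
    ∃ g : ℂ → ℂ, DifferentiableOn ℂ g U ∧ (∀ ρ ∈ Z, g ρ ≠ 0) ∧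
      ∀ z ∈ U, f z = (∏ ρ ∈ Z, (z - ρ) ^ analyticOrderNatAt f ρ) * g z := by
  classical
  induction Z using Finset.induction_on with
  | empty => exact ⟨f, hf, by simp, by simp⟩
  | insert ρ Z hρZ ih =>
    obtain ⟨g, hg, hgne, hfg⟩ := ih (fun z hz => hZ z (Finset.mem_insert_of_mem hz))
      (fun z hz => ho z (Finset.mem_insert_of_mem hz))
    have hρU := hZ ρ (Finset.mem_insert_self _ _)
    have hρo := ho ρ (Finset.mem_insert_self _ _)
    have hP : AnalyticAt ℂ (fun z => ∏ σ ∈ Z, (z - σ) ^ analyticOrderNatAt f σ) ρ :=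
      Finset.analyticAt_fun_prod _ fun σ _ => by fun_prop
    have hPne : ∏ σ ∈ Z, (ρ - σ) ^ analyticOrderNatAt f σ ≠ 0 :=
      Finset.prod_ne_zero_iff.2 fun σ hσ => pow_ne_zero _ (sub_ne_zero.2
        (by rintro rfl; exact hρZ hσ))
    have hord : analyticOrderAt f ρ = analyticOrderAt g ρ := by
      have h1 : f =ᶠ[𝓝 ρ] (fun z => ∏ σ ∈ Z, (z - σ) ^ analyticOrderNatAt f σ) * g := by
        filter_upwards [hU.mem_nhds hρU] with z hz using hfg z hz
      rw [analyticOrderAt_congr h1, analyticOrderAt_mul hP (hg.analyticAt (hU.mem_nhds hρU)),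
        hP.analyticOrderAt_eq_zero.2 hPne, zero_add]
    obtain ⟨k, hk, hkne, hgk⟩ := exists_factor_at hU hg hρU (by rwa [← hord])
    rw [analyticOrderNatAt, ← hord, ← analyticOrderNatAt] at hgk
    refine ⟨k, hk, fun σ hσ => ?_, fun z hz => ?_⟩
    · rcases Finset.mem_insert.1 hσ with rfl | hσ
      · exact hkne
      · intro h0
        have := hgk σ (hZ σ (Finset.mem_insert_of_mem hσ))
        rw [h0, mul_zero] at this
        exact hgne σ hσ this
    · rw [hfg z hz, hgk z hz, Finset.prod_insert hρZ]
      ring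

/-- The logarithmic derivative of a function whose zeros have been divided out. -/
lemma deriv_div_of_factorization {U : Set ℂ} (hU : IsOpen U) {f g : ℂ → ℂ}
    (hg : DifferentiableOn ℂ g U) {Z : Finset ℂ} {m : ℂ → ℕ}
    (hfg : ∀ z ∈ U, f z = (∏ ρ ∈ Z, (z - ρ) ^ m ρ) * g z) {z : ℂ} (hz : z ∈ U) (hzZ : z ∉ Z)
    (hgz : g z ≠ 0) :
    deriv f z / f z = ∑ ρ ∈ Z, (m ρ : ℂ) / (z - ρ) + deriv g z / g z := by
  have h1 : f =ᶠ[𝓝 z] fun z => (∏ ρ ∈ Z, (z - ρ) ^ m ρ) * g z := by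
    filter_upwards [hU.mem_nhds hz] with w hw using hfg w hw
  have hne : ∀ ρ ∈ Z, z - ρ ≠ 0 := fun ρ hρ => sub_ne_zero.2 (by rintro rfl; exact hzZ hρ)
  rw [← logDeriv_apply, ← logDeriv_apply, (logDeriv_congr_nhds h1).self_of_nhds, logDeriv_mul z
    (Finset.prod_ne_zero_iff.2 fun ρ hρ => pow_ne_zero _ (hne ρ hρ)) hgz (by fun_prop)
    (hg.differentiableAt (hU.mem_nhds hz))]
  congr 1
  rw [logDeriv_prod (f := fun (ρ w : ℂ) => (w - ρ) ^ m ρ) (fun ρ hρ => pow_ne_zero _ (hne ρ hρ)) (fun ρ _ => by fun_prop)]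
  refine Finset.sum_congr rfl fun ρ _ => ?_
  rw [logDeriv_fun_pow (by fun_prop)]
  simp [logDeriv_apply, div_eq_mul_inv]

/-- A holomorphic function that vanishes identically near no point of a compact set has finitely
many zeros there. -/
lemma finite_zeros_of_isCompact {f : ℂ → ℂ} {K : Set ℂ} (hK : IsCompact K)
    (ha : ∀ z ∈ K, AnalyticAt ℂ f z) (ho : ∀ z ∈ K, analyticOrderAt f z ≠ ⊤) :
    {z | z ∈ K ∧ f z = 0}.Finite := by
  by_contra h
  obtain ⟨z, hzK, hz⟩ := Set.Infinite.exists_accPt_of_subset_isCompact h hK fun z hz => hz.1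
  rcases (ha z hzK).eventually_eq_zero_or_eventually_ne_zero with h0 | h0
  · exact ho z hzK (analyticOrderAt_eq_top.2 h0)
  · rw [accPt_iff_frequently_nhdsNE] at hz
    obtain ⟨w, hw1, hw2⟩ := (hz.and_eventually h0).exists
    exact hw2 hw1.2

/-! ### Integrals over the boundary of a rectangle -/

/-- The integral of `f`, counterclockwise, over the boundary of `[a, b] × [c, d]`. -/
def rectIntegral (f : ℂ → ℂ) (a b c d : ℝ) : ℂ :=
  (∫ x : ℝ in a..b, f (x + c * Complex.I)) - (∫ x : ℝ in a..b, f (x + d * Complex.I)) +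
    Complex.I * (∫ y : ℝ in c..d, f (b + y * Complex.I)) -
    Complex.I * (∫ y : ℝ in c..d, f (a + y * Complex.I))

/-- The boundary of the rectangle `[a, b] × [c, d]`. -/
def rectBoundary (a b c d : ℝ) : Set ℂ :=
  {z | z.re ∈ Set.Icc a b ∧ (z.im = c ∨ z.im = d) ∨ z.im ∈ Set.Icc c d ∧ (z.re = b ∨ z.re = a)}

lemma rectBoundary_subset {a b c d : ℝ} (hab : a ≤ b) (hcd : c ≤ d) :
    rectBoundary a b c d ⊆ Set.Icc a b ×ℂ Set.Icc c d := by
  rintro z (⟨h1, h2 | h2⟩ | ⟨h1, h2 | h2⟩) <;> rw [Complex.mem_reProdIm]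
  all_goals first
    | exact ⟨h1, by linarith, by linarith⟩
    | exact ⟨⟨by linarith, by linarith⟩, h1⟩

section
variable {a b c d : ℝ}

lemma mem_rectBoundary_horizontal {x y : ℝ} (hx : x ∈ Set.Icc a b) (hy : y = c ∨ y = d) :
    (x + y * Complex.I : ℂ) ∈ rectBoundary a b c d :=
  Or.inl (by simpa using ⟨hx, hy⟩)

lemma mem_rectBoundary_vertical {x y : ℝ} (hy : y ∈ Set.Icc c d) (hx : x = b ∨ x = a) :
    (x + y * Complex.I : ℂ) ∈ rectBoundary a b c d :=
  Or.inr (by simpa using ⟨hy, hx⟩)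

lemma intervalIntegrable_horizontal {f : ℂ → ℂ} (hab : a ≤ b)
    (hf : ContinuousOn f (rectBoundary a b c d)) {y : ℝ} (hy : y = c ∨ y = d) :
    IntervalIntegrable (fun x : ℝ => f (x + y * Complex.I)) MeasureTheory.volume a b := by
  refine ContinuousOn.intervalIntegrable (hf.comp (by fun_prop) fun x hx => ?_)
  rw [Set.uIcc_of_le hab] at hx
  exact mem_rectBoundary_horizontal hx hy

lemma intervalIntegrable_vertical {f : ℂ → ℂ} (hcd : c ≤ d)
    (hf : ContinuousOn f (rectBoundary a b c d)) {x : ℝ} (hx : x = b ∨ x = a) :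
    IntervalIntegrable (fun y : ℝ => f (x + y * Complex.I)) MeasureTheory.volume c d := by
  refine ContinuousOn.intervalIntegrable (hf.comp (by fun_prop) fun y hy => ?_)
  rw [Set.uIcc_of_le hcd] at hy
  exact mem_rectBoundary_vertical hy hx

lemma rectIntegral_add (hab : a ≤ b) (hcd : c ≤ d) {f g : ℂ → ℂ}
    (hf : ContinuousOn f (rectBoundary a b c d)) (hg : ContinuousOn g (rectBoundary a b c d)) :
    rectIntegral (fun z => f z + g z) a b c d = rectIntegral f a b c d + rectIntegral g a b c d := by
  unfold rectIntegral
  rw [intervalIntegral.integral_add (intervalIntegrable_horizontal hab hf (Or.inl rfl))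
      (intervalIntegrable_horizontal hab hg (Or.inl rfl)),
    intervalIntegral.integral_add (intervalIntegrable_horizontal hab hf (Or.inr rfl))
      (intervalIntegrable_horizontal hab hg (Or.inr rfl)),
    intervalIntegral.integral_add (intervalIntegrable_vertical hcd hf (Or.inl rfl))
      (intervalIntegrable_vertical hcd hg (Or.inl rfl)),
    intervalIntegral.integral_add (intervalIntegrable_vertical hcd hf (Or.inr rfl))
      (intervalIntegrable_vertical hcd hg (Or.inr rfl))]
  ring

lemma rectIntegral_const_mul (k : ℂ) (f : ℂ → ℂ) :
    rectIntegral (fun z => k * f z) a b c d = k * rectIntegral f a b c d := by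
  unfold rectIntegral
  simp only [intervalIntegral.integral_const_mul]
  ring

lemma rectIntegral_sum (hab : a ≤ b) (hcd : c ≤ d) {ι : Type*} (Z : Finset ι) {f : ι → ℂ → ℂ}
    (hf : ∀ i ∈ Z, ContinuousOn (f i) (rectBoundary a b c d)) :
    rectIntegral (fun z => ∑ i ∈ Z, f i z) a b c d = ∑ i ∈ Z, rectIntegral (f i) a b c d := by
  classical
  induction Z using Finset.induction_on with
  | empty => simp [rectIntegral]
  | insert i Z hi ih =>
    simp only [Finset.sum_insert hi]
    rw [rectIntegral_add hab hcd (hf i (Finset.mem_insert_self _ _))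
      (continuousOn_finsetSum _ fun j hj => hf j (Finset.mem_insert_of_mem hj)),
      ih fun j hj => hf j (Finset.mem_insert_of_mem hj)]

lemma rectIntegral_congr (hab : a ≤ b) (hcd : c ≤ d) {f g : ℂ → ℂ}
    (h : Set.EqOn f g (rectBoundary a b c d)) :
    rectIntegral f a b c d = rectIntegral g a b c d := by
  have hh : ∀ y : ℝ, y = c ∨ y = d → ∫ x : ℝ in a..b, f (x + y * Complex.I) =
      ∫ x : ℝ in a..b, g (x + y * Complex.I) := fun y hy =>
    intervalIntegral.integral_congr fun x hx => by
      rw [Set.uIcc_of_le hab] at hx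
      exact h (mem_rectBoundary_horizontal hx hy)
  have hv : ∀ x : ℝ, x = b ∨ x = a → ∫ y : ℝ in c..d, f (x + y * Complex.I) =
      ∫ y : ℝ in c..d, g (x + y * Complex.I) := fun x hx =>
    intervalIntegral.integral_congr fun y hy => by
      rw [Set.uIcc_of_le hcd] at hy
      exact h (mem_rectBoundary_vertical hy hx)
  unfold rectIntegral
  rw [hh c (Or.inl rfl), hh d (Or.inr rfl), hv b (Or.inl rfl), hv a (Or.inr rfl)]

lemma rectIntegral_eq_zero (hab : a ≤ b) (hcd : c ≤ d) {f : ℂ → ℂ}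
    (hf : DifferentiableOn ℂ f (Set.Icc a b ×ℂ Set.Icc c d)) : rectIntegral f a b c d = 0 := by
  have := Complex.integral_boundary_rect_eq_zero_of_differentiableOn f (a + c * Complex.I)
    (b + d * Complex.I) (by simpa [Set.uIcc_of_le hab, Set.uIcc_of_le hcd] using hf)
  simpa [rectIntegral] using this

lemma integral_inv_horizontal {ρ : ℂ} {y : ℝ} (hy : y ≠ ρ.im) :
    ∫ x : ℝ in a..b, 1 / (x + y * Complex.I - ρ) =
      Complex.log (b + y * Complex.I - ρ) - Complex.log (a + y * Complex.I - ρ) := by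
  have him : ∀ x : ℝ, (x + y * Complex.I - ρ).im ≠ 0 := fun x => by simpa [sub_eq_zero] using hy
  have hne : ∀ x : ℝ, (x + y * Complex.I - ρ) ≠ 0 := fun x h => him x (by rw [h]; simp)
  refine intervalIntegral.integral_eq_sub_of_hasDerivAt
    (f := fun x : ℝ => Complex.log (x + y * Complex.I - ρ)) (fun x _ => ?_) ?_
  · have h1 : HasDerivAt (fun x : ℝ => (x + y * Complex.I - ρ : ℂ)) 1 x :=
      ((Complex.ofRealCLM.hasDerivAt (x := x)).add_const _).sub_const _
    exact h1.clog_real (Or.inr (him x))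
  · exact (ContinuousOn.div continuousOn_const (by fun_prop) fun x _ => hne x).intervalIntegrable

lemma integral_inv_right {ρ : ℂ} {x : ℝ} (hx : ρ.re < x) :
    Complex.I * ∫ y : ℝ in c..d, 1 / (x + y * Complex.I - ρ) =
      Complex.log (x + d * Complex.I - ρ) - Complex.log (x + c * Complex.I - ρ) := by
  have hre : ∀ y : ℝ, 0 < (x + y * Complex.I - ρ).re := fun x => by simpa using hx
  have hne : ∀ y : ℝ, (x + y * Complex.I - ρ) ≠ 0 := fun x h => (hre x).ne' (by rw [h]; simp)
  rw [← intervalIntegral.integral_const_mul]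
  refine intervalIntegral.integral_eq_sub_of_hasDerivAt
    (f := fun y : ℝ => Complex.log (x + y * Complex.I - ρ)) (fun y _ => ?_) ?_
  · have h1 : HasDerivAt (fun y : ℝ => (x + y * Complex.I - ρ : ℂ)) Complex.I y := by
      simpa using (((Complex.ofRealCLM.hasDerivAt (x := y)).mul_const Complex.I).const_add
        (x : ℂ)).sub_const ρ
    have h2 := h1.clog_real (Or.inl (hre y))
    rwa [← mul_one_div] at h2
  · exact (continuousOn_const.mul (ContinuousOn.div continuousOn_const (by fun_prop)
      fun y _ => hne y)).intervalIntegrable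

lemma integral_inv_left {ρ : ℂ} {x : ℝ} (hx : x < ρ.re) :
    Complex.I * ∫ y : ℝ in c..d, 1 / (x + y * Complex.I - ρ) =
      Complex.log (-(x + d * Complex.I - ρ)) - Complex.log (-(x + c * Complex.I - ρ)) := by
  have hre : ∀ y : ℝ, 0 < (-(x + y * Complex.I - ρ)).re := fun x => by simpa using hx
  have hne : ∀ y : ℝ, (x + y * Complex.I - ρ) ≠ 0 := fun x h => (hre x).ne' (by rw [h]; simp)
  rw [← intervalIntegral.integral_const_mul]
  refine intervalIntegral.integral_eq_sub_of_hasDerivAt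
    (f := fun y : ℝ => Complex.log (-(x + y * Complex.I - ρ))) (fun y _ => ?_) ?_
  · have h1 : HasDerivAt (fun y : ℝ => (-(x + y * Complex.I - ρ) : ℂ)) (-Complex.I) y := by
      have h0 := ((((Complex.ofRealCLM.hasDerivAt (x := y)).mul_const Complex.I).const_add
        (x : ℂ)).sub_const ρ).fun_neg
      simpa only [Complex.ofRealCLM_apply, Complex.ofReal_one, one_mul] using h0
    have h2 := h1.clog_real (Or.inl (hre y))
    rwa [neg_div_neg_eq, ← mul_one_div] at h2
  · exact (continuousOn_const.mul (ContinuousOn.div continuousOn_const (by fun_prop)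
      fun y _ => hne y)).intervalIntegrable

lemma clog_neg_sub_of_im_pos {z : ℂ} (h : 0 < z.im) :
    Complex.log (-z) = Complex.log z - Real.pi * Complex.I := by
  rw [Complex.log, Complex.log, norm_neg, Complex.arg_neg_eq_arg_sub_pi_of_im_pos h]
  push_cast; ring

lemma clog_neg_add_of_im_neg {z : ℂ} (h : z.im < 0) :
    Complex.log (-z) = Complex.log z + Real.pi * Complex.I := by
  rw [Complex.log, Complex.log, norm_neg, Complex.arg_neg_eq_arg_add_pi_of_im_neg h]
  push_cast; ring

lemma rectIntegral_inv {ρ : ℂ} (h1 : a < ρ.re) (h2 : ρ.re < b) (h3 : c < ρ.im) (h4 : ρ.im < d) :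
    rectIntegral (fun z => 1 / (z - ρ)) a b c d = 2 * Real.pi * Complex.I := by
  unfold rectIntegral
  rw [integral_inv_horizontal h3.ne, integral_inv_horizontal h4.ne', integral_inv_right h2,
    integral_inv_left h1, clog_neg_sub_of_im_pos (by simpa using h4),
    clog_neg_add_of_im_neg (by simpa using h3)]
  ring

/-- Cauchy's integral formula on a rectangle. -/
lemma rectIntegral_div_sub {U : Set ℂ} (hU : IsOpen U) (hR : Set.Icc a b ×ℂ Set.Icc c d ⊆ U)
    {F : ℂ → ℂ} (hF : DifferentiableOn ℂ F U) {ρ : ℂ}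
    (h1 : a < ρ.re) (h2 : ρ.re < b) (h3 : c < ρ.im) (h4 : ρ.im < d) :
    rectIntegral (fun z => F z / (z - ρ)) a b c d = 2 * Real.pi * Complex.I * F ρ := by
  have hab := (h1.trans h2).le
  have hcd := (h3.trans h4).le
  have hρU : U ∈ 𝓝 ρ := hU.mem_nhds (hR (Complex.mem_reProdIm.2 ⟨⟨h1.le, h2.le⟩, h3.le, h4.le⟩))
  have hd : DifferentiableOn ℂ (dslope F ρ) U := (Complex.differentiableOn_dslope hρU).2 hF
  have hne : ∀ z ∈ rectBoundary a b c d, z ≠ ρ := by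
    rintro z (⟨-, h | h⟩ | ⟨-, h | h⟩) rfl <;> linarith
  have hsub := (rectBoundary_subset hab hcd).trans hR
  have hinv : ContinuousOn (fun z => 1 / (z - ρ)) (rectBoundary a b c d) :=
    ContinuousOn.div continuousOn_const (by fun_prop) fun z hz => sub_ne_zero.2 (hne z hz)
  rw [rectIntegral_congr hab hcd (g := fun z => dslope F ρ z + F ρ * (1 / (z - ρ))) fun z hz => by
      simp only [dslope_of_ne _ (hne z hz), slope_def_field]
      have := sub_ne_zero.2 (hne z hz)
      field_simp
      ring,
    rectIntegral_add hab hcd (hd.continuousOn.mono hsub) (hinv.const_mul _),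
    rectIntegral_const_mul, rectIntegral_inv h1 h2 h3 h4, rectIntegral_eq_zero hab hcd (hd.mono hR)]
  ring

/-- The weighted argument principle on a rectangle. -/
lemma rectIntegral_logDeriv_mul {U : Set ℂ} (hU : IsOpen U)
    (hab : a ≤ b) (hcd : c ≤ d) (hR : Set.Icc a b ×ℂ Set.Icc c d ⊆ U)
    {f F : ℂ → ℂ} (hf : DifferentiableOn ℂ f U) (hF : DifferentiableOn ℂ F U)
    (Z : Finset ℂ) (hZ : ∀ z ∈ Set.Icc a b ×ℂ Set.Icc c d, f z = 0 ↔ z ∈ Z)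
    (ho : ∀ ρ ∈ Z, analyticOrderAt f ρ ≠ ⊤)
    (hint : ∀ ρ ∈ Z, a < ρ.re ∧ ρ.re < b ∧ c < ρ.im ∧ ρ.im < d) :
    rectIntegral (fun z => deriv f z / f z * F z) a b c d =
      2 * Real.pi * Complex.I * ∑ ρ ∈ Z, (analyticOrderNatAt f ρ : ℂ) * F ρ := by
  have hZR : ∀ ρ ∈ Z, ρ ∈ Set.Icc a b ×ℂ Set.Icc c d := fun ρ hρ => by
    obtain ⟨h1, h2, h3, h4⟩ := hint ρ hρ
    exact Complex.mem_reProdIm.2 ⟨⟨h1.le, h2.le⟩, h3.le, h4.le⟩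
  obtain ⟨g, hg, hgne, hfg⟩ := exists_factorization hU hf Z (fun ρ hρ => hR (hZR ρ hρ)) ho
  have hg0 : ∀ z ∈ Set.Icc a b ×ℂ Set.Icc c d, g z ≠ 0 := fun z hz h => by
    by_cases hzZ : z ∈ Z
    · exact hgne z hzZ h
    · exact hzZ ((hZ z hz).1 (by rw [hfg z (hR hz), h, mul_zero]))
  have hsub := rectBoundary_subset hab hcd
  have hne : ∀ z ∈ rectBoundary a b c d, z ∉ Z := by
    rintro z hz hzZ
    obtain ⟨h1, h2, h3, h4⟩ := hint z hzZ
    rcases hz with (⟨-, h | h⟩ | ⟨-, h | h⟩) <;> linarith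
  have hq : DifferentiableOn ℂ (fun z => deriv g z / g z * F z) (Set.Icc a b ×ℂ Set.Icc c d) :=
    (((hg.deriv hU).mono hR).div (hg.mono hR) hg0).mul (hF.mono hR)
  have hp : ∀ ρ ∈ Z, ContinuousOn (fun z => (analyticOrderNatAt f ρ : ℂ) * (F z / (z - ρ)))
      (rectBoundary a b c d) := fun ρ hρ => continuousOn_const.mul
    ((hF.continuousOn.mono (hsub.trans hR)).div (by fun_prop) fun z hz =>
      sub_ne_zero.2 (by rintro rfl; exact hne _ hz hρ))
  rw [rectIntegral_congr hab hcd (g := fun z => (∑ ρ ∈ Z, (analyticOrderNatAt f ρ : ℂ) *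
      (F z / (z - ρ))) + deriv g z / g z * F z) fun z hz => by
      simp only
      rw [deriv_div_of_factorization hU hg hfg (hR (hsub hz)) (hne z hz) (hg0 z (hsub hz)),
        add_mul, Finset.sum_mul]
      congr 1
      exact Finset.sum_congr rfl fun ρ _ => by ring,
    rectIntegral_add hab hcd (continuousOn_finsetSum _ hp) (hq.continuousOn.mono hsub),
    rectIntegral_sum hab hcd Z hp, rectIntegral_eq_zero hab hcd hq, add_zero, Finset.mul_sum]
  refine Finset.sum_congr rfl fun ρ hρ => ?_
  obtain ⟨h1, h2, h3, h4⟩ := hint ρ hρ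
  rw [rectIntegral_const_mul, rectIntegral_div_sub hU hR hF h1 h2 h3 h4]
  ring

end

/-! ### Landau's bound for a logarithmic derivative -/

/-- A zero-free holomorphic function on a disc is the exponential of a holomorphic function. -/
lemma exists_hasDerivAt_log_on_ball {c : ℂ} {r : ℝ} (hr : 0 < r) {k : ℂ → ℂ}
    (hk : DifferentiableOn ℂ k (Metric.ball c r)) (hk0 : ∀ z ∈ Metric.ball c r, k z ≠ 0) :
    ∃ l : ℂ → ℂ, l c = 0 ∧ (∀ z ∈ Metric.ball c r, HasDerivAt l (deriv k z / k z) z) ∧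
      ∀ z ∈ Metric.ball c r, k z = k c * Complex.exp (l z) := by
  obtain ⟨l, hl⟩ := ((hk.deriv Metric.isOpen_ball).div hk hk0).isExactOn_ball
  have hc : c ∈ Metric.ball c r := Metric.mem_ball_self hr
  refine ⟨fun z => l z - l c, by simp, fun z hz => (hl z hz).sub_const _, fun z hz => ?_⟩
  have hd : ∀ z ∈ Metric.ball c r,
      HasDerivAt (fun z => k z * Complex.exp (-(l z - l c))) 0 z := fun z hz => by
    have h1 := (hk.differentiableAt (Metric.isOpen_ball.mem_nhds hz)).hasDerivAt
    have h2 := ((hl z hz).sub_const (l c)).fun_neg.cexp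
    refine (h1.mul h2).congr_deriv ?_
    have := hk0 z hz
    simp only [Pi.div_apply]
    field_simp
    ring
  have hconst := Metric.isOpen_ball.is_const_of_deriv_eq_zero (𝕜 := ℂ)
    (convex_ball c r).isPreconnected
    (fun z hz => (hd z hz).differentiableAt.differentiableWithinAt)
    (fun z hz => (hd z hz).deriv) hz hc
  simp only [sub_self, neg_zero, Complex.exp_zero, mul_one] at hconst
  rw [← hconst, mul_assoc, ← Complex.exp_add]
  simp

lemma norm_deriv_div_le_of_ne_zero {c : ℂ} {r r₁ B : ℝ} (hr₁ : 0 < r₁) (hr : r₁ < r) (hB : 1 < B)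
    {k : ℂ → ℂ} (hk : DifferentiableOn ℂ k (Metric.ball c r))
    (hk0 : ∀ z ∈ Metric.ball c r, k z ≠ 0) (hkB : ∀ z ∈ Metric.ball c r, ‖k z‖ ≤ B * ‖k c‖)
    {s : ℂ} (hs : ‖s - c‖ ≤ r₁) :
    ‖deriv k s / k s‖ ≤ 8 * r / (r - r₁) ^ 2 * Real.log B := by
  have hr0 : 0 < r := hr₁.trans hr
  obtain ⟨l, hlc, hl, hkl⟩ := exists_hasDerivAt_log_on_ball hr0 hk hk0
  have hM : 0 < Real.log B := Real.log_pos hB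
  have hc : c ∈ Metric.ball c r := Metric.mem_ball_self hr0
  have hre : ∀ z ∈ Metric.ball c r, (l z).re ≤ Real.log B := fun z hz => by
    have h1 := hkB z hz
    rw [hkl z hz, norm_mul, Complex.norm_exp, mul_comm] at h1
    have h2 := le_of_mul_le_mul_right h1 (norm_pos_iff.2 (hk0 c hc))
    rwa [Real.le_log_iff_exp_le (by linarith)]
  have hmem : ∀ w ∈ Metric.ball (0 : ℂ) r, c + w ∈ Metric.ball c r := fun w hw => by
    simpa using hw
  have hbc : ∀ w : ℂ, ‖w‖ < r → ‖l (c + w)‖ ≤ 2 * Real.log B * ‖w‖ / (r - ‖w‖) := fun w hw => by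
    refine Complex.borelCaratheodory_zero (f := fun w => l (c + w)) hM (fun w hw => ?_)
      (fun w hw => hre _ (hmem w hw)) hr0 (by simpa using hw) (by simpa using hlc)
    have h1 := (hl _ (hmem w hw)).differentiableAt
    exact (h1.comp (f := fun w => c + w) w (by fun_prop)).differentiableWithinAt
  set δ := (r - r₁) / 2 with hδ
  have hδ0 : 0 < δ := by rw [hδ]; linarith
  have hsub : Metric.closedBall s δ ⊆ Metric.ball c r := fun z hz => by
    rw [Metric.mem_closedBall, dist_eq_norm] at hz
    rw [Metric.mem_ball, dist_eq_norm]
    calc ‖z - c‖ = ‖(z - s) + (s - c)‖ := by ring_nf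
      _ ≤ δ + r₁ := (norm_add_le _ _).trans (add_le_add hz hs)
      _ < r := by rw [hδ]; linarith
  have hdiff : DifferentiableOn ℂ l (Metric.ball c r) := fun z hz =>
    (hl z hz).differentiableAt.differentiableWithinAt
  have hcauchy : ‖deriv l s‖ ≤ (2 * Real.log B * r / δ) / δ := by
    refine Complex.norm_deriv_le_of_forall_mem_sphere_norm_le hδ0
      (DifferentiableOn.diffContOnCl ?_) fun z hz => ?_
    · rw [closure_ball s hδ0.ne']
      exact hdiff.mono hsub
    · rw [mem_sphere_iff_norm] at hz
      have h1 : ‖z - c‖ ≤ r - δ := by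
        calc ‖z - c‖ = ‖(z - s) + (s - c)‖ := by ring_nf
          _ ≤ δ + r₁ := (norm_add_le _ _).trans (add_le_add hz.le hs)
          _ = r - δ := by rw [hδ]; ring
      have h2 := hbc (z - c) (by linarith)
      rw [add_sub_cancel] at h2
      refine h2.trans ?_
      gcongr <;> linarith
  have hsb : s ∈ Metric.ball c r := hsub (Metric.mem_closedBall_self hδ0.le)
  rw [← (hl s hsb).deriv]
  refine hcauchy.trans_eq ?_
  rw [hδ]
  have : r - r₁ ≠ 0 := by linarith
  field_simp
  ring

lemma norm_sq_sub_mul_conj {w v : ℂ} {R : ℝ} (hw : ‖w‖ = R) :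
    ‖(R : ℂ) ^ 2 - w * starRingEnd ℂ v‖ = R * ‖w - v‖ := by
  have h : (R : ℂ) ^ 2 = w * starRingEnd ℂ w := by
    rw [Complex.mul_conj, Complex.normSq_eq_norm_sq, hw]
    push_cast; rfl
  rw [h, ← mul_sub, ← map_sub, norm_mul, RCLike.norm_conj, hw]

lemma le_norm_sq_sub_mul_conj {w v : ℂ} {R r : ℝ} (hR : 0 < R) (hw : ‖w‖ ≤ R) (hv : ‖v‖ ≤ r) :
    R * (R - r) ≤ ‖(R : ℂ) ^ 2 - w * starRingEnd ℂ v‖ := by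
  have h1 := norm_sub_norm_le ((R : ℂ) ^ 2) (w * starRingEnd ℂ v)
  rw [norm_mul, RCLike.norm_conj, norm_pow, Complex.norm_real, Real.norm_eq_abs, abs_of_pos hR] at h1
  have : ‖w‖ * ‖v‖ ≤ R * r := mul_le_mul hw hv (norm_nonneg _) hR.le
  nlinarith

/-- The number of zeros in a disc, and the logarithmic derivative away from them, of a holomorphic
function whose size on a larger disc is controlled by its value at the centre. The zeros are
divided out by Blaschke factors, which have modulus one on the larger circle. -/
theorem landau_bound {r₁ r₂ R : ℝ} (h₁ : 0 < r₁) (h₂ : r₁ < r₂) (hR : r₂ < R) :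
    ∃ K : ℝ, 0 < K ∧ ∀ (f : ℂ → ℂ) (c : ℂ) (R' B : ℝ) (Z : Finset ℂ), R < R' → 1 < B →
      DifferentiableOn ℂ f (Metric.ball c R') → f c ≠ 0 →
      (∀ z, ‖z - c‖ ≤ R → ‖f z‖ ≤ B * ‖f c‖) →
      (∀ z, ‖z - c‖ ≤ r₂ → (f z = 0 ↔ z ∈ Z)) → (∀ z ∈ Z, ‖z - c‖ ≤ r₂) →
      (∀ ρ ∈ Z, analyticOrderAt f ρ ≠ ⊤) →
      (∑ ρ ∈ Z, (analyticOrderNatAt f ρ : ℝ)) ≤ K * Real.log B ∧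
      ∀ s, ‖s - c‖ ≤ r₁ → f s ≠ 0 →
        ‖deriv f s / f s‖ ≤
          K * Real.log B + ∑ ρ ∈ Z, (analyticOrderNatAt f ρ : ℝ) / ‖s - ρ‖ := by
  have hr₂ : 0 < r₂ := h₁.trans h₂
  have hR0 : 0 < R := hr₂.trans hR
  have hq : 0 < Real.log (R / r₂) := Real.log_pos ((one_lt_div hr₂).2 hR)
  set K₁ := 1 / Real.log (R / r₂) with hK₁
  have hK₁0 : 0 < K₁ := by positivity
  set K₂ := 8 * r₂ / (r₂ - r₁) ^ 2 with hK₂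
  have hK₂0 : 0 < K₂ := by
    have : 0 < r₂ - r₁ := by linarith
    positivity
  set K₃ := r₂ / (R * (R - r₂)) with hK₃
  have hK₃0 : 0 < K₃ := by
    have : 0 < R - r₂ := by linarith
    positivity
  refine ⟨K₁ + (K₂ + K₁ * K₃), by positivity, fun f c R' B Z hR' hB hf hfc hfB hZ hZr ho => ?_⟩
  have hlogB : 0 < Real.log B := Real.log_pos hB
  set m : ℂ → ℕ := fun ρ => analyticOrderNatAt f ρ with hm
  obtain ⟨g, hg, hgne, hfg⟩ := exists_factorization Metric.isOpen_ball hf Z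
    (fun ρ hρ => by
      rw [Metric.mem_ball, dist_eq_norm]
      linarith [hZr ρ hρ]) ho
  have hmem : ∀ z, ‖z - c‖ ≤ R → z ∈ Metric.ball c R' := fun z hz => by
    rw [Metric.mem_ball, dist_eq_norm]; linarith
  set P : ℂ → ℂ := fun z =>
    ∏ ρ ∈ Z, (((R : ℂ) ^ 2 - (z - c) * starRingEnd ℂ (ρ - c)) / R) ^ m ρ with hP
  set h : ℂ → ℂ := fun z => P z * g z with hh
  have hRne : (R : ℂ) ≠ 0 := by exact_mod_cast hR0.ne'
  have hPd : Differentiable ℂ P := by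
    rw [hP]
    fun_prop
  have hhd : DifferentiableOn ℂ h (Metric.ball c R') := hPd.differentiableOn.mul hg
  have hsphere : ∀ z, ‖z - c‖ = R → ‖h z‖ = ‖f z‖ := fun z hz => by
    rw [hfg z (hmem z hz.le), hh, hP]
    simp only [norm_mul, norm_prod, norm_pow, norm_div, Complex.norm_real, Real.norm_eq_abs,
      abs_of_pos hR0]
    congr 1
    refine Finset.prod_congr rfl fun ρ _ => ?_
    rw [norm_sq_sub_mul_conj hz, mul_div_cancel_left₀ _ hR0.ne', sub_sub_sub_cancel_right]
  have hhB : ∀ z, ‖z - c‖ ≤ R → ‖h z‖ ≤ B * ‖f c‖ := fun z hz => by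
    refine Complex.norm_le_of_forall_mem_frontier_norm_le (U := Metric.ball c R)
      Metric.isBounded_ball (DifferentiableOn.diffContOnCl ?_) (fun w hw => ?_) (z := z) ?_
    · rw [closure_ball c hR0.ne']
      exact hhd.mono fun w hw => hmem w (by simpa [dist_eq_norm] using hw)
    · rw [frontier_ball c hR0.ne', mem_sphere_iff_norm] at hw
      rw [hsphere w hw]
      exact hfB w hw.le
    · rw [closure_ball c hR0.ne']
      simpa [dist_eq_norm] using hz
  have hcZ : c ∉ Z := fun hc => hfc ((hZ c (by simp [hr₂.le])).2 hc)
  have hhc : (R / r₂) ^ (∑ ρ ∈ Z, m ρ) * ‖f c‖ ≤ ‖h c‖ := by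
    rw [hfg c (hmem c (by simp [hR0.le])), hh, hP]
    simp only [sub_self, zero_mul, sub_zero, norm_mul, norm_prod, norm_pow, norm_div,
      Complex.norm_real, Real.norm_eq_abs, abs_of_pos hR0]
    rw [← mul_assoc, ← Finset.prod_pow_eq_pow_sum, ← Finset.prod_mul_distrib]
    gcongr with ρ hρ
    rw [← mul_pow]
    gcongr
    rw [div_mul_eq_mul_div, div_le_iff₀ hr₂, sq, mul_div_assoc, div_self hR0.ne', mul_one]
    gcongr
    rw [norm_sub_rev]
    exact hZr ρ hρ
  have hfc0 : 0 < ‖f c‖ := norm_pos_iff.2 hfc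
  have hone : 1 ≤ R / r₂ := ((one_lt_div hr₂).2 hR).le
  have hN : (∑ ρ ∈ Z, (m ρ : ℝ)) ≤ K₁ * Real.log B := by
    have h1 : (R / r₂) ^ (∑ ρ ∈ Z, m ρ) ≤ B :=
      le_of_mul_le_mul_right (hhc.trans (hhB c (by simp [hR0.le]))) hfc0
    have h2 := Real.log_le_log (by positivity) h1
    rw [Real.log_pow] at h2
    push_cast at h2
    rw [hK₁, one_div_mul_eq_div, le_div_iff₀ hq]
    exact h2
  have hhc' : ‖f c‖ ≤ ‖h c‖ :=
    (le_mul_of_one_le_left hfc0.le (one_le_pow₀ hone)).trans hhc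
  have hmem₂ : Metric.ball c r₂ ⊆ Metric.ball c R' := Metric.ball_subset_ball (by linarith)
  have hfac : ∀ z, ‖z - c‖ ≤ R → ∀ ρ ∈ Z, (R : ℂ) ^ 2 - (z - c) * starRingEnd ℂ (ρ - c) ≠ 0 :=
    fun z hz ρ hρ h0 => by
      have := le_norm_sq_sub_mul_conj hR0 hz (hZr ρ hρ)
      rw [h0, norm_zero] at this
      nlinarith
  have hg0 : ∀ z, ‖z - c‖ ≤ r₂ → g z ≠ 0 := fun z hz h0 => by
    by_cases hzZ : z ∈ Z
    · exact hgne z hzZ h0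
    · exact hzZ ((hZ z hz).1 (by rw [hfg z (hmem z (by linarith)), h0, mul_zero]))
  have hh0 : ∀ z ∈ Metric.ball c r₂, h z ≠ 0 := fun z hz => by
    rw [Metric.mem_ball, dist_eq_norm] at hz
    exact mul_ne_zero (Finset.prod_ne_zero_iff.2 fun ρ hρ => pow_ne_zero _
      (div_ne_zero (hfac z (by linarith) ρ hρ) hRne)) (hg0 z hz.le)
  have hsum0 : 0 ≤ ∑ ρ ∈ Z, (m ρ : ℝ) := Finset.sum_nonneg fun _ _ => Nat.cast_nonneg _
  refine ⟨hN.trans (by gcongr; linarith [mul_pos hK₁0 hK₃0]), fun s hs hfs => ?_⟩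
  have hsR : ‖s - c‖ ≤ R := by linarith
  have hsZ : s ∉ Z := fun h => hfs ((hZ s (by linarith)).2 h)
  have hlog := norm_deriv_div_le_of_ne_zero h₁ h₂ hB (hhd.mono hmem₂) hh0
    (fun z hz => by
      rw [Metric.mem_ball, dist_eq_norm] at hz
      exact (hhB z (by linarith)).trans (by gcongr)) hs
  have hgs := hg0 s (by linarith)
  have hPs : P s ≠ 0 := Finset.prod_ne_zero_iff.2 fun ρ hρ => pow_ne_zero _
      (div_ne_zero (hfac s hsR ρ hρ) hRne)
  have hP' : deriv P s / P s = ∑ ρ ∈ Z, (m ρ : ℂ) *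
      (-starRingEnd ℂ (ρ - c) / ((R : ℂ) ^ 2 - (s - c) * starRingEnd ℂ (ρ - c))) := by
    rw [← logDeriv_apply, hP, logDeriv_prod
      (f := fun (ρ z : ℂ) => (((R : ℂ) ^ 2 - (z - c) * starRingEnd ℂ (ρ - c)) / R) ^ m ρ)
      (fun ρ hρ => pow_ne_zero _ (div_ne_zero (hfac s hsR ρ hρ) hRne)) (fun ρ _ => by fun_prop)]
    refine Finset.sum_congr rfl fun ρ hρ => ?_
    rw [logDeriv_fun_pow (by fun_prop), logDeriv_apply]
    congr 1
    have hd : HasDerivAt (fun z : ℂ => ((R : ℂ) ^ 2 - (z - c) * starRingEnd ℂ (ρ - c)) / R)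
        (-(1 * starRingEnd ℂ (ρ - c)) / R) s :=
      ((((hasDerivAt_id s).sub_const c).mul_const _).const_sub _).div_const _
    rw [hd.deriv]
    have := hfac s hsR ρ hρ
    field_simp
  have hh' : deriv h s / h s = deriv P s / P s + deriv g s / g s := by
    have := logDeriv_mul s hPs hgs hPd.differentiableAt
      (hg.differentiableAt (Metric.isOpen_ball.mem_nhds (hmem s hsR)))
    simpa only [logDeriv_apply] using this
  have hPbound : ‖deriv P s / P s‖ ≤ (K₁ * Real.log B) * K₃ := by
    rw [hP']
    refine (norm_sum_le _ _).trans ?_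
    refine le_trans (Finset.sum_le_sum (g := fun ρ => (m ρ : ℝ) * K₃) fun ρ hρ => ?_)
      ((Finset.sum_mul _ _ _).symm.trans_le (by gcongr))
    rw [norm_mul, Complex.norm_natCast, norm_div, norm_neg, RCLike.norm_conj, hK₃]
    have hRr : 0 < R * (R - r₂) := mul_pos hR0 (by linarith)
    gcongr
    · exact hZr ρ hρ
    · exact le_norm_sq_sub_mul_conj hR0 hsR (hZr ρ hρ)
  rw [deriv_div_of_factorization Metric.isOpen_ball hg hfg (hmem s hsR) hsZ hgs]
  have h5 : deriv g s / g s = deriv h s / h s - deriv P s / P s := by rw [hh']; ring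
  rw [h5]
  calc ‖∑ ρ ∈ Z, (m ρ : ℂ) / (s - ρ) + (deriv h s / h s - deriv P s / P s)‖
      ≤ ∑ ρ ∈ Z, (m ρ : ℝ) / ‖s - ρ‖ + (K₂ * Real.log B + K₁ * Real.log B * K₃) := by
        refine (norm_add_le _ _).trans (add_le_add ((norm_sum_le _ _).trans_eq ?_)
          ((norm_sub_le _ _).trans (add_le_add hlog hPbound)))
        exact Finset.sum_congr rfl fun ρ _ => by rw [norm_div, Complex.norm_natCast]
    _ ≤ _ := by nlinarith [mul_pos hK₁0 hlogB]

/-! ### Polynomial growth of Dirichlet `L`-functions -/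

section
variable {q : ℕ}

/-- The difference between the partial sums of `χ` and their linear main term, which is `t` for
`q = 1` and zero otherwise. -/
def charSumError (χ : DirichletCharacter ℂ q) (t : ℝ) : ℂ :=
  ∑ k ∈ Finset.Icc 1 ⌊t⌋₊, χ k - deltaOne q * t

lemma sum_range_char_add [NeZero q] {χ : DirichletCharacter ℂ q} (hχ : q ≠ 1 → χ ≠ 1) (n : ℕ) :
    ∑ k ∈ Finset.range q, χ ((n + k : ℕ) : ZMod q) = deltaOne q * q := by
  induction n with
  | zero =>
    have h : ∑ k ∈ Finset.range q, χ ((0 + k : ℕ) : ZMod q) = ∑ a : ZMod q, χ a := by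
      obtain ⟨m, rfl⟩ : ∃ m, q = m + 1 := Nat.exists_eq_succ_of_ne_zero (NeZero.ne q)
      rw [Finset.sum_range]
      refine Finset.sum_congr rfl fun a _ => ?_
      rw [zero_add]
      congr 1
      exact Fin.cast_val_eq_self a
    rw [h]
    by_cases hq : q = 1
    · subst hq
      have h1 : ∀ a : ZMod 1, χ a = 1 := fun a => by rw [Subsingleton.elim a 1, map_one]
      rw [Finset.sum_congr rfl fun a _ => h1 a]
      simp [deltaOne]
    · rw [χ.sum_eq_zero_of_ne_one (hχ hq)]
      simp [deltaOne, hq]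
  | succ n ih =>
    rw [← ih, ← sub_eq_zero]
    have h1 := Finset.sum_range_succ (fun k => χ ((n + k : ℕ) : ZMod q)) q
    have h2 := Finset.sum_range_succ' (fun k => χ ((n + k : ℕ) : ZMod q)) q
    have h3 : ((n + q : ℕ) : ZMod q) = ((n + 0 : ℕ) : ZMod q) := by simp
    rw [h3] at h1
    have h4 : ∀ k, n + 1 + k = n + (k + 1) := fun k => by ring
    simp only [h4]
    linear_combination h1 - h2

lemma exists_norm_charSumError_le [NeZero q] {χ : DirichletCharacter ℂ q} (hχ : q ≠ 1 → χ ≠ 1) :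
    ∃ M : ℝ, 0 ≤ M ∧ ∀ t : ℝ, 0 ≤ t → ‖charSumError χ t‖ ≤ M := by
  set D : ℕ → ℂ := fun n => ∑ k ∈ Finset.Icc 1 n, χ k - deltaOne q * n with hD
  have hper : Function.Periodic D q := fun n => by
    have h1 : ∑ k ∈ Finset.Icc 1 (n + q), χ k =
        ∑ k ∈ Finset.Icc 1 n, χ k + ∑ k ∈ Finset.range q, χ ((n + 1 + k : ℕ) : ZMod q) := by
      have h2 : ∀ N : ℕ, ∑ k ∈ Finset.Icc 1 N, χ k = ∑ k ∈ Finset.range N, χ ((1 + k : ℕ) : ZMod q) :=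
        fun N => by
          rw [← Finset.Ico_succ_right_eq_Icc, Finset.sum_Ico_eq_sum_range]
          simp
      rw [h2, h2, Finset.sum_range_add]
      congr 1
      refine Finset.sum_congr rfl fun k _ => ?_
      congr 2
      ring
    simp only [hD]
    rw [h1, sum_range_char_add hχ]
    push_cast
    ring
  refine ⟨(∑ n ∈ Finset.range q, ‖D n‖) + 1, by positivity, fun t ht => ?_⟩
  have h1 : charSumError χ t = D ⌊t⌋₊ - deltaOne q * ((t - ⌊t⌋₊ : ℝ) : ℂ) := by
    simp only [charSumError, hD]
    push_cast
    ring
  have h2 : ‖D ⌊t⌋₊‖ ≤ ∑ n ∈ Finset.range q, ‖D n‖ := by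
    rw [← hper.map_mod_nat]
    exact Finset.single_le_sum (f := fun n => ‖D n‖) (fun _ _ => norm_nonneg _)
      (Finset.mem_range.2 (Nat.mod_lt _ (NeZero.pos q)))
  have h3 : ‖(deltaOne q : ℂ)‖ ≤ 1 := by
    unfold deltaOne
    split_ifs <;> simp
  have h4 : ‖((t - ⌊t⌋₊ : ℝ) : ℂ)‖ ≤ 1 := by
    rw [Complex.norm_real, Real.norm_eq_abs, abs_of_nonneg (sub_nonneg.2 (Nat.floor_le ht))]
    linarith [Nat.lt_floor_add_one t]
  rw [h1]
  refine (norm_sub_le _ _).trans (add_le_add h2 ?_)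
  rw [norm_mul]
  exact mul_le_one₀ h3 (norm_nonneg _) h4

lemma measurable_charSumError (χ : DirichletCharacter ℂ q) : Measurable (charSumError χ) := by
  have h : Measurable fun t : ℝ => ∑ k ∈ Finset.Icc 1 ⌊t⌋₊, χ (k : ZMod q) :=
    (measurable_from_nat (f := fun n : ℕ => ∑ k ∈ Finset.Icc 1 n, χ (k : ZMod q))).comp
      Nat.measurable_floor
  exact h.sub (measurable_const.mul Complex.measurable_ofReal)

/-- The Mellin transform of the partial sums of `χ` without their main term. -/
def charSumMellin (χ : DirichletCharacter ℂ q) (s : ℂ) : ℂ :=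
  mellin ((Set.Ioi (1 : ℝ)).indicator (charSumError χ)) (-s)

lemma norm_indicator_charSumError_le {χ : DirichletCharacter ℂ q} {M : ℝ} (hM : 0 ≤ M)
    (h : ∀ t : ℝ, 0 ≤ t → ‖charSumError χ t‖ ≤ M) (t : ℝ) :
    ‖(Set.Ioi (1 : ℝ)).indicator (charSumError χ) t‖ ≤ M := by
  by_cases ht : t ∈ Set.Ioi (1 : ℝ)
  · rw [Set.indicator_of_mem ht]
    exact h t (zero_le_one.trans (le_of_lt ht))
  · simpa [Set.indicator_of_notMem ht] using hM

lemma differentiableAt_charSumMellin [NeZero q] {χ : DirichletCharacter ℂ q} (hχ : q ≠ 1 → χ ≠ 1) {s : ℂ}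
    (hs : 0 < s.re) : DifferentiableAt ℂ (charSumMellin χ) s := by
  obtain ⟨M, hM, hb⟩ := exists_norm_charSumError_le hχ
  have hb' := norm_indicator_charSumError_le hM hb
  have hmeas : Measurable ((Set.Ioi (1 : ℝ)).indicator (charSumError χ)) :=
    (measurable_charSumError χ).indicator measurableSet_Ioi
  have h : DifferentiableAt ℂ (mellin ((Set.Ioi (1 : ℝ)).indicator (charSumError χ))) (-s) := by
    refine mellin_differentiableAt_of_isBigO_rpow (a := 0) (b := (-s).re - 1) ?_ ?_ (by simpa) ?_
      (by linarith)
    · refine MeasureTheory.LocallyIntegrable.locallyIntegrableOn ?_ _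
      have hc : MeasureTheory.LocallyIntegrable (fun _ : ℝ => M) MeasureTheory.volume :=
        MeasureTheory.locallyIntegrable_const M
      refine hc.mono hmeas.aestronglyMeasurable (Eventually.of_forall fun t => ?_)
      rw [Real.norm_of_nonneg hM]
      exact hb' t
    · refine IsBigO.of_bound M (Eventually.of_forall fun t => ?_)
      simpa using hb' t
    · refine IsBigO.of_bound 0 ?_
      filter_upwards [Ioo_mem_nhdsGT (zero_lt_one (α := ℝ))] with t ht
      rw [Set.indicator_of_notMem (by simpa using ht.2.le)]
      simp
  exact DifferentiableAt.comp (g := mellin ((Set.Ioi (1 : ℝ)).indicator (charSumError χ)))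
    (f := fun s => -s) s h (by fun_prop)

lemma charSumMellin_eq (χ : DirichletCharacter ℂ q) (s : ℂ) :
    charSumMellin χ s = ∫ t in Set.Ioi (1 : ℝ), charSumError χ t * (t : ℂ) ^ (-(s + 1)) := by
  rw [charSumMellin, mellin]
  have h1 : ∀ t : ℝ, (t : ℂ) ^ (-s - 1) • (Set.Ioi (1 : ℝ)).indicator (charSumError χ) t =
      (Set.Ioi (1 : ℝ)).indicator (fun t => charSumError χ t * (t : ℂ) ^ (-(s + 1))) t := fun t => by
    by_cases ht : t ∈ Set.Ioi (1 : ℝ)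
    · rw [Set.indicator_of_mem ht, Set.indicator_of_mem ht, smul_eq_mul, mul_comm, neg_add']
    · rw [Set.indicator_of_notMem ht, Set.indicator_of_notMem ht, smul_zero]
  simp_rw [h1]
  rw [MeasureTheory.setIntegral_indicator measurableSet_Ioi]
  congr 2
  ext t
  simp only [Set.mem_inter_iff, Set.mem_Ioi]
  exact ⟨fun h => h.2, fun h => ⟨zero_lt_one.trans h, h⟩⟩

lemma integrableOn_charSumError_mul [NeZero q] {χ : DirichletCharacter ℂ q} (hχ : q ≠ 1 → χ ≠ 1) {s : ℂ}
    (hs : 0 < s.re) : MeasureTheory.IntegrableOn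
      (fun t : ℝ => charSumError χ t * (t : ℂ) ^ (-(s + 1))) (Set.Ioi 1) := by
  obtain ⟨M, hM, hb⟩ := exists_norm_charSumError_le hχ
  have h1 : MeasureTheory.IntegrableOn (fun t : ℝ => (t : ℂ) ^ (-(s + 1))) (Set.Ioi 1) :=
    integrableOn_Ioi_cpow_of_lt (by simp; linarith) zero_lt_one
  refine h1.bdd_mul (c := M) (measurable_charSumError χ).aestronglyMeasurable ?_
  filter_upwards [MeasureTheory.ae_restrict_mem measurableSet_Ioi] with t ht
  exact hb t (zero_le_one.trans (le_of_lt ht))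

lemma exists_norm_charSumMellin_le [NeZero q] {χ : DirichletCharacter ℂ q} (hχ : q ≠ 1 → χ ≠ 1) :
    ∃ M : ℝ, 0 ≤ M ∧ ∀ s : ℂ, 0 < s.re → ‖charSumMellin χ s‖ ≤ M / s.re := by
  obtain ⟨M, hM, hb⟩ := exists_norm_charSumError_le hχ
  refine ⟨M, hM, fun s hs => ?_⟩
  rw [charSumMellin_eq]
  have h1 : ∫ t in Set.Ioi (1 : ℝ), M * t ^ (-(s.re + 1)) = M / s.re := by
    rw [MeasureTheory.integral_const_mul, integral_Ioi_rpow_of_lt (by linarith) zero_lt_one]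
    have : s.re ≠ 0 := hs.ne'
    rw [show -(s.re + 1) + 1 = -s.re by ring]
    simp [div_eq_mul_inv]
  rw [← h1]
  refine MeasureTheory.norm_integral_le_of_norm_le
    ((integrableOn_Ioi_rpow_of_lt (by linarith) zero_lt_one).const_mul M) ?_
  filter_upwards [MeasureTheory.ae_restrict_mem measurableSet_Ioi] with t ht
  have ht0 : 0 < t := zero_lt_one.trans ht
  rw [norm_mul, Complex.norm_cpow_eq_rpow_re_of_pos ht0]
  gcongr
  · exact hb t ht0.le
  · exact ht.le
  · simp

lemma LFunction_eq_of_one_lt_re [NeZero q] {χ : DirichletCharacter ℂ q} (hχ : q ≠ 1 → χ ≠ 1) {s : ℂ}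
    (hs : 1 < s.re) :
    χ.LFunction s = s * charSumMellin χ s + deltaOne q * (s / (s - 1)) := by
  obtain ⟨M, hM, hb⟩ := exists_norm_charSumError_le hχ
  have hs1 : s - 1 ≠ 0 := fun h => by
    have := congrArg Complex.re h
    simp at this
    linarith
  have hO : (fun n : ℕ => ∑ k ∈ Finset.Icc 1 n, χ (k : ZMod q)) =O[atTop]
      fun n : ℕ => (n : ℝ) ^ (1 : ℝ) := by
    refine IsBigO.of_bound 1 (Eventually.of_forall fun n => ?_)
    rw [Real.rpow_one, Real.norm_natCast, one_mul]
    refine (norm_sum_le _ _).trans ((Finset.sum_le_sum (g := fun _ => (1 : ℝ)) fun k _ => χ.norm_le_one _).trans ?_)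
    simp
  rw [χ.LFunction_eq_LSeries hs, LSeries_eq_mul_integral _ zero_le_one hs
    (DirichletCharacter.LSeriesSummable_of_one_lt_re χ hs) hO, charSumMellin_eq]
  have hpow : MeasureTheory.IntegrableOn (fun t : ℝ => (t : ℂ) ^ (-s)) (Set.Ioi 1) :=
    integrableOn_Ioi_cpow_of_lt (by simpa) zero_lt_one
  have h1 : ∫ t in Set.Ioi (1 : ℝ), (∑ k ∈ Finset.Icc 1 ⌊t⌋₊, χ (k : ZMod q)) *
        (t : ℂ) ^ (-(s + 1)) =
      ∫ t in Set.Ioi (1 : ℝ), (charSumError χ t * (t : ℂ) ^ (-(s + 1)) +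
        deltaOne q * (t : ℂ) ^ (-s)) := by
    refine MeasureTheory.setIntegral_congr_fun measurableSet_Ioi fun t ht => ?_
    have ht0 : (t : ℂ) ≠ 0 := by exact_mod_cast (zero_lt_one.trans ht).ne'
    have h2 : (t : ℂ) ^ (-s) = t * (t : ℂ) ^ (-(s + 1)) := by
      rw [show -s = 1 + -(s + 1) by ring, Complex.cpow_add _ _ ht0, Complex.cpow_one]
    simp only [charSumError]
    rw [h2]
    ring
  rw [h1, MeasureTheory.integral_add (integrableOn_charSumError_mul hχ (by linarith))
    (hpow.const_mul _), MeasureTheory.integral_const_mul,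
    integral_Ioi_cpow_of_lt (by simpa) zero_lt_one]
  have h3 : -s + 1 ≠ 0 := fun h => hs1 (by linear_combination -h)
  have h4 : -((1 : ℝ) : ℂ) ^ (-s + 1) / (-s + 1) = 1 / (s - 1) := by
    rw [Complex.ofReal_one, Complex.one_cpow]
    field_simp
    ring
  rw [h4]
  ring

lemma LFunction_eq_of_re_pos [NeZero q] {χ : DirichletCharacter ℂ q} (hχ : q ≠ 1 → χ ≠ 1) {s : ℂ}
    (hs : 0 < s.re) (him : s.im ≠ 0) :
    χ.LFunction s = s * charSumMellin χ s + deltaOne q * (s / (s - 1)) := by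
  set Q : Set ℂ := {z | 0 < z.re ∧ 0 < s.im * z.im} with hQ
  have hQo : IsOpen Q := (isOpen_lt continuous_const Complex.continuous_re).inter
    (isOpen_lt continuous_const (continuous_const.mul Complex.continuous_im))
  have hQc : Convex ℝ Q := by
    intro z hz w hw a b ha hb hab
    simp only [hQ, Set.mem_ofPred_eq, Complex.add_re, Complex.add_im, Complex.real_smul,
      Complex.re_ofReal_mul, Complex.im_ofReal_mul] at hz hw ⊢
    constructor
    · rcases ha.eq_or_lt with rfl | ha
      · have : b = 1 := by linarith
        subst this; simpa using hw.1
      · nlinarith [mul_pos ha hz.1, mul_nonneg hb hw.1.le]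
    · rcases ha.eq_or_lt with rfl | ha
      · have : b = 1 := by linarith
        subst this; simpa using hw.2
      · nlinarith [mul_pos ha hz.2, mul_nonneg hb hw.2.le]
  have hne : ∀ z ∈ Q, z ≠ 1 := by
    rintro z hz rfl
    simpa using hz.2
  have hL : AnalyticOnNhd ℂ χ.LFunction Q := by
    refine DifferentiableOn.analyticOnNhd (fun z hz => ?_) hQo
    exact (χ.differentiableAt_LFunction z (Or.inl (hne z hz))).differentiableWithinAt
  have hRd : DifferentiableOn ℂ
      (fun s => s * charSumMellin χ s + deltaOne q * (s / (s - 1))) Q := fun z hz => by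
    have h1 := differentiableAt_charSumMellin hχ hz.1
    have h2 : z - 1 ≠ 0 := sub_ne_zero.2 (hne z hz)
    exact DifferentiableAt.differentiableWithinAt (by fun_prop (disch := assumption))
  have hz₁ : s + 2 ∈ Q := ⟨by simp; linarith, by simpa using him⟩
  refine hL.eqOn_of_preconnected_of_eventuallyEq (hRd.analyticOnNhd hQo) hQc.isPreconnected hz₁ ?_
    (show s ∈ Q from ⟨hs, by simpa using him⟩)
  filter_upwards [(isOpen_lt continuous_const Complex.continuous_re).mem_nhds
    (show (1 : ℝ) < (s + 2).re by simp; linarith)] with z hz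
  exact LFunction_eq_of_one_lt_re hχ hz

/-- The bound `O(|s|)` that partial summation gives to the right of `Re s = 0`. -/
lemma exists_norm_LFunction_le [NeZero q] {χ : DirichletCharacter ℂ q} (hχ : q ≠ 1 → χ ≠ 1) :
    ∃ C : ℝ, 0 < C ∧ ∀ s : ℂ, 1 / 10 ≤ s.re → 1 ≤ |s.im| → ‖χ.LFunction s‖ ≤ C * ‖s‖ := by
  obtain ⟨M, hM, hb⟩ := exists_norm_charSumMellin_le hχ
  refine ⟨10 * M + 1, by positivity, fun s hs him => ?_⟩
  have hs0 : 0 < s.re := by linarith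
  have him0 : s.im ≠ 0 := fun h => by rw [h, abs_zero] at him; linarith
  have h1 : 1 ≤ ‖s - 1‖ := him.trans ((by simp : |s.im| = |(s - 1).im|).trans_le
    (Complex.abs_im_le_norm _))
  have h3 : ‖(deltaOne q : ℂ)‖ ≤ 1 := by
    unfold deltaOne
    split_ifs <;> simp
  rw [LFunction_eq_of_re_pos hχ hs0 him0]
  calc _ ≤ ‖s‖ * (10 * M) + 1 * (‖s‖ / 1) := by
        refine (norm_add_le _ _).trans ?_
        rw [norm_mul, norm_mul, norm_div]
        gcongr
        refine (hb s hs0).trans ?_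
        rw [div_le_iff₀ hs0]
        nlinarith
    _ = _ := by ring

lemma exists_le_norm_LFunction [NeZero q] (χ : DirichletCharacter ℂ q) :
    ∃ c : ℝ, 0 < c ∧ ∀ s : ℂ, s.re = 2 → c ≤ ‖χ.LFunction s‖ := by
  have hsum : Summable fun n : ℕ => ((n : ℝ) ^ (2 : ℕ))⁻¹ :=
    Real.summable_nat_pow_inv.2 one_lt_two
  set A := ∑' n : ℕ, ((n : ℝ) ^ (2 : ℕ))⁻¹ with hA
  have hA0 : 0 ≤ A := tsum_nonneg fun n => by positivity
  refine ⟨1 / (A + 1), by positivity, fun s hs => ?_⟩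
  have hs1 : 1 < s.re := by rw [hs]; norm_num
  have hmul := DirichletCharacter.LSeries.mul_mu_eq_one χ hs1
  rw [← χ.LFunction_eq_LSeries hs1] at hmul
  set g : ℕ → ℂ := (fun n : ℕ => χ (n : ZMod q)) * fun n : ℕ => ((ArithmeticFunction.moebius n : ℤ) : ℂ)
    with hg
  have hb : ‖LSeries g s‖ ≤ A := by
    refine tsum_of_norm_bounded hsum.hasSum fun n => ?_
    rw [LSeries.norm_term_eq]
    split_ifs with hn
    · simp [hn]
    · rw [hs, Real.rpow_two, ← one_div]
      gcongr
      simp only [hg, Pi.mul_apply, norm_mul]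
      refine mul_le_one₀ (χ.norm_le_one _) (norm_nonneg _) ?_
      rw [Complex.norm_intCast]
      exact_mod_cast ArithmeticFunction.abs_moebius_le_one
  rw [div_le_iff₀ (by positivity)]
  calc (1 : ℝ) = ‖χ.LFunction s‖ * ‖LSeries g s‖ := by rw [← norm_mul, hmul, norm_one]
    _ ≤ _ := by gcongr; linarith

end

/-! ### Local bounds for the logarithmic derivative of an `L`-function -/

lemma abs_im_sub_le_of_norm_sub_le {z : ℂ} {T r : ℝ} (h : ‖z - (2 + T * Complex.I)‖ ≤ r) :
    |z.im - T| ≤ r := by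
  simpa using (Complex.abs_im_le_norm _).trans h

lemma le_re_of_norm_sub_le {z : ℂ} {T r : ℝ} (h : ‖z - (2 + T * Complex.I)‖ ≤ r) :
    2 - r ≤ z.re := by
  have h1 : |z.re - 2| ≤ r := by simpa using (Complex.abs_re_le_norm _).trans h
  linarith [(abs_le.1 h1).1]

/-- A holomorphic function on a connected open set which is not identically zero vanishes to
finite order everywhere. -/
lemma analyticOrderAt_ne_top_of_ne_zero {U : Set ℂ} (hU : IsOpen U) (hc : IsPreconnected U)
    {f : ℂ → ℂ} (hf : DifferentiableOn ℂ f U) {c z : ℂ} (hcU : c ∈ U) (hfc : f c ≠ 0)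
    (hz : z ∈ U) : analyticOrderAt f z ≠ ⊤ := by
  refine (hf.analyticOnNhd hU).analyticOrderAt_ne_top_of_isPreconnected hc hcU hz ?_
  rw [(hf.analyticAt (hU.mem_nhds hcU)).analyticOrderAt_eq_zero.2 hfc]
  simp

/-- The number of zeros of `L(s, χ)` near `2 + iT` is `O(log |T|)`, and up to `O(log |T|)` the
logarithmic derivative there is accounted for by these zeros. -/
lemma exists_local_bound {q : ℕ} [NeZero q] {χ : DirichletCharacter ℂ q} (hχ : q ≠ 1 → χ ≠ 1) :
    ∃ K : ℝ, 0 < K ∧ ∀ T : ℝ, 3 ≤ |T| → ∃ Z : Finset ℂ,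
      (∀ z, z ∈ Z ↔ ‖z - (2 + T * Complex.I)‖ ≤ 37 / 20 ∧ χ.LFunction z = 0) ∧
      (∑ ρ ∈ Z, (analyticOrderNatAt χ.LFunction ρ : ℝ)) ≤ K * Real.log |T| ∧
      ∀ s, ‖s - (2 + T * Complex.I)‖ ≤ 8 / 5 → χ.LFunction s ≠ 0 →
        ‖deriv χ.LFunction s / χ.LFunction s‖ ≤ K * Real.log |T| +
          ∑ ρ ∈ Z, (analyticOrderNatAt χ.LFunction ρ : ℝ) / ‖s - ρ‖ := by
  obtain ⟨K, hK, hL⟩ := landau_bound (r₁ := 8 / 5) (r₂ := 37 / 20) (R := 19 / 10) (by norm_num)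
    (by norm_num) (by norm_num)
  obtain ⟨C, hC, hup⟩ := exists_norm_LFunction_le hχ
  obtain ⟨c₀, hc₀, hlow⟩ := exists_le_norm_LFunction χ
  set D := 3 * C / c₀ + 1 with hD
  have hD1 : 1 < D := by
    have : 0 < 3 * C / c₀ := by positivity
    linarith
  have hlogD := Real.log_pos hD1
  refine ⟨K * (Real.log D + 1), by positivity, fun T hT => ?_⟩
  have hT1 : 1 ≤ Real.log |T| := by
    rw [Real.le_log_iff_exp_le (by linarith)]
    linarith [Real.exp_one_lt_d9]
  set c : ℂ := 2 + T * Complex.I with hc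
  have him : ∀ z, ‖z - c‖ ≤ 39 / 20 → 1 ≤ |z.im| := fun z hz => by
    have h1 := abs_im_sub_le_of_norm_sub_le hz
    have h2 : |T| ≤ |z.im| + |z.im - T| := by
      calc |T| = |z.im - (z.im - T)| := by ring_nf
        _ ≤ _ := abs_sub _ _
    linarith
  have hdiff : DifferentiableOn ℂ χ.LFunction (Metric.ball c (39 / 20)) := fun z hz => by
    refine (χ.differentiableAt_LFunction z (Or.inl ?_)).differentiableWithinAt
    rintro rfl
    have := him 1 (by simpa [dist_eq_norm] using (Metric.mem_ball.1 hz).le)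
    norm_num at this
  have hcre : c.re = 2 := by simp [hc]
  have hLc := hlow c hcre
  have hLc0 : χ.LFunction c ≠ 0 := norm_pos_iff.1 (hc₀.trans_le hLc)
  have hord : ∀ z, ‖z - c‖ < 39 / 20 → analyticOrderAt χ.LFunction z ≠ ⊤ := fun z hz =>
    analyticOrderAt_ne_top_of_ne_zero Metric.isOpen_ball (convex_ball c _).isPreconnected hdiff
      (Metric.mem_ball_self (by norm_num)) hLc0 (by simpa [dist_eq_norm] using hz)
  have hfin : {z | z ∈ Metric.closedBall c (37 / 20) ∧ χ.LFunction z = 0}.Finite := by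
    have hlt : ∀ z ∈ Metric.closedBall c (37 / 20), ‖z - c‖ < 39 / 20 := fun z hz => by
      rw [Metric.mem_closedBall, dist_eq_norm] at hz
      linarith
    refine finite_zeros_of_isCompact (isCompact_closedBall c _) (fun z hz => ?_)
      fun z hz => hord z (hlt z hz)
    exact hdiff.analyticAt (Metric.isOpen_ball.mem_nhds (by
      simpa [dist_eq_norm] using hlt z hz))
  have hZ : ∀ z, z ∈ hfin.toFinset ↔ ‖z - c‖ ≤ 37 / 20 ∧ χ.LFunction z = 0 := fun z => by
    rw [Set.Finite.mem_toFinset, Set.mem_ofPred_eq, Metric.mem_closedBall, dist_eq_norm]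
  have hB : 1 < D * |T| := by nlinarith
  have hcT : ‖c‖ ≤ 2 + |T| := by
    refine (norm_add_le _ _).trans ?_
    simp
  have hbound : ∀ z, ‖z - c‖ ≤ 19 / 10 → ‖χ.LFunction z‖ ≤ D * |T| * ‖χ.LFunction c‖ :=
    fun z hz => by
      have h1 := le_re_of_norm_sub_le hz
      have h2 : ‖z‖ ≤ 3 * |T| := by
        calc ‖z‖ = ‖(z - c) + c‖ := by ring_nf
          _ ≤ 19 / 10 + (2 + |T|) := (norm_add_le _ _).trans (add_le_add hz hcT)
          _ ≤ 3 * |T| := by linarith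
      calc ‖χ.LFunction z‖ ≤ C * ‖z‖ := hup z (by linarith) (him z (by linarith))
        _ ≤ C * (3 * |T|) := by gcongr
        _ = (3 * C / c₀) * |T| * c₀ := by field_simp
        _ ≤ D * |T| * ‖χ.LFunction c‖ := by gcongr; linarith
  obtain ⟨h1, h2⟩ := hL χ.LFunction c (39 / 20) (D * |T|) hfin.toFinset (by norm_num) hB hdiff hLc0
    hbound (fun z hz => by rw [hZ]; exact ⟨fun h => ⟨hz, h⟩, fun h => h.2⟩)
    (fun z hz => ((hZ z).1 hz).1) (fun z hz => hord z (by linarith [((hZ z).1 hz).1]))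
  have hlog : K * Real.log (D * |T|) ≤ K * (Real.log D + 1) * Real.log |T| := by
    rw [Real.log_mul (by linarith) (by linarith), mul_assoc]
    gcongr
    nlinarith
  exact ⟨hfin.toFinset, hZ, h1.trans hlog, fun s hs hs0 => (h2 s hs hs0).trans (by gcongr)⟩

/-! ### The completed `L`-function -/

section
variable {q : ℕ}

lemma parityIndex_eq (χ : DirichletCharacter ℂ q) : parityIndex χ = 0 ∨ parityIndex χ = 1 := by
  unfold parityIndex
  split_ifs <;> simp

lemma parityIndex_re_nonneg (χ : DirichletCharacter ℂ q) : 0 ≤ (parityIndex χ).re := by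
  rcases parityIndex_eq χ with h | h <;> simp [h]

lemma parityIndex_inv (χ : DirichletCharacter ℂ q) : parityIndex χ⁻¹ = parityIndex χ := by
  unfold parityIndex
  simp only [MulChar.inv_apply_eq_inv', inv_eq_one]

lemma gammaFactor_eq (χ : DirichletCharacter ℂ q) (s : ℂ) :
    χ.gammaFactor s = Complex.Gammaℝ (s + parityIndex χ) := by
  rcases χ.even_or_odd with h | h
  · simp [h.gammaFactor_def, parityIndex, show χ (-1) = 1 from h]
  · have h1 : χ (-1) ≠ 1 := by
      rw [h]
      norm_num
    rw [h.gammaFactor_def, parityIndex, if_neg h1]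

lemma ne_one_of_isPrimitive [NeZero q] {χ : DirichletCharacter ℂ q} (hχ : χ.IsPrimitive)
    (hq : q ≠ 1) : χ ≠ 1 := by
  rintro rfl
  rw [DirichletCharacter.IsPrimitive, DirichletCharacter.conductor_one] at hχ
  exact hq hχ.symm

lemma isPrimitive_inv {χ : DirichletCharacter ℂ q} (hχ : χ.IsPrimitive) : χ⁻¹.IsPrimitive := by
  rw [DirichletCharacter.IsPrimitive, DirichletCharacter.conductor_inv]
  exact hχ

/-- The entire completed `L`-function: `q ^ (s / 2) Λ(s, χ)`, multiplied by `s (s - 1)` when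
`q = 1` in order to remove the poles of `Λ`. -/
def xiFunction [NeZero q] (χ : DirichletCharacter ℂ q) (s : ℂ) : ℂ :=
  if q = 1 then s * (s - 1) * completedRiemannZeta₀ s + 1
  else (q : ℂ) ^ (s / 2) * χ.completedLFunction s

/-- The elementary factor in `ξ(s, χ) = xiFactor χ s * L(s, χ)`. -/
def xiFactor (χ : DirichletCharacter ℂ q) (s : ℂ) : ℂ :=
  (if q = 1 then s * (s - 1) else 1) *
    ((q : ℂ) ^ (s / 2) * Complex.Gammaℝ (s + parityIndex χ))

/-- The part of the logarithmic derivative of `xiFactor` coming from the poles of `Λ`. -/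
def poleTerm (q : ℕ) (s : ℂ) : ℂ := deltaOne q * (1 / s + 1 / (s - 1))

/-- The part of the logarithmic derivative of `xiFactor` coming from the conductor and the
Gamma function. -/
def gammaTerm (χ : DirichletCharacter ℂ q) (s : ℂ) : ℂ :=
  1 / 2 * (Real.log (q / Real.pi) : ℂ) + 1 / 2 * Complex.digamma ((s + parityIndex χ) / 2)

lemma differentiable_xiFunction [NeZero q] {χ : DirichletCharacter ℂ q} (hχ : χ.IsPrimitive) :
    Differentiable ℂ (xiFunction χ) := by
  have hq0 : (q : ℂ) ≠ 0 := Nat.cast_ne_zero.2 (NeZero.ne q)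
  intro s
  by_cases hq : q = 1
  · have h : xiFunction χ = fun s => s * (s - 1) * completedRiemannZeta₀ s + 1 := by
      ext s; simp [xiFunction, hq]
    have := differentiable_completedZeta₀ s
    rw [h]
    fun_prop
  · have h : xiFunction χ = fun s => (q : ℂ) ^ (s / 2) * χ.completedLFunction s := by
      ext s; simp [xiFunction, hq]
    have := DirichletCharacter.differentiable_completedLFunction
      (ne_one_of_isPrimitive hχ hq) s
    rw [h]
    exact (DifferentiableAt.const_cpow (by fun_prop) (Or.inl hq0)).mul this

lemma xiFactor_ne_zero [NeZero q] (χ : DirichletCharacter ℂ q) {s : ℂ} (hs : 0 < s.re)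
    (hs1 : s ≠ 1) : xiFactor χ s ≠ 0 := by
  have hq0 : (q : ℂ) ≠ 0 := Nat.cast_ne_zero.2 (NeZero.ne q)
  have hs0 : s ≠ 0 := by rintro rfl; simp at hs
  refine mul_ne_zero ?_ (mul_ne_zero (by simp [Complex.cpow_eq_zero_iff, hq0])
    (Complex.Gammaℝ_ne_zero_of_re_pos ?_))
  · split_ifs
    · exact mul_ne_zero hs0 (sub_ne_zero.2 hs1)
    · exact one_ne_zero
  · rw [Complex.add_re]
    linarith [parityIndex_re_nonneg χ]

lemma xiFunction_eq [NeZero q] (χ : DirichletCharacter ℂ q) {s : ℂ} (hs : 0 < s.re) (hs1 : s ≠ 1) :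
    xiFunction χ s = xiFactor χ s * χ.LFunction s := by
  have hs0 : s ≠ 0 := by rintro rfl; simp at hs
  have hg : χ.gammaFactor s ≠ 0 := by
    rw [gammaFactor_eq]
    refine Complex.Gammaℝ_ne_zero_of_re_pos ?_
    rw [Complex.add_re]
    linarith [parityIndex_re_nonneg χ]
  rw [χ.LFunction_eq_completed_div_gammaFactor s (Or.inl hs0), xiFactor, ← gammaFactor_eq]
  by_cases hq : q = 1
  · subst hq
    have h1 : s - 1 ≠ 0 := sub_ne_zero.2 hs1
    have h2 : 1 - s ≠ 0 := sub_ne_zero.2 hs1.symm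
    simp only [xiFunction, if_true, DirichletCharacter.completedLFunction_modOne_eq,
      completedRiemannZeta_eq, Nat.cast_one, Complex.one_cpow, one_mul]
    field_simp
    ring
  · simp only [xiFunction, hq, if_false]
    field_simp

lemma hasDerivAt_Gammaℝ_add {χ : DirichletCharacter ℂ q} {s : ℂ} (hs : 0 < s.re) :
    DifferentiableAt ℂ (fun z => Complex.Gammaℝ (z + parityIndex χ)) s ∧
    logDeriv (fun z => Complex.Gammaℝ (z + parityIndex χ)) s =
      -(1 / 2) * (Real.log Real.pi : ℂ) +
        1 / 2 * Complex.digamma ((s + parityIndex χ) / 2) := by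
  have hpi : (Real.pi : ℂ) ≠ 0 := by exact_mod_cast Real.pi_ne_zero
  have hre : 0 < ((s + parityIndex χ) / 2).re := by
    have := parityIndex_re_nonneg χ
    rw [Complex.div_ofNat_re, Complex.add_re]
    linarith
  have ha : HasDerivAt (fun z => (z + parityIndex χ) / 2) (1 / 2) s :=
    ((hasDerivAt_id s).add_const _).div_const 2
  have ha' : HasDerivAt (fun z => -(z + parityIndex χ) / 2) (-1 / 2) s :=
    ((hasDerivAt_id s).add_const _).neg.div_const 2
  have h1 : HasDerivAt (fun z => (Real.pi : ℂ) ^ (-(z + parityIndex χ) / 2)) _ s :=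
    ha'.const_cpow (Or.inl hpi)
  have hG : DifferentiableAt ℂ Complex.Gamma ((s + parityIndex χ) / 2) :=
    Complex.differentiableAt_Gamma _ fun m h => by
      rw [h] at hre
      simp at hre
      linarith [(Nat.cast_nonneg m : (0 : ℝ) ≤ m)]
  have h2 : HasDerivAt (fun z => Complex.Gamma ((z + parityIndex χ) / 2))
      (deriv Complex.Gamma ((s + parityIndex χ) / 2) * (1 / 2)) s := hG.hasDerivAt.comp s ha
  have hGne := Complex.Gamma_ne_zero_of_re_pos hre
  have hpne : (Real.pi : ℂ) ^ (-(s + parityIndex χ) / 2) ≠ 0 := by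
    simp [Complex.cpow_eq_zero_iff, hpi]
  have h3 := h1.mul h2
  refine ⟨h3.differentiableAt, ?_⟩
  have h4 : logDeriv (fun z => Complex.Gammaℝ (z + parityIndex χ)) s = _ :=
    logDeriv_mul s hpne hGne h1.differentiableAt h2.differentiableAt
  rw [h4, logDeriv_apply, logDeriv_apply, h1.deriv, h2.deriv, Complex.digamma_def, logDeriv_apply,
    Complex.ofReal_log Real.pi_nonneg]
  field_simp

lemma logDeriv_xiFactor [NeZero q] (χ : DirichletCharacter ℂ q) {s : ℂ} (hs : 0 < s.re)
    (hs1 : s ≠ 1) : DifferentiableAt ℂ (xiFactor χ) s ∧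
      logDeriv (xiFactor χ) s = poleTerm q s + gammaTerm χ s := by
  have hq0 : (q : ℂ) ≠ 0 := Nat.cast_ne_zero.2 (NeZero.ne q)
  have hs0 : s ≠ 0 := by rintro rfl; simp at hs
  have hs1' : s - 1 ≠ 0 := sub_ne_zero.2 hs1
  obtain ⟨hd, hl⟩ := hasDerivAt_Gammaℝ_add (χ := χ) hs
  have hGne : Complex.Gammaℝ (s + parityIndex χ) ≠ 0 := by
    refine Complex.Gammaℝ_ne_zero_of_re_pos ?_
    rw [Complex.add_re]
    linarith [parityIndex_re_nonneg χ]
  have hqd : HasDerivAt (fun z : ℂ => (q : ℂ) ^ (z / 2)) _ s :=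
    ((hasDerivAt_id s).div_const 2).const_cpow (Or.inl hq0)
  have hqne : (q : ℂ) ^ (s / 2) ≠ 0 := by simp [Complex.cpow_eq_zero_iff, hq0]
  have hA : logDeriv (fun z => (q : ℂ) ^ (z / 2) * Complex.Gammaℝ (z + parityIndex χ)) s =
      gammaTerm χ s := by
    rw [logDeriv_mul s hqne hGne hqd.differentiableAt hd, hl, logDeriv_apply, hqd.deriv, gammaTerm,
      Real.log_div (Nat.cast_ne_zero.2 (NeZero.ne q)) Real.pi_ne_zero, Complex.ofReal_sub,
      Complex.natCast_log]
    simp only [id]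
    field_simp
    ring
  have hAd := hqd.differentiableAt.mul hd
  by_cases hq : q = 1
  · have h : xiFactor χ = fun z => (z * (z - 1)) *
        ((q : ℂ) ^ (z / 2) * Complex.Gammaℝ (z + parityIndex χ)) := by
      ext z; simp [xiFactor, hq]
    have hp : DifferentiableAt ℂ (fun z : ℂ => z * (z - 1)) s := by fun_prop
    rw [h]
    refine ⟨hp.mul hAd, ?_⟩
    rw [logDeriv_mul (f := fun z : ℂ => z * (z - 1))
        (g := fun z => (q : ℂ) ^ (z / 2) * Complex.Gammaℝ (z + parityIndex χ)) s (mul_ne_zero hs0 hs1')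
        (mul_ne_zero hqne hGne) hp hAd, hA,
      logDeriv_mul (f := fun z : ℂ => z) (g := fun z : ℂ => z - 1) s hs0 hs1' (by fun_prop) (by fun_prop), poleTerm, deltaOne, if_pos hq]
    simp [logDeriv_apply]
  · have h : xiFactor χ = fun z => (q : ℂ) ^ (z / 2) * Complex.Gammaℝ (z + parityIndex χ) := by
      ext z; simp [xiFactor, hq]
    rw [h]
    refine ⟨hAd, ?_⟩
    rw [hA, poleTerm, deltaOne, if_neg hq]
    simp

lemma logDeriv_xiFunction [NeZero q] (χ : DirichletCharacter ℂ q) {s : ℂ} (hs : 0 < s.re)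
    (hs1 : s ≠ 1) (hL : χ.LFunction s ≠ 0) :
    deriv (xiFunction χ) s / xiFunction χ s =
      poleTerm q s + gammaTerm χ s + deriv χ.LFunction s / χ.LFunction s := by
  obtain ⟨hd, hl⟩ := logDeriv_xiFactor χ hs hs1
  have h1 : xiFunction χ =ᶠ[𝓝 s] fun z => xiFactor χ z * χ.LFunction z := by
    filter_upwards [(isOpen_lt continuous_const Complex.continuous_re).mem_nhds hs,
      isOpen_ne.mem_nhds hs1] with z hz hz1
    exact xiFunction_eq χ hz hz1
  rw [← logDeriv_apply, (logDeriv_congr_nhds h1).self_of_nhds,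
    logDeriv_mul s (xiFactor_ne_zero χ hs hs1) hL hd (χ.differentiableAt_LFunction s (Or.inl hs1)),
    hl, logDeriv_apply]

lemma xiFunction_ne_zero_of_one_le_re [NeZero q] {χ : DirichletCharacter ℂ q} (hχ : χ.IsPrimitive)
    {s : ℂ} (hs : 1 ≤ s.re) : xiFunction χ s ≠ 0 := by
  have hs0 : 0 < s.re := by linarith
  by_cases h1 : s = 1
  · by_cases hq : q = 1
    · simp [xiFunction, hq, h1]
    · have hχ1 := ne_one_of_isPrimitive hχ hq
      have hL := DirichletCharacter.LFunction_ne_zero_of_one_le_re χ (Or.inl hχ1) hs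
      rw [χ.LFunction_eq_completed_div_gammaFactor s (Or.inr hq)] at hL
      rw [xiFunction, if_neg hq]
      refine mul_ne_zero ?_ (div_ne_zero_iff.1 hL).1
      simp [Complex.cpow_eq_zero_iff, NeZero.ne q]
  · rw [xiFunction_eq χ hs0 h1]
    exact mul_ne_zero (xiFactor_ne_zero χ hs0 h1)
      (DirichletCharacter.LFunction_ne_zero_of_one_le_re χ (Or.inr h1) hs)

/-- The functional equation. -/
lemma exists_xiFunction_one_sub [NeZero q] {χ : DirichletCharacter ℂ q} (hχ : χ.IsPrimitive) :
    ∃ W : ℂ, W ≠ 0 ∧ ∀ s, xiFunction χ (1 - s) = W * xiFunction χ⁻¹ s := by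
  suffices h : ∃ W : ℂ, ∀ s, xiFunction χ (1 - s) = W * xiFunction χ⁻¹ s by
    obtain ⟨W, hW⟩ := h
    refine ⟨W, ?_, hW⟩
    rintro rfl
    have := hW (-1)
    rw [zero_mul] at this
    exact xiFunction_ne_zero_of_one_le_re hχ (by norm_num) this
  by_cases hq : q = 1
  · refine ⟨1, fun s => ?_⟩
    simp only [xiFunction, if_pos hq, completedRiemannZeta₀_one_sub]
    ring
  · have hq0 : (q : ℂ) ≠ 0 := Nat.cast_ne_zero.2 (NeZero.ne q)
    refine ⟨χ.rootNumber, fun s => ?_⟩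
    simp only [xiFunction, if_neg hq]
    rw [hχ.completedLFunction_one_sub, ← mul_assoc, ← mul_assoc, ← Complex.cpow_add _ _ hq0]
    ring_nf

lemma xiFunction_eq_zero_iff [NeZero q] {χ : DirichletCharacter ℂ q} (hχ : χ.IsPrimitive) (s : ℂ) :
    xiFunction χ s = 0 ↔ s ∈ nontrivialZeros χ := by
  constructor
  · intro h
    have h1 : s.re < 1 := by
      by_contra h1
      exact xiFunction_ne_zero_of_one_le_re hχ (not_lt.1 h1) h
    have h0 : 0 < s.re := by
      by_contra h0
      obtain ⟨W, hW, hfe⟩ := exists_xiFunction_one_sub hχ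
      have h2 := hfe (1 - s)
      rw [sub_sub_cancel, h] at h2
      rcases mul_eq_zero.1 h2.symm with h3 | h3
      · exact hW h3
      · refine xiFunction_ne_zero_of_one_le_re (isPrimitive_inv hχ) ?_ h3
        rw [Complex.sub_re, Complex.one_re]
        linarith [not_lt.1 h0]
    have hs1 : s ≠ 1 := by rintro rfl; simp at h1
    rw [xiFunction_eq χ h0 hs1] at h
    exact ⟨h0, h1, (mul_eq_zero.1 h).resolve_left (xiFactor_ne_zero χ h0 hs1)⟩
  · rintro ⟨h0, h1, h⟩
    have hs1 : s ≠ 1 := by rintro rfl; simp at h1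
    rw [xiFunction_eq χ h0 hs1, h, mul_zero]

lemma one_sub_mem_nontrivialZeros [NeZero q] {χ : DirichletCharacter ℂ q} (hχ : χ.IsPrimitive)
    {s : ℂ} (hs : s ∈ nontrivialZeros χ) : 1 - s ∈ nontrivialZeros χ⁻¹ := by
  obtain ⟨W, hW, hfe⟩ := exists_xiFunction_one_sub hχ
  rw [← xiFunction_eq_zero_iff (isPrimitive_inv hχ)]
  rw [← xiFunction_eq_zero_iff hχ] at hs
  have h2 := hfe (1 - s)
  rw [sub_sub_cancel, hs] at h2
  exact (mul_eq_zero.1 h2.symm).resolve_left hW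

lemma analyticOrderAt_xiFunction_ne_top [NeZero q] {χ : DirichletCharacter ℂ q}
    (hχ : χ.IsPrimitive) (s : ℂ) : analyticOrderAt (xiFunction χ) s ≠ ⊤ :=
  analyticOrderAt_ne_top_of_ne_zero isOpen_univ isPreconnected_univ
    (differentiable_xiFunction hχ).differentiableOn (Set.mem_univ (2 : ℂ))
    (xiFunction_ne_zero_of_one_le_re hχ (by norm_num)) (Set.mem_univ s)

lemma analyticOrderAt_xiFunction [NeZero q] (χ : DirichletCharacter ℂ q) {s : ℂ} (hs : 0 < s.re)
    (hs1 : s ≠ 1) : analyticOrderAt (xiFunction χ) s = analyticOrderAt χ.LFunction s := by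
  set U : Set ℂ := {z | 0 < z.re} ∩ {z | z ≠ 1} with hU
  have hUo : IsOpen U := (isOpen_lt continuous_const Complex.continuous_re).inter isOpen_ne
  have hUs : U ∈ 𝓝 s := hUo.mem_nhds ⟨hs, hs1⟩
  have h1 : xiFunction χ =ᶠ[𝓝 s] xiFactor χ * χ.LFunction := by
    filter_upwards [hUs] with z hz using xiFunction_eq χ hz.1 hz.2
  have ha : AnalyticAt ℂ (xiFactor χ) s :=
    DifferentiableOn.analyticAt (s := U)
      (fun z hz => (logDeriv_xiFactor χ hz.1 hz.2).1.differentiableWithinAt) hUs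
  have hb : AnalyticAt ℂ χ.LFunction s :=
    DifferentiableOn.analyticAt (s := U) (fun z hz =>
      (χ.differentiableAt_LFunction z (Or.inl hz.2)).differentiableWithinAt) hUs
  rw [analyticOrderAt_congr h1, analyticOrderAt_mul ha hb,
    ha.analyticOrderAt_eq_zero.2 (xiFactor_ne_zero χ hs hs1), zero_add]

lemma analyticOrderAt_xiFunction_one_sub [NeZero q] {χ : DirichletCharacter ℂ q}
    (hχ : χ.IsPrimitive) (s : ℂ) :
    analyticOrderAt (xiFunction χ) (1 - s) = analyticOrderAt (xiFunction χ⁻¹) s := by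
  obtain ⟨W, hW, hfe⟩ := exists_xiFunction_one_sub hχ
  have hd : HasDerivAt (fun z : ℂ => 1 - z) (-1) s := (hasDerivAt_id s).const_sub 1
  have h1 := analyticOrderAt_comp_of_deriv_ne_zero (f := xiFunction χ) (g := fun z : ℂ => 1 - z)
    (z₀ := s) (by fun_prop) (by rw [hd.deriv]; norm_num)
  have h2 : xiFunction χ ∘ (fun z : ℂ => 1 - z) = (fun _ => W) * xiFunction χ⁻¹ := by
    ext z
    exact hfe z
  have h3 : AnalyticAt ℂ (fun _ : ℂ => W) s := analyticAt_const
  rw [← h1, h2, analyticOrderAt_mul h3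
    ((differentiable_xiFunction (isPrimitive_inv hχ)).analyticAt s),
    h3.analyticOrderAt_eq_zero.2 hW, zero_add]

lemma analyticOrderNatAt_one_sub [NeZero q] {χ : DirichletCharacter ℂ q} (hχ : χ.IsPrimitive)
    {s : ℂ} (h0 : 0 < s.re) (h1 : s.re < 1) :
    analyticOrderNatAt χ⁻¹.LFunction (1 - s) = analyticOrderNatAt χ.LFunction s := by
  have hs1 : s ≠ 1 := by rintro rfl; simp at h1
  have hs0 : 1 - s ≠ 1 := by
    intro h
    have : s = 0 := by linear_combination -h
    subst this
    simp at h0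
  rw [analyticOrderNatAt, analyticOrderNatAt, ← analyticOrderAt_xiFunction χ h0 hs1,
    ← analyticOrderAt_xiFunction χ⁻¹ (by simpa using h1) hs0,
    ← analyticOrderAt_xiFunction_one_sub hχ, sub_sub_cancel]

/-- The logarithmic derivative to the left of the critical strip, from the functional equation. -/
lemma logDeriv_xiFunction_one_sub [NeZero q] {χ : DirichletCharacter ℂ q} (hχ : χ.IsPrimitive)
    (s : ℂ) : deriv (xiFunction χ) (1 - s) / xiFunction χ (1 - s) =
      -(deriv (xiFunction χ⁻¹) s / xiFunction χ⁻¹ s) := by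
  obtain ⟨W, hW, hfe⟩ := exists_xiFunction_one_sub hχ
  have h1 : HasDerivAt (fun z => xiFunction χ (1 - z)) (deriv (xiFunction χ) (1 - s) * -1) s :=
    (differentiable_xiFunction hχ (1 - s)).hasDerivAt.comp s ((hasDerivAt_id s).const_sub 1)
  have h2 : (fun z => xiFunction χ (1 - z)) = fun z => W * xiFunction χ⁻¹ z := funext hfe
  have h3 : HasDerivAt (fun z => W * xiFunction χ⁻¹ z) (W * deriv (xiFunction χ⁻¹) s) s :=
    ((differentiable_xiFunction (isPrimitive_inv hχ)) s).hasDerivAt.const_mul W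
  rw [h2] at h1
  have h4 := h1.unique h3
  rw [hfe, show deriv (xiFunction χ) (1 - s) = -(W * deriv (xiFunction χ⁻¹) s) by
    linear_combination -h4, neg_div, mul_div_mul_left _ _ hW]

end

/-! ### Heights at which the `L`-functions have no zeros nearby -/

/-- Pigeonhole: an interval of length one half contains a point far from a given finite set. -/
lemma exists_mem_Icc_forall_le_abs_sub (A : Finset ℝ) (T : ℝ) :
    ∃ x ∈ Set.Icc T (T + 1 / 2), ∀ a ∈ A, 1 / (4 * ((A.card : ℝ) + 1)) ≤ |x - a| := by
  by_contra! h
  set δ : ℝ := 1 / (4 * ((A.card : ℝ) + 1)) with hδ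
  have hδ0 : 0 < δ := by positivity
  have hsub : Set.Icc T (T + 1 / 2) ⊆ ⋃ a ∈ A, Metric.ball a δ := fun x hx => by
    obtain ⟨a, ha, hxa⟩ := h x hx
    exact Set.mem_biUnion ha (by rwa [Metric.mem_ball, Real.dist_eq])
  have h1 := (MeasureTheory.measure_mono (μ := MeasureTheory.volume) hsub).trans
    (MeasureTheory.measure_biUnion_finset_le A _)
  simp only [Real.volume_Icc, Real.volume_ball, Finset.sum_const, nsmul_eq_mul] at h1
  rw [← ENNReal.ofReal_natCast, ← ENNReal.ofReal_mul (by positivity),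
    ENNReal.ofReal_le_ofReal_iff (by positivity)] at h1
  have h2 : (A.card : ℝ) * (2 * δ) < 1 / 2 := by
    rw [hδ, mul_one_div, ← mul_div_assoc, div_lt_iff₀ (by positivity)]
    linarith
  linarith

section
variable {q : ℕ} [NeZero q] {χ : DirichletCharacter ℂ q}

lemma mem_nontrivialZeros_of_re_pos (hχ : χ.IsPrimitive) {s : ℂ} (hs : 0 < s.re) (hs1 : s ≠ 1)
    (h : χ.LFunction s = 0) : s ∈ nontrivialZeros χ := by
  rw [← xiFunction_eq_zero_iff hχ, xiFunction_eq χ hs hs1, h, mul_zero]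

lemma one_le_analyticOrderNatAt (hχ : χ.IsPrimitive) {s : ℂ} (hs : s ∈ nontrivialZeros χ) :
    1 ≤ analyticOrderNatAt χ.LFunction s := by
  have hs1 : s ≠ 1 := by
    rintro rfl
    simpa using hs.2.1
  rw [analyticOrderNatAt, ← analyticOrderAt_xiFunction χ hs.1 hs1, Nat.one_le_iff_ne_zero, Ne,
    ENat.toNat_eq_zero, not_or]
  refine ⟨?_, analyticOrderAt_xiFunction_ne_top hχ s⟩
  rw [((differentiable_xiFunction hχ).analyticAt s).analyticOrderAt_eq_zero, not_not]
  exact (xiFunction_eq_zero_iff hχ s).2 hs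

/-- A bound for the logarithmic derivative at a height `T'` with distance at least `δ` from the
ordinates of the zeros near `2 + iT`. -/
lemma exists_zeros_near (hχ : χ.IsPrimitive) :
    ∃ K : ℝ, 0 < K ∧ ∀ T : ℝ, 3 ≤ |T| → ∃ Z : Finset ℂ,
      (∀ ρ ∈ Z, ρ ∈ nontrivialZeros χ) ∧
      (∀ ρ ∈ nontrivialZeros χ, 1 / 2 ≤ ρ.re → |ρ.im - T| ≤ 1 / 2 → ρ ∈ Z) ∧
      (∑ ρ ∈ Z, (analyticOrderNatAt χ.LFunction ρ : ℝ)) ≤ K * Real.log |T| ∧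
      (Z.card : ℝ) ≤ K * Real.log |T| ∧
      ∀ T' δ : ℝ, |T' - T| ≤ 1 / 2 → 0 < δ → (∀ ρ ∈ Z, δ ≤ |T' - ρ.im|) →
        ∀ σ : ℝ, 1 / 2 ≤ σ → σ ≤ 3 / 2 → χ.LFunction (σ + T' * Complex.I) ≠ 0 ∧
          ‖deriv χ.LFunction (σ + T' * Complex.I) / χ.LFunction (σ + T' * Complex.I)‖ ≤
            K * Real.log |T| * (1 + 1 / δ) := by
  obtain ⟨K, hK, hloc⟩ := exists_local_bound (χ := χ) (ne_one_of_isPrimitive hχ)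
  refine ⟨K, hK, fun T hT => ?_⟩
  obtain ⟨Z, hZ, hsum, hbd⟩ := hloc T hT
  have hZ0 : ∀ ρ ∈ Z, ρ ∈ nontrivialZeros χ := fun ρ hρ => by
    obtain ⟨h1, h2⟩ := (hZ ρ).1 hρ
    refine mem_nontrivialZeros_of_re_pos hχ (by linarith [le_re_of_norm_sub_le h1]) ?_ h2
    rintro rfl
    have := abs_im_sub_le_of_norm_sub_le h1
    rw [Complex.one_im, zero_sub, abs_neg] at this
    linarith
  -- the rectangle `[1/2, 3/2] × [T - 1/2, T + 1/2]` lies in the disc of radius `8/5`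
  have hdist : ∀ σ y : ℝ, 1 / 2 ≤ σ → σ ≤ 3 / 2 → |y - T| ≤ 1 / 2 →
      ‖(σ + y * Complex.I : ℂ) - (2 + T * Complex.I)‖ ≤ 8 / 5 := fun σ y h1 h2 h3 => by
    rw [← sq_le_sq₀ (norm_nonneg _) (by norm_num), ← Complex.normSq_eq_norm_sq,
      Complex.normSq_apply]
    have h4 := abs_le.1 h3
    simp only [Complex.sub_re, Complex.add_re, Complex.ofReal_re, Complex.mul_re, Complex.I_re,
      Complex.ofReal_im, Complex.I_im, Complex.re_ofNat, Complex.sub_im, Complex.add_im,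
      Complex.mul_im, Complex.im_ofNat]
    nlinarith
  refine ⟨Z, hZ0, fun ρ hρ h1 h2 => ?_, hsum, ?_, fun T' δ hT' hδ hfar σ h1 h2 => ?_⟩
  · have := hdist ρ.re ρ.im h1 (by linarith [hρ.2.1]) h2
    rw [Complex.re_add_im] at this
    exact (hZ ρ).2 ⟨by linarith, hρ.2.2⟩
  · refine le_trans ?_ hsum
    rw [Finset.cast_card]
    refine Finset.sum_le_sum fun ρ hρ => ?_
    exact_mod_cast one_le_analyticOrderNatAt hχ (hZ0 ρ hρ)
  · have hd := hdist σ T' h1 h2 hT'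
    have hne : χ.LFunction (σ + T' * Complex.I) ≠ 0 := fun h0 => by
      have := hfar _ ((hZ _).2 ⟨by linarith, h0⟩)
      simp at this
      linarith
    refine ⟨hne, (hbd _ hd hne).trans ?_⟩
    have h3 : ∑ ρ ∈ Z, (analyticOrderNatAt χ.LFunction ρ : ℝ) / ‖(σ + T' * Complex.I : ℂ) - ρ‖ ≤
        ∑ ρ ∈ Z, (analyticOrderNatAt χ.LFunction ρ : ℝ) * (1 / δ) := by
      refine Finset.sum_le_sum fun ρ hρ => ?_
      rw [div_eq_mul_one_div]
      gcongr
      refine (hfar ρ hρ).trans ?_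
      simpa using Complex.abs_im_le_norm ((σ + T' * Complex.I : ℂ) - ρ)
    rw [← Finset.sum_mul] at h3
    have h4 : (∑ ρ ∈ Z, (analyticOrderNatAt χ.LFunction ρ : ℝ)) * (1 / δ) ≤
        K * Real.log |T| * (1 / δ) := by gcongr
    linarith

/-- `T'` is a good height for `χ`, with bound `B`: on the two segments
`[1/2, 3/2] ± iT'` the function `L(s, χ)` does not vanish, and its logarithmic derivative is
bounded by `B`. -/
def GoodHeight (χ : DirichletCharacter ℂ q) (B T' : ℝ) : Prop :=
  ∀ y : ℝ, |y| = T' → ∀ σ : ℝ, 1 / 2 ≤ σ → σ ≤ 3 / 2 →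
    χ.LFunction (σ + y * Complex.I) ≠ 0 ∧
    ‖deriv χ.LFunction (σ + y * Complex.I) / χ.LFunction (σ + y * Complex.I)‖ ≤ B

/-- Near every height there is one which is good for `χ` and for `χ⁻¹`, and there are few zeros
in between. -/
theorem exists_goodHeight (hχ : χ.IsPrimitive) :
    ∃ K : ℝ, 0 < K ∧ ∀ T : ℝ, 3 ≤ T → ∃ T' ∈ Set.Icc T (T + 1 / 2),
      GoodHeight χ (K * Real.log T ^ 2) T' ∧ GoodHeight χ⁻¹ (K * Real.log T ^ 2) T' ∧
      ∀ Y : Finset ℂ, (∀ ρ ∈ Y, ρ ∈ nontrivialZeros χ ∧ T ≤ |ρ.im| ∧ |ρ.im| ≤ T + 1 / 2) →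
        (∑ ρ ∈ Y, (analyticOrderNatAt χ.LFunction ρ : ℝ)) ≤ K * Real.log T := by
  classical
  obtain ⟨K₁, hK₁, hn₁⟩ := exists_zeros_near hχ
  obtain ⟨K₂, hK₂, hn₂⟩ := exists_zeros_near (isPrimitive_inv hχ)
  set K := max K₁ K₂ with hKdef
  have hK₁K : K₁ ≤ K := le_max_left _ _
  have hK₂K : K₂ ≤ K := le_max_right _ _
  have hK : 0 < K := hK₁.trans_le hK₁K
  refine ⟨K * (5 + 16 * K), by positivity, fun T hT => ?_⟩
  have hT0 : |T| = T := abs_of_nonneg (by linarith)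
  have hT0' : |-T| = T := by rw [abs_neg, hT0]
  have hlog : 1 ≤ Real.log T := by
    rw [Real.le_log_iff_exp_le (by linarith)]
    linarith [Real.exp_one_lt_d9]
  obtain ⟨Z₁, a₁, b₁, c₁, d₁, e₁⟩ := hn₁ T (hT0.symm ▸ hT)
  obtain ⟨Z₂, a₂, b₂, c₂, d₂, e₂⟩ := hn₁ (-T) (hT0'.symm ▸ hT)
  obtain ⟨Z₃, a₃, b₃, c₃, d₃, e₃⟩ := hn₂ T (hT0.symm ▸ hT)
  obtain ⟨Z₄, a₄, b₄, c₄, d₄, e₄⟩ := hn₂ (-T) (hT0'.symm ▸ hT)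
  rw [hT0] at c₁ d₁ e₁ c₃ d₃ e₃
  rw [hT0'] at c₂ d₂ e₂ c₄ d₄ e₄
  have hm₁ : K₁ * Real.log T ≤ K * Real.log T := by gcongr
  have hm₂ : K₂ * Real.log T ≤ K * Real.log T := by gcongr
  set A : Finset ℝ := (Z₁.image Complex.im ∪ Z₂.image fun ρ => -ρ.im) ∪
    (Z₃.image Complex.im ∪ Z₄.image fun ρ => -ρ.im) with hA
  have hcard : (A.card : ℝ) ≤ 4 * K * Real.log T := by
    have h : A.card ≤ (Z₁.card + Z₂.card) + (Z₃.card + Z₄.card) :=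
      (Finset.card_union_le _ _).trans (add_le_add
        ((Finset.card_union_le _ _).trans (add_le_add Finset.card_image_le Finset.card_image_le))
        ((Finset.card_union_le _ _).trans (add_le_add Finset.card_image_le Finset.card_image_le)))
    have h' : (A.card : ℝ) ≤ (Z₁.card + Z₂.card) + (Z₃.card + Z₄.card) := by exact_mod_cast h
    linarith
  obtain ⟨T', hT', hfar⟩ := exists_mem_Icc_forall_le_abs_sub A T
  set δ : ℝ := 1 / (4 * ((A.card : ℝ) + 1)) with hδ
  have hδ0 : 0 < δ := by positivity
  have hTT' : |T' - T| ≤ 1 / 2 := by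
    rw [abs_of_nonneg (by linarith [hT'.1])]
    linarith [hT'.2]
  have hTT'' : |-T' - -T| ≤ 1 / 2 := by
    rw [← neg_sub', abs_neg]
    exact hTT'
  have hT'0 : 0 ≤ T' := by linarith [hT'.1]
  have hδb : 1 + 1 / δ ≤ (5 + 16 * K) * Real.log T := by
    rw [hδ, one_div_one_div]
    nlinarith
  have hbound : ∀ k, 0 < k → k ≤ K → k * Real.log T * (1 + 1 / δ) ≤
      K * (5 + 16 * K) * Real.log T ^ 2 := fun k hk hkK => by
    calc k * Real.log T * (1 + 1 / δ) ≤ K * Real.log T * ((5 + 16 * K) * Real.log T) := by gcongr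
      _ = _ := by ring
  have hneg : ∀ ρ : ℂ, -ρ.im ∈ A → δ ≤ |-T' - ρ.im| := fun ρ hρ => by
    have := hfar _ hρ
    rwa [sub_neg_eq_add, ← abs_neg, neg_add'] at this
  have f₁ : ∀ ρ ∈ Z₁, δ ≤ |T' - ρ.im| := fun ρ hρ => hfar _ (by
    rw [hA]; simp only [Finset.mem_union, Finset.mem_image]; exact Or.inl (Or.inl ⟨ρ, hρ, rfl⟩))
  have f₂ : ∀ ρ ∈ Z₂, δ ≤ |-T' - ρ.im| := fun ρ hρ => hneg _ (by
    rw [hA]; simp only [Finset.mem_union, Finset.mem_image]; exact Or.inl (Or.inr ⟨ρ, hρ, rfl⟩))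
  have f₃ : ∀ ρ ∈ Z₃, δ ≤ |T' - ρ.im| := fun ρ hρ => hfar _ (by
    rw [hA]; simp only [Finset.mem_union, Finset.mem_image]; exact Or.inr (Or.inl ⟨ρ, hρ, rfl⟩))
  have f₄ : ∀ ρ ∈ Z₄, δ ≤ |-T' - ρ.im| := fun ρ hρ => hneg _ (by
    rw [hA]; simp only [Finset.mem_union, Finset.mem_image]; exact Or.inr (Or.inr ⟨ρ, hρ, rfl⟩))
  refine ⟨T', hT', fun y hy σ h1 h2 => ?_, fun y hy σ h1 h2 => ?_, fun Y hY => ?_⟩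
  · rcases (abs_eq hT'0).1 hy with rfl | rfl
    · obtain ⟨h3, h4⟩ := e₁ y δ hTT' hδ0 f₁ σ h1 h2
      exact ⟨h3, h4.trans (hbound K₁ hK₁ hK₁K)⟩
    · obtain ⟨h3, h4⟩ := e₂ (-T') δ hTT'' hδ0 f₂ σ h1 h2
      exact ⟨h3, h4.trans (hbound K₁ hK₁ hK₁K)⟩
  · rcases (abs_eq hT'0).1 hy with rfl | rfl
    · obtain ⟨h3, h4⟩ := e₃ y δ hTT' hδ0 f₃ σ h1 h2
      exact ⟨h3, h4.trans (hbound K₂ hK₂ hK₂K)⟩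
    · obtain ⟨h3, h4⟩ := e₄ (-T') δ hTT'' hδ0 f₄ σ h1 h2
      exact ⟨h3, h4.trans (hbound K₂ hK₂ hK₂K)⟩
  -- zeros in the left half of the critical strip are reflected to zeros of `L(s, χ⁻¹)`
  · have hsub : Y ⊆ (Z₁ ∪ Z₂) ∪ (Z₃.image (fun ρ => 1 - ρ) ∪ Z₄.image fun ρ => 1 - ρ) :=
      fun ρ hρ => by
        obtain ⟨h1, h2, h3⟩ := hY ρ hρ
        simp only [Finset.mem_union, Finset.mem_image]
        have hcases : |ρ.im - T| ≤ 1 / 2 ∨ |ρ.im - -T| ≤ 1 / 2 := by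
          rcases le_total 0 ρ.im with h | h
          · rw [abs_of_nonneg h] at h2 h3
            exact Or.inl (abs_le.2 ⟨by linarith, by linarith⟩)
          · rw [abs_of_nonpos h] at h2 h3
            exact Or.inr (abs_le.2 ⟨by linarith, by linarith⟩)
        rcases le_total (1 / 2) ρ.re with hre | hre
        · rcases hcases with h | h
          · exact Or.inl (Or.inl (b₁ ρ h1 hre h))
          · exact Or.inl (Or.inr (b₂ ρ h1 hre h))
        · have h1' := one_sub_mem_nontrivialZeros hχ h1
          have hre' : 1 / 2 ≤ (1 - ρ).re := by
            rw [Complex.sub_re, Complex.one_re]; linarith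
          refine Or.inr ?_
          rcases hcases with h | h
          · refine Or.inr ⟨1 - ρ, b₄ _ h1' hre' ?_, sub_sub_cancel _ _⟩
            rw [← abs_neg]
            convert h using 2
            simp; ring
          · refine Or.inl ⟨1 - ρ, b₃ _ h1' hre' ?_, sub_sub_cancel _ _⟩
            rw [← abs_neg]
            convert h using 2
            simp; ring
    have himage : ∀ Z : Finset ℂ, (∀ ρ ∈ Z, ρ ∈ nontrivialZeros χ⁻¹) →
        ∑ ρ ∈ Z.image (fun ρ => 1 - ρ), (analyticOrderNatAt χ.LFunction ρ : ℝ) =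
          ∑ ρ ∈ Z, (analyticOrderNatAt χ⁻¹.LFunction ρ : ℝ) := fun Z hZ => by
      rw [Finset.sum_image fun x _ y _ h => sub_right_injective h]
      refine Finset.sum_congr rfl fun ρ hρ => ?_
      have := analyticOrderNatAt_one_sub (isPrimitive_inv hχ) (hZ ρ hρ).1 (hZ ρ hρ).2.1
      rw [inv_inv] at this
      rw [this]
    have hunion : ∀ U V : Finset ℂ, ∑ ρ ∈ U ∪ V, (analyticOrderNatAt χ.LFunction ρ : ℝ) ≤
        ∑ ρ ∈ U, (analyticOrderNatAt χ.LFunction ρ : ℝ) +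
          ∑ ρ ∈ V, (analyticOrderNatAt χ.LFunction ρ : ℝ) := fun U V => by
      rw [← Finset.sum_union_inter]
      exact le_add_of_nonneg_right (Finset.sum_nonneg fun _ _ => Nat.cast_nonneg _)
    have h1 := Finset.sum_le_sum_of_subset_of_nonneg
      (f := fun ρ => (analyticOrderNatAt χ.LFunction ρ : ℝ)) hsub fun _ _ _ => Nat.cast_nonneg _
    have h2 := hunion (Z₁ ∪ Z₂) (Z₃.image (fun ρ => 1 - ρ) ∪ Z₄.image fun ρ => 1 - ρ)
    have h3 := hunion Z₁ Z₂
    have h4 := hunion (Z₃.image (fun ρ => 1 - ρ)) (Z₄.image fun ρ => 1 - ρ)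
    rw [himage Z₃ a₃, himage Z₄ a₄] at h4
    have h5 : 4 * K * Real.log T ≤ K * (5 + 16 * K) * Real.log T := by
      rw [mul_comm 4 K]
      gcongr
      linarith
    linarith

end

/-! ### The sums over prime powers -/

lemma term_add_mul_I (a : ℕ → ℂ) (c ε t : ℝ) (n : ℕ) :
    LSeries.term a (c + (ε * t : ℝ) * Complex.I) n =
      LSeries.term a c n * Complex.exp (-(t * (ε * Real.log n : ℝ) * Complex.I)) := by
  rw [LSeries.term_def, LSeries.term_def]
  split_ifs with hn
  · simp
  · have hn0 : (n : ℂ) ≠ 0 := Nat.cast_ne_zero.2 hn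
    rw [Complex.cpow_add _ _ hn0, Complex.exp_neg, ← div_eq_mul_inv, div_div]
    congr 2
    rw [Complex.cpow_def_of_ne_zero hn0, ← Complex.natCast_log]
    congr 1
    push_cast
    ring

/-- Fourier inversion, termwise in an absolutely convergent Dirichlet series. -/
lemma DecayingPiecewiseC1.tendsto_integral_LSeries_mul {S : Finset ℝ} {δ C : ℝ} {g : ℝ → ℂ}
    (h : DecayingPiecewiseC1 S δ C g) {a : ℕ → ℂ} {c : ℝ} (ha : LSeriesSummable a c) (ε : ℝ) :
    (Summable fun n => LSeries.term a c n * g (ε * Real.log n)) ∧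
    Tendsto (fun T : ℝ => ∫ t in -T..T, LSeries a (c + (ε * t : ℝ) * Complex.I) * fourierInt g t)
      atTop (𝓝 (2 * Real.pi * ∑' n, LSeries.term a c n * g (ε * Real.log n))) := by
  have hnorm : Summable fun n => ‖LSeries.term a c n‖ := ha.norm
  obtain ⟨B, hB⟩ := h.norm_integral_fourierInt_le
  have hsum : Summable fun n => LSeries.term a c n * g (ε * Real.log n) := by
    refine Summable.of_norm_bounded (hnorm.mul_right C) fun n => ?_
    rw [norm_mul]
    gcongr
    exact h.norm_le _
  refine ⟨hsum, ?_⟩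
  set A := ∫ y : ℝ, ‖g y‖ with hA
  have hcont := continuous_fourierInt h.integrable
  have key : ∀ T : ℝ, ∫ t in -T..T, LSeries a (c + (ε * t : ℝ) * Complex.I) * fourierInt g t =
      ∑' n, LSeries.term a c n * ∫ t in -T..T,
        fourierInt g t * Complex.exp (-(t * (ε * Real.log n : ℝ) * Complex.I)) := fun T => by
    have h1 := intervalIntegral.hasSum_integral_of_dominated_convergence
      (μ := MeasureTheory.volume) (a := -T) (b := T)
      (F := fun n (t : ℝ) => LSeries.term a c n *
        (fourierInt g t * Complex.exp (-(t * (ε * Real.log n : ℝ) * Complex.I))))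
      (f := fun t => LSeries a (c + (ε * t : ℝ) * Complex.I) * fourierInt g t)
      (fun n _ => ‖LSeries.term a c n‖ * A)
      (fun n => (Continuous.aestronglyMeasurable (by fun_prop)))
      (fun n => Eventually.of_forall fun t _ => by
        have h0 : (-(t * (ε * Real.log n : ℝ) * Complex.I) : ℂ) =
            ((-(t * (ε * Real.log n)) : ℝ) : ℂ) * Complex.I := by
          push_cast
          ring
        rw [norm_mul, norm_mul, h0, Complex.norm_exp_ofReal_mul_I, mul_one]
        gcongr
        exact norm_fourierInt_le t)
      (Eventually.of_forall fun t _ => hnorm.mul_right A)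
      intervalIntegrable_const
      (Eventually.of_forall fun t _ => by
        have hs : Summable fun n => LSeries.term a (c + (ε * t : ℝ) * Complex.I) n := by
          have := (LSeriesSummable_iff_of_re_eq_re (f := a) (s := (c : ℂ))
            (s' := c + (ε * t : ℝ) * Complex.I) (by simp)).1 ha
          exact this
        have h2 := hs.hasSum.mul_right (fourierInt g t)
        refine h2.congr_fun fun n => ?_
        rw [term_add_mul_I]
        ring)
    rw [← h1.tsum_eq]
    simp_rw [intervalIntegral.integral_const_mul]
  simp_rw [key]
  rw [← tsum_mul_left]
  refine tendsto_tsum_of_dominated_convergence (bound := fun n => ‖LSeries.term a c n‖ * B)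
    (hnorm.mul_right B) (fun n => ?_) (Eventually.of_forall fun T n => ?_)
  · have := (h.tendsto_integral_fourierInt (ε * Real.log n)).const_mul (LSeries.term a c n)
    convert this using 2
    ring
  · rw [norm_mul]
    gcongr
    exact hB T _

section
variable {q : ℕ} [NeZero q]

lemma logDeriv_LFunction_eq (χ : DirichletCharacter ℂ q) {s : ℂ} (hs : 1 < s.re) :
    deriv χ.LFunction s / χ.LFunction s =
      -LSeries ((fun n : ℕ => χ n) * fun n : ℕ => (ArithmeticFunction.vonMangoldt n : ℂ)) s := by
  rw [χ.LSeries_twist_vonMangoldt_eq hs, χ.deriv_LFunction_eq_deriv_LSeries hs,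
    χ.LFunction_eq_LSeries hs, neg_div, neg_neg]

/-- The integral over the line `Re s = c` to the right of the critical strip. -/
lemma tendsto_integral_right (χ : DirichletCharacter ℂ q) {S : Finset ℝ} {δ C c : ℝ} {φ : ℝ → ℂ}
    (hc : 1 < c) (h : DecayingPiecewiseC1 S δ C fun x => φ x * (Real.exp (c * x) : ℂ)) :
    (Summable fun n : ℕ => (ArithmeticFunction.vonMangoldt n : ℂ) * χ n * φ (Real.log n)) ∧
    Tendsto (fun T : ℝ => ∫ t : ℝ in -T..T,
      deriv χ.LFunction (c + t * Complex.I) / χ.LFunction (c + t * Complex.I) *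
        laplaceTransform φ (-(c + t * Complex.I))) atTop
      (𝓝 (-(2 * Real.pi *
        ∑' n : ℕ, (ArithmeticFunction.vonMangoldt n : ℂ) * χ n * φ (Real.log n)))) := by
  have hs := χ.LSeriesSummable_twist_vonMangoldt (s := (c : ℂ)) (by simpa using hc)
  obtain ⟨h1, h2⟩ := h.tendsto_integral_LSeries_mul hs 1
  have hterm : ∀ n : ℕ, LSeries.term ((fun n : ℕ => χ n) *
      fun n : ℕ => (ArithmeticFunction.vonMangoldt n : ℂ)) c n *
      (φ (1 * Real.log n) * (Real.exp (c * (1 * Real.log n)) : ℂ)) =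
      (ArithmeticFunction.vonMangoldt n : ℂ) * χ n * φ (Real.log n) := fun n => by
    rw [LSeries.term_def]
    split_ifs with hn
    · simp [hn]
    · have hn0 : (n : ℂ) ≠ 0 := Nat.cast_ne_zero.2 hn
      have h3 : (Real.exp (c * (1 * Real.log n)) : ℂ) = (n : ℂ) ^ (c : ℂ) := by
        rw [Complex.cpow_def_of_ne_zero hn0, ← Complex.natCast_log, Complex.ofReal_exp]
        congr 1
        push_cast
        ring
      have h4 : (n : ℂ) ^ (c : ℂ) ≠ 0 := by simp [Complex.cpow_eq_zero_iff, hn0]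
      rw [h3, one_mul, Pi.mul_apply]
      field_simp
  simp_rw [hterm] at h1 h2
  refine ⟨h1, h2.neg.congr fun T => ?_⟩
  rw [← intervalIntegral.integral_neg]
  refine intervalIntegral.integral_congr fun t _ => ?_
  simp only [one_mul]
  rw [logDeriv_LFunction_eq χ (by simpa using hc), laplaceTransform_eq_fourierInt]
  ring

/-- The integral over the line `Re s = 1 - c` to the left of the critical strip, which the
functional equation turns into an integral of `L(s, χ⁻¹)` over `Re s = c`; here `χ` stands for the
character at which the `L`-function is evaluated. -/
lemma tendsto_integral_left (χ : DirichletCharacter ℂ q) {S : Finset ℝ} {δ C c : ℝ} {φ : ℝ → ℂ}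
    (hc : 1 < c) (h : DecayingPiecewiseC1 S δ C fun x => φ x * (Real.exp ((1 - c) * x) : ℂ)) :
    (Summable fun n : ℕ =>
      (ArithmeticFunction.vonMangoldt n : ℂ) * χ n / n * φ (-Real.log n)) ∧
    Tendsto (fun T : ℝ => ∫ t : ℝ in -T..T,
      deriv χ.LFunction (1 - ((1 - c : ℝ) + t * Complex.I)) /
          χ.LFunction (1 - ((1 - c : ℝ) + t * Complex.I)) *
        laplaceTransform φ (-((1 - c : ℝ) + t * Complex.I))) atTop
      (𝓝 (-(2 * Real.pi * ∑' n : ℕ,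
        (ArithmeticFunction.vonMangoldt n : ℂ) * χ n / n * φ (-Real.log n)))) := by
  have hs := χ.LSeriesSummable_twist_vonMangoldt (s := (c : ℂ)) (by simpa using hc)
  obtain ⟨h1, h2⟩ := h.tendsto_integral_LSeries_mul hs (-1)
  have hterm : ∀ n : ℕ, LSeries.term ((fun n : ℕ => χ n) *
      fun n : ℕ => (ArithmeticFunction.vonMangoldt n : ℂ)) c n *
      (φ (-1 * Real.log n) * (Real.exp ((1 - c) * (-1 * Real.log n)) : ℂ)) =
      (ArithmeticFunction.vonMangoldt n : ℂ) * χ n / n * φ (-Real.log n) := fun n => by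
    rw [LSeries.term_def]
    split_ifs with hn
    · simp [hn]
    · have hn0 : (n : ℂ) ≠ 0 := Nat.cast_ne_zero.2 hn
      have h3 : (Real.exp ((1 - c) * (-1 * Real.log n)) : ℂ) = (n : ℂ) ^ (c : ℂ) / n := by
        rw [eq_div_iff hn0, Complex.cpow_def_of_ne_zero hn0, ← Complex.natCast_log,
          Complex.ofReal_exp]
        have h6 : Complex.exp (Real.log n : ℂ) = n := by
          rw [Complex.natCast_log, Complex.exp_log hn0]
        conv_lhs => rw [← h6]
        rw [← Complex.exp_add]
        congr 1
        push_cast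
        ring
      have h4 : (n : ℂ) ^ (c : ℂ) ≠ 0 := by simp [Complex.cpow_eq_zero_iff, hn0]
      rw [h3, neg_one_mul, Pi.mul_apply]
      field_simp
  simp_rw [hterm] at h1 h2
  refine ⟨h1, h2.neg.congr fun T => ?_⟩
  rw [← intervalIntegral.integral_neg]
  refine intervalIntegral.integral_congr fun t _ => ?_
  have h5 : (1 - ((1 - c : ℝ) + t * Complex.I) : ℂ) = c + ((-1 * t : ℝ) : ℂ) * Complex.I := by
    push_cast
    ring
  rw [h5, logDeriv_LFunction_eq χ (by simpa using hc), laplaceTransform_eq_fourierInt]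
  ring

end

/-! ### The contour integral -/

lemma integral_comp_path_eq_add {V : Set ℂ} {f g h : ℂ → ℂ} (hg : ContinuousOn g V)
    (hh : ContinuousOn h V) (hf : ∀ s ∈ V, f s = g s + h s) {γ : ℝ → ℂ} (hγ : Continuous γ)
    {p r : ℝ} (hpr : p ≤ r) (hV : ∀ x ∈ Set.Icc p r, γ x ∈ V) :
    IntervalIntegrable (fun x => f (γ x)) MeasureTheory.volume p r ∧
    ∫ x in p..r, f (γ x) = (∫ x in p..r, g (γ x)) + ∫ x in p..r, h (γ x) := by
  have hV' : ∀ x ∈ Set.uIcc p r, γ x ∈ V := by rwa [Set.uIcc_of_le hpr]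
  have ig : IntervalIntegrable (fun x => g (γ x)) MeasureTheory.volume p r :=
    (hg.comp hγ.continuousOn hV').intervalIntegrable
  have ih : IntervalIntegrable (fun x => h (γ x)) MeasureTheory.volume p r :=
    (hh.comp hγ.continuousOn hV').intervalIntegrable
  have heq : Set.EqOn (fun x => f (γ x)) (fun x => g (γ x) + h (γ x)) (Set.uIcc p r) :=
    fun x hx => hf _ (hV' x hx)
  refine ⟨(ig.add ih).congr fun x hx => (heq (Set.uIoc_subset_uIcc hx)).symm, ?_⟩
  rw [intervalIntegral.integral_congr heq, intervalIntegral.integral_add ig ih]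

section
variable {q : ℕ}

lemma gammaTerm_inv (χ : DirichletCharacter ℂ q) : gammaTerm χ⁻¹ = gammaTerm χ := by
  ext s
  rw [gammaTerm, gammaTerm, parityIndex_inv]

lemma poleTerm_one_sub (s : ℂ) : poleTerm q (1 - s) = -poleTerm q s := by
  have h1 : 1 - s = -(s - 1) := by ring
  have h2 : 1 - s - 1 = -s := by ring
  rw [poleTerm, poleTerm, h2, h1]
  simp only [one_div, inv_neg]
  ring

lemma differentiableAt_gammaTerm (χ : DirichletCharacter ℂ q) {s : ℂ} (hs : 0 < s.re) :
    DifferentiableAt ℂ (gammaTerm χ) s := by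
  have hre : 0 < ((s + parityIndex χ) / 2).re := by
    have := parityIndex_re_nonneg χ
    rw [Complex.div_ofNat_re, Complex.add_re]
    linarith
  have h : DifferentiableAt ℂ (fun s => Complex.digamma ((s + parityIndex χ) / 2)) s :=
    (differentiableAt_digamma hre).comp s (f := fun s => (s + parityIndex χ) / 2) (by fun_prop)
  exact (h.const_mul (1 / 2)).const_add _

lemma rectIntegral_poleTerm_mul {F : ℂ → ℂ} {U : Set ℂ} (hU : IsOpen U)
    (hF : DifferentiableOn ℂ F U) {a T : ℝ} (ha : 0 < a) (hT : 0 < T)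
    (hR : Set.Icc (-a) (1 + a) ×ℂ Set.Icc (-T) T ⊆ U) :
    ContinuousOn (fun s => poleTerm q s * F s) (rectBoundary (-a) (1 + a) (-T) T) ∧
    rectIntegral (fun s => poleTerm q s * F s) (-a) (1 + a) (-T) T =
      2 * Real.pi * Complex.I * (deltaOne q * (F 0 + F 1)) := by
  have hab : -a ≤ 1 + a := by linarith
  have hcd : -T ≤ T := by linarith
  have hFc := hF.continuousOn.mono ((rectBoundary_subset hab hcd).trans hR)
  have hne : ∀ r : ℝ, 0 ≤ r → r ≤ 1 → ∀ z ∈ rectBoundary (-a) (1 + a) (-T) T, z - (r : ℂ) ≠ 0 := by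
    rintro r hr0 hr1 z hz h
    rw [sub_eq_zero.1 h] at hz
    rcases hz with ⟨-, h | h⟩ | ⟨-, h | h⟩ <;> simp at h <;> linarith
  have hc : ∀ r : ℝ, 0 ≤ r → r ≤ 1 → ContinuousOn (fun s => F s / (s - (r : ℂ)))
      (rectBoundary (-a) (1 + a) (-T) T) := fun r h0 h1 => hFc.div (by fun_prop) (hne r h0 h1)
  have hi : ∀ r : ℝ, 0 ≤ r → r ≤ 1 → rectIntegral (fun s => F s / (s - (r : ℂ)))
      (-a) (1 + a) (-T) T = 2 * Real.pi * Complex.I * F r := fun r h0 h1 =>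
    rectIntegral_div_sub hU hR hF (by simp; linarith) (by simp; linarith) (by simpa using hT)
      (by simpa using hT)
  have heq : (fun s => poleTerm q s * F s) = fun s => deltaOne q *
      (F s / (s - ((0 : ℝ) : ℂ)) + F s / (s - ((1 : ℝ) : ℂ))) := by
    ext s
    rw [poleTerm, Complex.ofReal_zero, Complex.ofReal_one, sub_zero]
    ring
  have h0 := hc 0 le_rfl zero_le_one
  have h1 := hc 1 zero_le_one le_rfl
  rw [heq]
  refine ⟨continuousOn_const.mul (h0.add h1), ?_⟩
  rw [rectIntegral_const_mul, rectIntegral_add hab hcd h0 h1, hi 0 le_rfl zero_le_one,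
    hi 1 zero_le_one le_rfl, Complex.ofReal_zero, Complex.ofReal_one]
  ring

variable [NeZero q]

lemma xiFunction_logDeriv_sub_poleTerm (χ : DirichletCharacter ℂ q) {s : ℂ} (hs : 0 < s.re)
    (hs1 : s ≠ 1) (hL : χ.LFunction s ≠ 0) :
    deriv (xiFunction χ) s / xiFunction χ s - poleTerm q s =
      gammaTerm χ s + deriv χ.LFunction s / χ.LFunction s := by
  rw [logDeriv_xiFunction χ hs hs1 hL]
  ring

lemma xiFunction_logDeriv_sub_poleTerm' {χ : DirichletCharacter ℂ q} (hχ : χ.IsPrimitive) {s : ℂ}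
    (hs : s.re < 1) (hs0 : s ≠ 0) (hL : χ⁻¹.LFunction (1 - s) ≠ 0) :
    deriv (xiFunction χ) s / xiFunction χ s - poleTerm q s =
      -(gammaTerm χ (1 - s) + deriv χ⁻¹.LFunction (1 - s) / χ⁻¹.LFunction (1 - s)) := by
  have h1 := logDeriv_xiFunction_one_sub hχ (1 - s)
  rw [sub_sub_cancel, logDeriv_xiFunction χ⁻¹ (by simpa using hs) (by simpa using hs0) hL,
    poleTerm_one_sub, gammaTerm_inv] at h1
  rw [h1]
  ring

lemma im_abs_lt_of_goodHeight {χ : DirichletCharacter ℂ q} (hχ : χ.IsPrimitive) {T B : ℝ}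
    (g₁ : GoodHeight χ B T) (g₂ : GoodHeight χ⁻¹ B T) {ρ : ℂ} (hρ : ρ ∈ zerosUpTo χ T) :
    |ρ.im| < T := by
  refine lt_of_le_of_ne hρ.2 fun h => ?_
  rcases le_total (1 / 2) ρ.re with hre | hre
  · have := (g₁ ρ.im h ρ.re hre (by linarith [hρ.1.2.1])).1
    rw [Complex.re_add_im] at this
    exact this hρ.1.2.2
  · have h1 := one_sub_mem_nontrivialZeros hχ hρ.1
    have := (g₂ (1 - ρ).im (by simpa using h) (1 - ρ).re
      (by rw [Complex.sub_re, Complex.one_re]; linarith)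
      (by rw [Complex.sub_re, Complex.one_re]; linarith [hρ.1.1])).1
    rw [Complex.re_add_im] at this
    exact this h1.2.2

/-- The contribution of the horizontal side at height `y`. -/
def horizontalTerm (χ : DirichletCharacter ℂ q) (F : ℂ → ℂ) (a y : ℝ) : ℂ :=
  (∫ x : ℝ in (1 / 2)..(1 + a), deriv χ.LFunction (x + y * Complex.I) /
      χ.LFunction (x + y * Complex.I) * F (x + y * Complex.I)) -
    ∫ x : ℝ in (-a)..(1 / 2), deriv χ⁻¹.LFunction (1 - (x + y * Complex.I)) /
      χ⁻¹.LFunction (1 - (x + y * Complex.I)) * F (x + y * Complex.I)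

/-- The integral of `ξ'/ξ · F` over the boundary of `[-a, 1 + a] × [-T, T]`, in which the integrals
of the Gamma factors have been moved to the critical line. -/
theorem contour_identity {χ : DirichletCharacter ℂ q} (hχ : χ.IsPrimitive) {F : ℂ → ℂ} {a b : ℝ}
    (hF : DifferentiableOn ℂ F {s | -b < s.re ∧ s.re < 1 + b}) (ha : 0 < a) (hab : a < b)
    (ha2 : a ≤ 1 / 2) {T B : ℝ} (hT : 0 < T) (g₁ : GoodHeight χ B T) (g₂ : GoodHeight χ⁻¹ B T)
    (Z : Finset ℂ) (hZ : ∀ ρ, ρ ∈ Z ↔ ρ ∈ zerosUpTo χ T) :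
    2 * Real.pi * Complex.I * ∑ ρ ∈ Z, (analyticOrderNatAt χ.LFunction ρ : ℂ) * F ρ =
      2 * Real.pi * Complex.I * (deltaOne q * (F 0 + F 1)) +
      Complex.I * ((∫ t : ℝ in -T..T, gammaTerm χ ((1 / 2 : ℝ) + t * Complex.I) *
          F ((1 / 2 : ℝ) + t * Complex.I)) +
        ∫ t : ℝ in -T..T, gammaTerm χ (1 - ((1 / 2 : ℝ) + t * Complex.I)) *
          F ((1 / 2 : ℝ) + t * Complex.I)) +
      Complex.I * (∫ t : ℝ in -T..T, deriv χ.LFunction ((1 + a : ℝ) + t * Complex.I) /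
        χ.LFunction ((1 + a : ℝ) + t * Complex.I) * F ((1 + a : ℝ) + t * Complex.I)) +
      Complex.I * (∫ t : ℝ in -T..T, deriv χ⁻¹.LFunction (1 - ((-a : ℝ) + t * Complex.I)) /
        χ⁻¹.LFunction (1 - ((-a : ℝ) + t * Complex.I)) * F ((-a : ℝ) + t * Complex.I)) +
      (horizontalTerm χ F a (-T) - horizontalTerm χ F a T) := by
  set U : Set ℂ := {s | -b < s.re ∧ s.re < 1 + b} with hU
  have hUo : IsOpen U := (isOpen_lt continuous_const Complex.continuous_re).inter
    (isOpen_lt Complex.continuous_re continuous_const)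
  have hle : -a ≤ 1 + a := by linarith
  have hle1 : -a ≤ 1 / 2 := by linarith
  have hle2 : 1 / 2 ≤ 1 + a := by linarith
  have hTT : -T ≤ T := by linarith
  have hR : Set.Icc (-a) (1 + a) ×ℂ Set.Icc (-T) T ⊆ U := fun z hz => by
    have := (Complex.mem_reProdIm.1 hz).1
    exact ⟨by linarith [this.1], by linarith [this.2]⟩
  set M : ℂ → ℂ := fun s => deriv (xiFunction χ) s / xiFunction χ s - poleTerm q s with hM
  have hxi := differentiable_xiFunction hχ
  -- the argument principle
  have hzero : ∀ z ∈ Set.Icc (-a) (1 + a) ×ℂ Set.Icc (-T) T, xiFunction χ z = 0 ↔ z ∈ Z :=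
    fun z hz => by
      rw [xiFunction_eq_zero_iff hχ, hZ]
      exact ⟨fun h => ⟨h, abs_le.2 (Complex.mem_reProdIm.1 hz).2⟩, fun h => h.1⟩
  have hint : ∀ ρ ∈ Z, -a < ρ.re ∧ ρ.re < 1 + a ∧ -T < ρ.im ∧ ρ.im < T := fun ρ hρ => by
    have h1 := (hZ ρ).1 hρ
    have h2 := abs_lt.1 (im_abs_lt_of_goodHeight hχ g₁ g₂ h1)
    exact ⟨by linarith [h1.1.1], by linarith [h1.1.2.1], h2.1, h2.2⟩
  have harg := rectIntegral_logDeriv_mul hUo hle hTT hR (hxi.differentiableOn (s := U)) hF Z hzero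
    (fun ρ _ => analyticOrderAt_xiFunction_ne_top hχ ρ) hint
  have hord : ∑ ρ ∈ Z, (analyticOrderNatAt (xiFunction χ) ρ : ℂ) * F ρ =
      ∑ ρ ∈ Z, (analyticOrderNatAt χ.LFunction ρ : ℂ) * F ρ := by
    refine Finset.sum_congr rfl fun ρ hρ => ?_
    have h1 := ((hZ ρ).1 hρ).1
    have h2 : ρ ≠ 1 := by
      rintro rfl
      simpa using h1.2.1
    rw [analyticOrderNatAt, analyticOrderNatAt, analyticOrderAt_xiFunction χ h1.1 h2]
  obtain ⟨hpc, hpi⟩ := rectIntegral_poleTerm_mul (q := q) hUo hF ha hT hR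
  have hbd := rectBoundary_subset hle hTT
  have hxic : ContinuousOn (fun s => deriv (xiFunction χ) s / xiFunction χ s * F s)
      (rectBoundary (-a) (1 + a) (-T) T) := by
    refine ContinuousOn.mul (ContinuousOn.div ?_ hxi.continuous.continuousOn fun z hz h0 => ?_)
      (hF.continuousOn.mono (hbd.trans hR))
    · exact (hxi.contDiff.continuous_deriv (n := 1) le_rfl).continuousOn
    · obtain ⟨h1, h2, h3, h4⟩ := hint z ((hzero z (hbd hz)).1 h0)
      rcases hz with ⟨-, h | h⟩ | ⟨-, h | h⟩ <;> linarith
  have hMc : ContinuousOn (fun s => M s * F s) (rectBoundary (-a) (1 + a) (-T) T) := by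
    refine (hxic.sub hpc).congr fun s _ => ?_
    simp only [hM, Pi.sub_apply]
    ring
  have hsplit : rectIntegral (fun s => deriv (xiFunction χ) s / xiFunction χ s * F s)
      (-a) (1 + a) (-T) T = rectIntegral (fun s => poleTerm q s * F s) (-a) (1 + a) (-T) T +
        rectIntegral (fun s => M s * F s) (-a) (1 + a) (-T) T := by
    rw [← rectIntegral_add hle hTT hpc hMc]
    congr 1
    ext s
    simp only [hM]
    ring
  -- the two formulas for the logarithmic derivative
  set V₁ : Set ℂ := U ∩ {s | 0 < s.re ∧ s ≠ 1 ∧ χ.LFunction s ≠ 0} with hV₁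
  set V₂ : Set ℂ := U ∩ {s | s.re < 1 ∧ s ≠ 0 ∧ χ⁻¹.LFunction (1 - s) ≠ 0} with hV₂
  have hLd : ∀ ψ : DirichletCharacter ℂ q,
      ContinuousOn (fun s => deriv ψ.LFunction s / ψ.LFunction s) {s | s ≠ 1 ∧ ψ.LFunction s ≠ 0} :=
    fun ψ => by
      have h1 : DifferentiableOn ℂ ψ.LFunction {s | s ≠ 1} := fun s hs =>
        (ψ.differentiableAt_LFunction s (Or.inl hs)).differentiableWithinAt
      exact ((h1.deriv isOpen_ne).continuousOn.mono fun s hs => hs.1).div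
        (h1.continuousOn.mono fun s hs => hs.1) fun s hs => hs.2
  have hG : DifferentiableOn ℂ (gammaTerm χ) {s | 0 < s.re} := fun s hs =>
    (differentiableAt_gammaTerm χ hs).differentiableWithinAt
  have hG' : DifferentiableOn ℂ (fun s => gammaTerm χ (1 - s)) {s | s.re < 1} :=
    hG.comp (f := fun s : ℂ => 1 - s) (by fun_prop) fun s hs => by
      have : s.re < 1 := hs
      simpa using this
  have cG₁ : ContinuousOn (fun s => gammaTerm χ s * F s) V₁ :=
    (hG.continuousOn.mono fun s hs => hs.2.1).mul (hF.continuousOn.mono fun s hs => hs.1)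
  have cL₁ : ContinuousOn (fun s => deriv χ.LFunction s / χ.LFunction s * F s) V₁ :=
    ((hLd χ).mono fun s hs => hs.2.2).mul (hF.continuousOn.mono fun s hs => hs.1)
  have cG₂ : ContinuousOn (fun s => -(gammaTerm χ (1 - s) * F s)) V₂ :=
    ((hG'.continuousOn.mono fun s hs => hs.2.1).mul (hF.continuousOn.mono fun s hs => hs.1)).neg
  have cL₂ : ContinuousOn
      (fun s => -(deriv χ⁻¹.LFunction (1 - s) / χ⁻¹.LFunction (1 - s) * F s)) V₂ :=
    (((hLd χ⁻¹).comp (f := fun s : ℂ => 1 - s) (by fun_prop) fun s hs =>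
      ⟨by simpa using hs.2.2.1, hs.2.2.2⟩).mul (hF.continuousOn.mono fun s hs => hs.1)).neg
  have e₁ : ∀ s ∈ V₁, M s * F s =
      gammaTerm χ s * F s + deriv χ.LFunction s / χ.LFunction s * F s := fun s hs => by
    rw [hM]
    simp only
    rw [xiFunction_logDeriv_sub_poleTerm χ hs.2.1 hs.2.2.1 hs.2.2.2]
    ring
  have e₂ : ∀ s ∈ V₂, M s * F s = -(gammaTerm χ (1 - s) * F s) +
      -(deriv χ⁻¹.LFunction (1 - s) / χ⁻¹.LFunction (1 - s) * F s) := fun s hs => by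
    rw [hM]
    simp only
    rw [xiFunction_logDeriv_sub_poleTerm' hχ hs.2.1 hs.2.2.1 hs.2.2.2]
    ring
  -- the sides of the rectangle
  have hv : ∀ x : ℝ, Continuous fun t : ℝ => (x + t * Complex.I : ℂ) := fun x => by fun_prop
  have hh : ∀ y : ℝ, Continuous fun x : ℝ => (x + y * Complex.I : ℂ) := fun y => by fun_prop
  have hright : ∀ t ∈ Set.Icc (-T) T, ((1 + a : ℝ) + t * Complex.I : ℂ) ∈ V₁ := fun t _ => by
    have hre : ((1 + a : ℝ) + t * Complex.I : ℂ).re = 1 + a := by simp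
    have hne : ((1 + a : ℝ) + t * Complex.I : ℂ) ≠ 1 := fun h => by
      rw [h, Complex.one_re] at hre
      linarith
    refine ⟨⟨by rw [hre]; linarith, by rw [hre]; linarith⟩, by rw [hre]; linarith, hne,
      DirichletCharacter.LFunction_ne_zero_of_one_le_re χ (Or.inr hne) (by rw [hre]; linarith)⟩
  have hleft : ∀ t ∈ Set.Icc (-T) T, ((-a : ℝ) + t * Complex.I : ℂ) ∈ V₂ := fun t _ => by
    have hre : ((-a : ℝ) + t * Complex.I : ℂ).re = -a := by simp
    have hne : ((-a : ℝ) + t * Complex.I : ℂ) ≠ 0 := fun h => by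
      rw [h, Complex.zero_re] at hre
      linarith
    refine ⟨⟨by rw [hre]; linarith, by rw [hre]; linarith⟩, by rw [hre]; linarith, hne,
      DirichletCharacter.LFunction_ne_zero_of_one_le_re χ⁻¹ (Or.inr (by simpa using hne)) ?_⟩
    rw [Complex.sub_re, hre, Complex.one_re]
    linarith
  have him : ∀ x y : ℝ, (x + y * Complex.I : ℂ).im = y := fun x y => by simp
  have hhor₁ : ∀ y : ℝ, |y| = T → ∀ x ∈ Set.Icc (1 / 2) (1 + a), (x + y * Complex.I : ℂ) ∈ V₁ :=
    fun y hy x hx => by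
      have hre : (x + y * Complex.I : ℂ).re = x := by simp
      refine ⟨⟨by rw [hre]; linarith [hx.1], by rw [hre]; linarith [hx.2]⟩,
        by rw [hre]; linarith [hx.1], fun h => ?_, (g₁ y hy x hx.1 (by linarith [hx.2])).1⟩
      have := him x y
      rw [h, Complex.one_im] at this
      rw [← this, abs_zero] at hy
      linarith
  have hhor₂ : ∀ y : ℝ, |y| = T → ∀ x ∈ Set.Icc (-a) (1 / 2), (x + y * Complex.I : ℂ) ∈ V₂ :=
    fun y hy x hx => by
      have hre : (x + y * Complex.I : ℂ).re = x := by simp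
      refine ⟨⟨by rw [hre]; linarith [hx.1], by rw [hre]; linarith [hx.2]⟩,
        by rw [hre]; linarith [hx.2], fun h => ?_, ?_⟩
      · have := him x y
        rw [h, Complex.zero_im] at this
        rw [← this, abs_zero] at hy
        linarith
      · have := (g₂ (-y) (by rwa [abs_neg]) (1 - x) (by linarith [hx.2]) (by linarith [hx.1])).1
        convert this using 2
        push_cast
        ring
  have hor : ∀ y : ℝ, |y| = T → ∫ x : ℝ in (-a)..(1 + a), M (x + y * Complex.I) *
      F (x + y * Complex.I) = horizontalTerm χ F a y +
        (∫ x : ℝ in (1 / 2)..(1 + a), gammaTerm χ (x + y * Complex.I) * F (x + y * Complex.I)) -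
        ∫ x : ℝ in (-a)..(1 / 2), gammaTerm χ (1 - (x + y * Complex.I)) * F (x + y * Complex.I) :=
    fun y hy => by
      obtain ⟨i₁, h₁⟩ := integral_comp_path_eq_add cG₁ cL₁ e₁ (hh y) hle2 (hhor₁ y hy)
      obtain ⟨i₂, h₂⟩ := integral_comp_path_eq_add cG₂ cL₂ e₂ (hh y) hle1 (hhor₂ y hy)
      rw [← intervalIntegral.integral_add_adjacent_intervals i₂ i₁, h₁, h₂, horizontalTerm]
      simp only [intervalIntegral.integral_neg]
      ring
  obtain ⟨-, hr⟩ := integral_comp_path_eq_add cG₁ cL₁ e₁ (hv (1 + a)) hTT hright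
  obtain ⟨-, hl⟩ := integral_comp_path_eq_add cG₂ cL₂ e₂ (hv (-a)) hTT hleft
  simp only [intervalIntegral.integral_neg] at hl
  -- moving the Gamma factors to the critical line
  have c₁ : rectIntegral (fun s => gammaTerm χ s * F s) (1 / 2) (1 + a) (-T) T = 0 := by
    refine rectIntegral_eq_zero hle2 hTT ((hG.mono fun z hz => ?_).mul (hF.mono fun z hz => hR ?_))
    · have := (Complex.mem_reProdIm.1 hz).1.1
      show 0 < z.re
      linarith
    · obtain ⟨h1, h2⟩ := Complex.mem_reProdIm.1 hz
      exact Complex.mem_reProdIm.2 ⟨⟨by linarith [h1.1], h1.2⟩, h2⟩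
  have c₂ : rectIntegral (fun s => gammaTerm χ (1 - s) * F s) (-a) (1 / 2) (-T) T = 0 := by
    refine rectIntegral_eq_zero hle1 hTT ((hG'.mono fun z hz => ?_).mul (hF.mono fun z hz => hR ?_))
    · have := (Complex.mem_reProdIm.1 hz).1.2
      show z.re < 1
      linarith
    · obtain ⟨h1, h2⟩ := Complex.mem_reProdIm.1 hz
      exact Complex.mem_reProdIm.2 ⟨⟨h1.1, by linarith [h1.2]⟩, h2⟩
  rw [← hord, ← harg, hsplit, hpi]
  have hbot := hor (-T) (by rw [abs_neg, abs_of_pos hT])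
  have htop := hor T (abs_of_pos hT)
  unfold rectIntegral at c₁ c₂ ⊢
  rw [hbot, htop, hr, hl]
  linear_combination c₁ - c₂

end

/-! ### The Gamma factors on the critical line -/

lemma digamma_conj (s : ℂ) :
    Complex.digamma (starRingEnd ℂ s) = starRingEnd ℂ (Complex.digamma s) := by
  have h1 : (starRingEnd ℂ) ∘ Complex.Gamma ∘ (starRingEnd ℂ) = Complex.Gamma := by
    ext z
    simp [Complex.Gamma_conj]
  have h2 := congrFun (deriv_conj_conj (f := Complex.Gamma)) s
  rw [h1] at h2
  simp only [Function.comp_apply] at h2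
  rw [Complex.digamma_def, logDeriv_apply, logDeriv_apply, Complex.Gamma_conj, h2, map_div₀,
    Complex.conj_conj]

section
variable {q : ℕ}

lemma gammaTerm_add_gammaTerm_one_sub (χ : DirichletCharacter ℂ q) (t : ℝ) :
    gammaTerm χ ((1 / 2 : ℝ) + t * Complex.I) + gammaTerm χ (1 - ((1 / 2 : ℝ) + t * Complex.I)) =
      (Real.log (q / Real.pi) : ℂ) +
        ((Complex.digamma ((1 / 2 + t * Complex.I + parityIndex χ) / 2)).re : ℂ) := by
  set w : ℂ := (1 / 2 + t * Complex.I + parityIndex χ) / 2 with hw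
  have hpar : starRingEnd ℂ (parityIndex χ) = parityIndex χ := by
    rcases parityIndex_eq χ with h | h <;> simp [h]
  have h1 : ((1 / 2 : ℝ) + t * Complex.I + parityIndex χ) / 2 = w := by
    rw [hw]
    push_cast
    ring
  have h2 : (1 - ((1 / 2 : ℝ) + t * Complex.I) + parityIndex χ) / 2 = starRingEnd ℂ w := by
    rw [hw]
    simp only [map_div₀, map_add, map_mul, Complex.conj_I, Complex.conj_ofReal, hpar, map_one,
      map_ofNat]
    push_cast
    ring
  rw [gammaTerm, gammaTerm, h1, h2, digamma_conj, Complex.re_eq_add_conj]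
  ring

lemma parityArgument_eq (χ : DirichletCharacter ℂ q) (t : ℝ) :
    ((1 / 2 + t * Complex.I + parityIndex χ) / 2 : ℂ) =
      (((1 / 2 + (parityIndex χ).re) / 2 : ℝ) : ℂ) + ((t / 2 : ℝ) : ℂ) * Complex.I := by
  rcases parityIndex_eq χ with h | h <;> rw [h] <;> push_cast <;> simp <;> ring

lemma gammaIntegral_eq (χ : DirichletCharacter ℂ q) (φ : ℝ → ℂ) (T : ℝ) :
    gammaIntegral χ φ T = 1 / (2 * Real.pi) * ∫ t : ℝ in -T..T,
      ((Complex.digamma ((1 / 2 + t * Complex.I + parityIndex χ) / 2)).re : ℂ) *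
        laplaceTransform φ (-(1 / 2 + t * Complex.I)) := by
  rw [gammaIntegral, intervalIntegral.integral_mul_const]
  have := Complex.I_ne_zero
  have hpi : (Real.pi : ℂ) ≠ 0 := by exact_mod_cast Real.pi_ne_zero
  field_simp

/-- The sum of the two Gamma integrals on the critical line. -/
lemma integral_gammaTerm_add (χ : DirichletCharacter ℂ q) {F : ℂ → ℂ}
    (hF : Continuous fun t : ℝ => F ((1 / 2 : ℝ) + t * Complex.I)) (T : ℝ) :
    (∫ t : ℝ in -T..T, gammaTerm χ ((1 / 2 : ℝ) + t * Complex.I) *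
          F ((1 / 2 : ℝ) + t * Complex.I)) +
        (∫ t : ℝ in -T..T, gammaTerm χ (1 - ((1 / 2 : ℝ) + t * Complex.I)) *
          F ((1 / 2 : ℝ) + t * Complex.I)) =
      (Real.log (q / Real.pi) : ℂ) * (∫ t : ℝ in -T..T, F ((1 / 2 : ℝ) + t * Complex.I)) +
        ∫ t : ℝ in -T..T,
          ((Complex.digamma ((1 / 2 + t * Complex.I + parityIndex χ) / 2)).re : ℂ) *
            F ((1 / 2 : ℝ) + t * Complex.I) := by
  have hg : ContinuousOn (gammaTerm χ) {s | 0 < s.re} := fun s hs =>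
    (differentiableAt_gammaTerm χ hs).continuousAt.continuousWithinAt
  have hg1 : Continuous fun t : ℝ => gammaTerm χ ((1 / 2 : ℝ) + t * Complex.I) :=
    hg.comp_continuous (by fun_prop) fun t => by simp
  have hg2 : Continuous fun t : ℝ => gammaTerm χ (1 - ((1 / 2 : ℝ) + t * Complex.I)) :=
    hg.comp_continuous (by fun_prop) fun t => by simp; norm_num
  have hd : Continuous fun t : ℝ =>
      ((Complex.digamma ((1 / 2 + t * Complex.I + parityIndex χ) / 2)).re : ℂ) := by
    have : (fun t : ℝ =>
        ((Complex.digamma ((1 / 2 + t * Complex.I + parityIndex χ) / 2)).re : ℂ)) = fun t : ℝ =>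
        gammaTerm χ ((1 / 2 : ℝ) + t * Complex.I) +
          gammaTerm χ (1 - ((1 / 2 : ℝ) + t * Complex.I)) - (Real.log (q / Real.pi) : ℂ) := by
      ext t
      rw [gammaTerm_add_gammaTerm_one_sub]
      ring
    rw [this]
    fun_prop
  rw [← intervalIntegral.integral_const_mul, ← intervalIntegral.integral_add
      ((hg1.fun_mul hF).intervalIntegrable _ _) ((hg2.fun_mul hF).intervalIntegrable _ _),
    ← intervalIntegral.integral_add ((continuous_const.fun_mul hF).intervalIntegrable _ _)
      ((hd.fun_mul hF).intervalIntegrable _ _)]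
  refine intervalIntegral.integral_congr fun t _ => ?_
  rw [← add_mul, ← add_mul, gammaTerm_add_gammaTerm_one_sub]

end

/-! ### Truncated sums over zeros -/

section
variable {q : ℕ} [NeZero q] {χ : DirichletCharacter ℂ q}

lemma finite_zerosUpTo (hχ : χ.IsPrimitive) (T : ℝ) : (zerosUpTo χ T).Finite := by
  have hK : IsCompact (Set.Icc (0 : ℝ) 1 ×ℂ Set.Icc (-T) T) := isCompact_Icc.reProdIm isCompact_Icc
  refine (finite_zeros_of_isCompact hK
    (fun z _ => (differentiable_xiFunction hχ).analyticAt z)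
    fun z _ => analyticOrderAt_xiFunction_ne_top hχ z).subset fun ρ hρ => ⟨?_, ?_⟩
  · exact Complex.mem_reProdIm.2 ⟨⟨hρ.1.1.le, hρ.1.2.1.le⟩, abs_le.1 hρ.2⟩
  · exact (xiFunction_eq_zero_iff hχ ρ).2 hρ.1

lemma sumOverZerosUpTo_eq (hχ : χ.IsPrimitive) (f : ℂ → ℂ) (T : ℝ) :
    sumOverZerosUpTo χ f T =
      ∑ ρ ∈ (finite_zerosUpTo hχ T).toFinset, (analyticOrderNatAt χ.LFunction ρ : ℂ) * f ρ :=
  finsum_mem_eq_finite_toFinset_sum _ (finite_zerosUpTo hχ T)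

/-- Passing to a good height changes the sum over zeros by little. -/
lemma norm_sumOverZerosUpTo_sub_le (hχ : χ.IsPrimitive) {f : ℂ → ℂ} {A K T T' : ℝ} (hT : 0 < T)
    (hTT' : T' ∈ Set.Icc T (T + 1 / 2)) (hA : 0 ≤ A)
    (hf : ∀ ρ ∈ nontrivialZeros χ, ‖f ρ‖ * |ρ.im| ≤ A)
    (hK : ∀ Y : Finset ℂ, (∀ ρ ∈ Y, ρ ∈ nontrivialZeros χ ∧ T ≤ |ρ.im| ∧ |ρ.im| ≤ T + 1 / 2) →
        (∑ ρ ∈ Y, (analyticOrderNatAt χ.LFunction ρ : ℝ)) ≤ K) :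
    ‖sumOverZerosUpTo χ f T' - sumOverZerosUpTo χ f T‖ ≤ K * (A / T) := by
  classical
  have hsub : (finite_zerosUpTo hχ T).toFinset ⊆ (finite_zerosUpTo hχ T').toFinset := by
    intro ρ hρ
    rw [Set.Finite.mem_toFinset] at hρ ⊢
    exact ⟨hρ.1, hρ.2.trans hTT'.1⟩
  rw [sumOverZerosUpTo_eq hχ, sumOverZerosUpTo_eq hχ, ← Finset.sum_sdiff hsub, add_sub_cancel_right]
  have hY : ∀ ρ ∈ (finite_zerosUpTo hχ T').toFinset \ (finite_zerosUpTo hχ T).toFinset,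
      ρ ∈ nontrivialZeros χ ∧ T ≤ |ρ.im| ∧ |ρ.im| ≤ T + 1 / 2 := fun ρ hρ => by
    rw [Finset.mem_sdiff, Set.Finite.mem_toFinset, Set.Finite.mem_toFinset] at hρ
    refine ⟨hρ.1.1, ?_, hρ.1.2.trans hTT'.2⟩
    by_contra h
    exact hρ.2 ⟨hρ.1.1, (not_le.1 h).le⟩
  refine (norm_sum_le _ _).trans (le_trans (Finset.sum_le_sum (g := fun ρ =>
    (analyticOrderNatAt χ.LFunction ρ : ℝ) * (A / T)) fun ρ hρ => ?_) ?_)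
  · obtain ⟨h1, h2, -⟩ := hY ρ hρ
    rw [norm_mul, Complex.norm_natCast]
    gcongr
    rw [le_div_iff₀ hT]
    exact (by gcongr : ‖f ρ‖ * T ≤ ‖f ρ‖ * |ρ.im|).trans (hf ρ h1)
  · rw [← Finset.sum_mul]
    gcongr
    exact hK _ hY

/-- The horizontal sides contribute little at a good height. -/
lemma norm_horizontalTerm_le {F : ℂ → ℂ} {a A B T y : ℝ} (ha : 0 < a) (ha2 : a ≤ 1 / 2)
    (hT : 0 < T) (hy : |y| = T) (hB : 0 ≤ B) (g₁ : GoodHeight χ B T) (g₂ : GoodHeight χ⁻¹ B T)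
    (hF : ∀ s : ℂ, -a ≤ s.re → s.re ≤ 1 + a → ‖F s‖ * |s.im| ≤ A) :
    ‖horizontalTerm χ F a y‖ ≤ 2 * (B * (A / T)) := by
  have hFb : ∀ x : ℝ, -a ≤ x → x ≤ 1 + a → ‖F (x + y * Complex.I)‖ ≤ A / T := fun x h1 h2 => by
    have := hF (x + y * Complex.I) (by simpa using h1) (by simpa using h2)
    rw [le_div_iff₀ hT, ← hy]
    simpa using this
  have hA0 : 0 ≤ A / T := (norm_nonneg _).trans (hFb 0 (by linarith) (by linarith))
  have h1 : ‖∫ x : ℝ in (1 / 2)..(1 + a), deriv χ.LFunction (x + y * Complex.I) /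
      χ.LFunction (x + y * Complex.I) * F (x + y * Complex.I)‖ ≤
      B * (A / T) * |1 + a - 1 / 2| := by
    refine intervalIntegral.norm_integral_le_of_norm_le_const fun x hx => ?_
    rw [Set.uIoc_of_le (by linarith)] at hx
    rw [norm_mul]
    exact mul_le_mul (g₁ y hy x hx.1.le (by linarith [hx.2])).2
      (hFb x (by linarith [hx.1]) hx.2) (norm_nonneg _) hB
  have h2 : ‖∫ x : ℝ in (-a)..(1 / 2), deriv χ⁻¹.LFunction (1 - (x + y * Complex.I)) /
      χ⁻¹.LFunction (1 - (x + y * Complex.I)) * F (x + y * Complex.I)‖ ≤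
      B * (A / T) * |1 / 2 - -a| := by
    refine intervalIntegral.norm_integral_le_of_norm_le_const fun x hx => ?_
    rw [Set.uIoc_of_le (by linarith)] at hx
    rw [norm_mul]
    have h3 := (g₂ (-y) (by rwa [abs_neg]) (1 - x) (by linarith [hx.2]) (by linarith [hx.1])).2
    have h4 : (((1 - x : ℝ) : ℂ) + ((-y : ℝ) : ℂ) * Complex.I) = 1 - (x + y * Complex.I) := by
      push_cast
      ring
    rw [h4] at h3
    exact mul_le_mul h3 (hFb x hx.1.le (by linarith [hx.2])) (norm_nonneg _) hB
  have hBA : 0 ≤ B * (A / T) := mul_nonneg hB hA0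
  have h5 : |1 + a - 1 / 2| ≤ 1 := by rw [abs_le]; constructor <;> linarith
  have h6 : |1 / 2 - -a| ≤ 1 := by rw [abs_le]; constructor <;> linarith
  have h7 := mul_le_mul_of_nonneg_left h5 hBA
  have h8 := mul_le_mul_of_nonneg_left h6 hBA
  rw [horizontalTerm]
  refine (norm_sub_le _ _).trans ?_
  linarith

end

/-! ### The explicit formula -/

lemma tendsto_log_pow_div_atTop (n : ℕ) : Tendsto (fun T : ℝ => Real.log T ^ n / T) atTop (𝓝 0) :=
  Real.isLittleO_pow_log_id_atTop.tendsto_div_nhds_zero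

/-- The explicit formula for a test function with uniform bounds in place of `O`-conditions, the
conjugate character being written `χ⁻¹`. -/
theorem explicit_formula {q : ℕ} [NeZero q] {χ : DirichletCharacter ℂ q} (hχ : χ.IsPrimitive)
    {φ : ℝ → ℂ} {b : ℝ} (hb : 0 < b) {S : Finset ℝ} {C : ℝ} (hS : StripDecay S b C φ) :
    Summable (fun n : ℕ => (ArithmeticFunction.vonMangoldt n : ℂ) * χ n * φ (Real.log n)) ∧
    Summable (fun n : ℕ =>
      (ArithmeticFunction.vonMangoldt n : ℂ) * χ⁻¹ n / n * φ (-Real.log n)) ∧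
    ∃ Z J : ℂ,
      Tendsto (sumOverZerosUpTo χ (fun ρ => laplaceTransform φ (-ρ))) atTop (𝓝 Z) ∧
      Tendsto (gammaIntegral χ φ) atTop (𝓝 J) ∧
      Z = deltaOne q * (laplaceTransform φ (-0) + laplaceTransform φ (-1)) +
        ((Real.log (q / Real.pi) : ℂ) * φ 0 + J) -
        (∑' n : ℕ, (ArithmeticFunction.vonMangoldt n : ℂ) * χ n * φ (Real.log n)) -
        ∑' n : ℕ, (ArithmeticFunction.vonMangoldt n : ℂ) * χ⁻¹ n / n * φ (-Real.log n) := by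
  obtain ⟨a, ha, hab, ha2⟩ : ∃ a : ℝ, 0 < a ∧ a < b ∧ a ≤ 1 / 2 := by
    refine ⟨min b 1 / 2, by positivity, ?_, ?_⟩
    · linarith [min_le_left b 1]
    · linarith [min_le_right b 1]
  set F : ℂ → ℂ := fun s => laplaceTransform φ (-s) with hF
  have hpi : (Real.pi : ℂ) ≠ 0 := by exact_mod_cast Real.pi_ne_zero
  have hFd : DifferentiableOn ℂ F {s | -b < s.re ∧ s.re < 1 + b} := fun s hs => by
    have h1 : DifferentiableAt ℂ (laplaceTransform φ) (-s) :=
      hS.differentiableAt (by rw [Complex.neg_re]; linarith [hs.2])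
        (by rw [Complex.neg_re]; linarith [hs.1])
    exact (h1.comp (f := fun s => -s) s (by fun_prop)).differentiableWithinAt
  obtain ⟨A, hA0, hA⟩ := hS.exists_norm_le ha hab
  have hFA : ∀ s : ℂ, -a ≤ s.re → s.re ≤ 1 + a → ‖F s‖ * |s.im| ≤ A := fun s h1 h2 => by
    have := hA (-s) (by rw [Complex.neg_re]; linarith) (by rw [Complex.neg_re]; linarith)
    rwa [Complex.neg_im, abs_neg] at this
  -- the prime sums
  have hright := tendsto_integral_right χ (c := 1 + a) (by linarith)
    (hS (b - a) (1 + a) (by linarith) (by rw [abs_of_nonneg (by linarith)]; linarith))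
  have hca : (1 : ℝ) - (1 + a) = -a := by ring
  have hleft := tendsto_integral_left χ⁻¹ (φ := φ) (c := 1 + a) (by linarith)
    (by
      rw [hca]
      exact hS (b - a) (-a) (by linarith) (by rw [abs_of_nonpos (by linarith)]; linarith))
  rw [hca] at hleft
  obtain ⟨hsum₁, hlim₁⟩ := hright
  obtain ⟨hsum₂, hlim₂⟩ := hleft
  -- the critical line
  have hmid := hS b (1 / 2) hb (by simp)
  have hFmid : ∀ t : ℝ, F ((1 / 2 : ℝ) + t * Complex.I) =
      fourierInt (fun x => φ x * (Real.exp (1 / 2 * x) : ℂ)) t := fun t =>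
    laplaceTransform_eq_fourierInt φ (1 / 2) t
  have hFc : Continuous fun t : ℝ => F ((1 / 2 : ℝ) + t * Complex.I) := by
    simp_rw [hFmid]
    exact continuous_fourierInt hmid.integrable
  have hinv : Tendsto (fun T : ℝ => ∫ t : ℝ in -T..T, F ((1 / 2 : ℝ) + t * Complex.I)) atTop
      (𝓝 (2 * Real.pi * φ 0)) := by
    have := hmid.tendsto_integral_fourierInt 0
    simp_rw [hFmid]
    simpa only [Complex.ofReal_zero, mul_zero, zero_mul, neg_zero, Complex.exp_zero, mul_one,
      Real.exp_zero, Complex.ofReal_one] using this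
  have hβ : 0 < (1 / 2 + (parityIndex χ).re) / 2 := by
    linarith [parityIndex_re_nonneg χ]
  obtain ⟨L, hL⟩ := exists_tendsto_integral_digamma_mul hmid hβ
  have hdig : Tendsto (fun T : ℝ => ∫ t : ℝ in -T..T,
      ((Complex.digamma ((1 / 2 + t * Complex.I + parityIndex χ) / 2)).re : ℂ) *
        F ((1 / 2 : ℝ) + t * Complex.I)) atTop (𝓝 L) := by
    refine hL.congr fun T => intervalIntegral.integral_congr fun t _ => ?_
    rw [hFmid, parityArgument_eq]
  have hJ : Tendsto (gammaIntegral χ φ) atTop (𝓝 (1 / (2 * Real.pi) * L)) := by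
    refine (hdig.const_mul (1 / (2 * Real.pi) : ℂ)).congr fun T => ?_
    rw [gammaIntegral_eq]
    simp only [hF]
    push_cast
    rfl
  -- good heights
  obtain ⟨K, hK, hgood⟩ := exists_goodHeight hχ
  choose! τ hτ hτ₁ hτ₂ hτ₃ using hgood
  have hτtop : Tendsto τ atTop atTop := by
    refine tendsto_atTop_mono' atTop ?_ tendsto_id
    filter_upwards [eventually_ge_atTop 3] with T hT using (hτ T hT).1
  -- the horizontal sides tend to zero
  have hhor : ∀ ε : ℝ, |ε| = 1 →
      Tendsto (fun T : ℝ => horizontalTerm χ F a (ε * τ T)) atTop (𝓝 0) := fun ε hε => by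
    have hlim : Tendsto (fun T : ℝ => 2 * K * A * (Real.log T ^ 2 / T)) atTop (𝓝 0) := by
      simpa using (tendsto_log_pow_div_atTop 2).const_mul (2 * K * A)
    refine squeeze_zero_norm' ?_ hlim
    filter_upwards [eventually_ge_atTop 3] with T hT
    have hT1 := (hτ T hT).1
    have hB : 0 ≤ K * Real.log T ^ 2 := by positivity
    refine (norm_horizontalTerm_le ha ha2 (by linarith : 0 < τ T) ?_ hB (hτ₁ T hT) (hτ₂ T hT)
      hFA).trans ?_
    · rw [abs_mul, hε, one_mul, abs_of_pos (by linarith)]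
    · calc 2 * (K * Real.log T ^ 2 * (A / τ T)) ≤ 2 * (K * Real.log T ^ 2 * (A / T)) := by gcongr
        _ = _ := by ring
  have hhor₁ := hhor 1 abs_one
  have hhor₂ := hhor (-1) (by simp)
  simp only [one_mul, neg_one_mul] at hhor₁ hhor₂
  -- the contour identity at good heights
  have hident : ∀ᶠ T : ℝ in atTop, sumOverZerosUpTo χ F (τ T) =
      deltaOne q * (F 0 + F 1) + 1 / (2 * Real.pi) *
        ((Real.log (q / Real.pi) : ℂ) * (∫ t : ℝ in -τ T..τ T, F ((1 / 2 : ℝ) + t * Complex.I)) +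
          ∫ t : ℝ in -τ T..τ T,
            ((Complex.digamma ((1 / 2 + t * Complex.I + parityIndex χ) / 2)).re : ℂ) *
              F ((1 / 2 : ℝ) + t * Complex.I)) +
      1 / (2 * Real.pi) * (∫ t : ℝ in -τ T..τ T, deriv χ.LFunction ((1 + a : ℝ) + t * Complex.I) /
        χ.LFunction ((1 + a : ℝ) + t * Complex.I) * F ((1 + a : ℝ) + t * Complex.I)) +
      1 / (2 * Real.pi) * (∫ t : ℝ in -τ T..τ T,
        deriv χ⁻¹.LFunction (1 - ((-a : ℝ) + t * Complex.I)) /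
        χ⁻¹.LFunction (1 - ((-a : ℝ) + t * Complex.I)) * F ((-a : ℝ) + t * Complex.I)) +
      1 / (2 * Real.pi * Complex.I) *
        (horizontalTerm χ F a (-τ T) - horizontalTerm χ F a (τ T)) := by
    filter_upwards [eventually_ge_atTop 3] with T hT
    have hid := contour_identity hχ hFd ha hab ha2
      (by linarith [(hτ T hT).1] : 0 < τ T) (hτ₁ T hT) (hτ₂ T hT)
      (finite_zerosUpTo hχ (τ T)).toFinset fun ρ => Set.Finite.mem_toFinset _
    rw [integral_gammaTerm_add χ hFc, ← sumOverZerosUpTo_eq hχ] at hid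
    have hI := Complex.I_ne_zero
    have h2 : (2 * Real.pi * Complex.I : ℂ) ≠ 0 := by simp [hpi]
    rw [← mul_right_inj' h2, hid]
    field_simp
  have hZτ := ((((tendsto_const_nhds (x := deltaOne q * (F 0 + F 1))).add
    ((((hinv.comp hτtop).const_mul (Real.log (q / Real.pi) : ℂ)).add
      (hdig.comp hτtop)).const_mul (1 / (2 * Real.pi) : ℂ))).add
    ((hlim₁.comp hτtop).const_mul (1 / (2 * Real.pi) : ℂ))).add
    ((hlim₂.comp hτtop).const_mul (1 / (2 * Real.pi) : ℂ))).add
    ((hhor₂.sub hhor₁).const_mul (1 / (2 * Real.pi * Complex.I)))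
  have hZτ' := hZτ.congr' (f₂ := fun T => sumOverZerosUpTo χ F (τ T)) (by
    filter_upwards [hident] with T hT
    rw [hT]
    rfl)
  -- from good heights to all heights
  have hdiff : Tendsto (fun T : ℝ => sumOverZerosUpTo χ F (τ T) - sumOverZerosUpTo χ F T) atTop
      (𝓝 0) := by
    have hlim : Tendsto (fun T : ℝ => K * A * (Real.log T ^ 1 / T)) atTop (𝓝 0) := by
      simpa using (tendsto_log_pow_div_atTop 1).const_mul (K * A)
    refine squeeze_zero_norm' ?_ hlim
    filter_upwards [eventually_ge_atTop 3] with T hT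
    refine (norm_sumOverZerosUpTo_sub_le hχ (by linarith) (hτ T hT) hA0
      (fun ρ hρ => hFA ρ (by linarith [hρ.1]) (by linarith [hρ.2.1])) (hτ₃ T hT)).trans_eq ?_
    ring
  have hZ := hZτ'.sub hdiff
  simp only [sub_sub_cancel, sub_zero] at hZ
  refine ⟨hsum₁, hsum₂, _, _, hZ, hJ, ?_⟩
  simp only [hF]
  field_simp
  ring

end

theorem mainTheorem2 (φ : ℝ → ℂ) (b : ℝ) (hb : 0 < b)
    (hA : PiecewiseC1WithMeanValue φ) (hB : ExpDecay φ b) :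
    -- the Laplace transform exists, is holomorphic in the strip, and is `O(1/|t|)` there
    (∀ a : ℝ, 0 < a → a < b → a < 1 →
      (∀ s : ℂ, -(1 + a) ≤ s.re → s.re ≤ a →
        MeasureTheory.Integrable (fun x : ℝ => φ x * Complex.exp (-s * x))) ∧
      DifferentiableOn ℂ (laplaceTransform φ) {s : ℂ | -(1 + a) < s.re ∧ s.re < a} ∧
      ∃ C : ℝ, ∀ s : ℂ, -(1 + a) ≤ s.re → s.re ≤ a → s.im ≠ 0 →
        ‖laplaceTransform φ s‖ ≤ C / |s.im|) ∧
    -- the explicit formula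
    (∀ (q : ℕ) [NeZero q] (χ : DirichletCharacter ℂ q), χ.IsPrimitive →
      Summable (fun n : ℕ =>
        (ArithmeticFunction.vonMangoldt n : ℂ) * χ n * φ (Real.log n)) ∧
      Summable (fun n : ℕ =>
        (ArithmeticFunction.vonMangoldt n : ℂ) * starRingEnd ℂ (χ n) / n * φ (-Real.log n)) ∧
      (∀ T : ℝ, (zerosUpTo χ T).Finite) ∧
      ∃ Z J : ℂ,
        Tendsto (sumOverZerosUpTo χ (fun ρ => laplaceTransform φ (-ρ))) atTop (𝓝 Z) ∧
        Tendsto (gammaIntegral χ φ) atTop (𝓝 J) ∧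
        ∑' n : ℕ, (ArithmeticFunction.vonMangoldt n : ℂ) * χ n * φ (Real.log n) =
          deltaOne q * (laplaceTransform φ (-1) + laplaceTransform φ 0)
          - Z
          + φ 0 * (Real.log (q / Real.pi) : ℂ)
          - ∑' n : ℕ, (ArithmeticFunction.vonMangoldt n : ℂ) * starRingEnd ℂ (χ n) / n
              * φ (-Real.log n)
          + J) := by
  obtain ⟨S, C, hS⟩ := exists_stripDecay hA hB
  refine ⟨fun a ha hab _ => ⟨fun s h1 h2 => hS.integrable (by linarith) (by linarith),
    fun s hs => (hS.differentiableAt (by linarith [hs.1])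
      (by linarith [hs.2])).differentiableWithinAt, ?_⟩, fun q _ χ hχ => ?_⟩
  · obtain ⟨B, -, hB⟩ := hS.exists_norm_le ha hab
    exact ⟨B, fun s h1 h2 him => (le_div_iff₀ (abs_pos.2 him)).2 (hB s h1 h2)⟩
  · have hconj : ∀ n : ℕ, starRingEnd ℂ (χ n) = χ⁻¹ n := fun n => MulChar.star_apply' χ n
    obtain ⟨h1, h2, Z, J, hZ, hJ, heq⟩ := explicit_formula hχ hb hS
    simp only [hconj]
    refine ⟨h1, h2, finite_zerosUpTo hχ, Z, J, hZ, hJ, ?_⟩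
    rw [heq, neg_zero]
    ring
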